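/- **Theorem (Optimistic Succinctness).** Let $\delta\in(0,1)$, $a\ge 8/\delta^2$, $c>3$ and an integer $Q\ge 1$ be fixed, together with the size of the fixed header fields of a block, the size of a link, and a bound on the size of the transactions of a block. Then there are constants $K,C\in\mathbb R$ and $\eta>0$, depending only on these, such that the following holds for all security parameters $k,k'\in\mathbb N$. *Model.* All nodes are honest, communication is synchronous, and blocks are mined according to a Poisson process $N_t$ of rate $\lambda>0$, each block being appended to the tip of the common chain; so at time $t$ the complete chain $\mathcal C_t$ consists of the genesis block $0$ and the blocks $1,\dots,N_t$, and has length $B_t=N_t+1$. The hashes of the mined blocks are independent of each other and of the mining times and uniform on $[0,2^{-T}]$. A block is a level-$\mu$ superblock if its hash is at most $2^{-(T+\mu)}$; genesis is a superblock of every level. For a set $\mathcal D$ of blocks, $\mathcal D\uparrow^\mu$ is the sequence of its level-$\mu$ superblocks, $\mathcal D\{i:j\}$ is the set of its blocks with index in $[i,j)$, and $\mathcal D[-n]$, $\mathcal D[-n:]$ are its $n$-th last block and its last $n$ blocks. The interlink of a block has one link for each level that occurs among the blocks strictly between genesis and it, and one link to genesis. *Good superchains.* The downchain $\mathcal C'{\downarrow}$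 of a level-$\mu$ superchain $\mathcal C'$ is the segment of the complete chain from the block after the last level-$\mu$ superblock preceding $\mathcal C'$ (from genesis if there is none) up to, but excluding, the last block of $\mathcal C'$. A trimmed chain of a segment $X$ is a set $\mathcal P'\subseteq X$ with level ranges $[L'_f(\nu),L'_l(\nu)]$, $\nu\ge0$, of decreasing levels, each beginning at the last block of the preceding one (of level $\nu+1$) or right after it, such that level range $\nu$ retains all level-$\nu$ superblocks of $X$ in it. $\mathcal C'$ is *good* for $(\delta,g)$ at level $\mu$ if (i) $|\mathcal C'[-g':]|\ge(1-\delta)2^{-\mu}|\mathcal C'[-g':]{\downarrow}|$ for all integers $g'\ge g$, and (ii) for every trimmed chain $\mathcal P'$ of $\mathcal C'{\downarrow}$ and all $\mu_1\le\mu'\le\mu$ and $L'_f(\mu')\le l\le L'_l(\mu')$, if $2^{\mu_1}|\mathcal P'\{l:L'_l(\mu')+1\}\uparrow^{\mu_1}|+\sum_{\nu<\mu'}2^{\nu}|\mathcal P'\{L'_f(\nu):L'_l(\nu)+1\}\uparrow^{\nu}|\ge 2^\mu g$ then $\mathcal P'$ contains a level-$\mu$ superblock. *Protocol.* A hybrid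 node keeps a set $\mathcal P\subseteq\mathcal C$ of retained blocks, a trimming point $B'$, a highest level range $\mu_h$ and level-range functions $L_f,L_l$; initially $\mathcal P=\{0\}$, $B'=1$, $\mu_h=0$, $L_f=L_l=0$. New blocks are added to $\mathcal P$. Put $W(\mu)=2^\mu|\mathcal P\{L_f(\mu):L_l(\mu)+1\}\uparrow^\mu|$, $S(\mu)=\sum_{\mu\le\nu\le\max(\mu,\mu_h)}W(\nu)$, $\Delta=k'+a\log(S(0)+|\mathcal P\{B':\}|)$, $g(\mu)=k+a\log S(\mu)$ and $f(\mu)=\lceil c\,g(\mu)\rceil$. Whenever the chain has grown by $Q$ blocks, let $B''=\max(B',\lfloor b-\Delta\rfloor)$ with $b$ the index of the last block. For $\mu=\mu_h+1,\dots,1$, until a success: if $E=\mathcal P\{L_f(\mu):B''\}\uparrow^\mu$ has at least $f=f(\mu)$ blocks and is good for $(\delta,g(\mu))$ at level $\mu$, trim at level $\mu$: set $A=E[-f]$; for $\mu'=\mu-1,\dots,0$ add $\alpha=\mathcal P\{A:B''\}\uparrow^{\mu'}$ to $E$ and, if $|\alpha|\ge f$ and $\alpha$ is good for $(\delta,g(\mu))$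 at level $\mu'$, set $A=\alpha[-f]$. The trim succeeds if the last condition holds at $\mu'=0$; then $\mathcal P$ is replaced by $\mathcal P\{:L_f(\mu)\}\cup E\cup\mathcal P\{B'':\}$, $B'$ by $B''$, $\mu_h$ by $\max(\mu_h,\mu)$, and $L_l(\mu)$ as well as $L_f(\nu),L_l(\nu)$ for all $\nu<\mu$ by $B''-1$. Otherwise nothing changes. *Conclusion.* The cold storage for $\mathcal P$ is the total size of the headers (with interlinks) of its blocks and of the transactions of the blocks of the untrimmed tail $\mathcal P\{B':\}$ (the state at the trimming point is not counted). Except with probability at most $Ce^{-\eta k}$, the following holds at all times $t\ge0$ simultaneously, with $B=B_t$ and $L=k+k'+\log B$: the cold storage is at most $K L^4$, the highest level range $\mu_h$ is at most $KL$, each level range $\mathcal P\{L_f(\mu):L_l(\mu)+1\}$ has at most $KL^2$ blocks, the untrimmed tail has at most $KL$ blocks, and each interlink in the chain has at most $KL$ links. In particular, for fixed security parameters the cold storage is $O(\log^4 B)$, with a constant that does not depend on them once $\log B\ge k+k'$. -/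

import Mathlib

open MeasureTheory ProbabilityTheory
open scoped NNReal

namespace HybridNode

/-! ### Superblocks and upchains

A chain is the sequence of its blocks, a block is named by its index, and block `0` is genesis.
The relation `sb μ b` says that block `b` is a level-`μ` superblock. -/

/-- Block `b` is a level-`μ` superblock when its hash is at most `2 ^ (-(T + μ))`;
genesis is a superblock of every level. -/
def IsSuper (T : ℕ) (hash : ℕ → ℝ) (μ b : ℕ) : Prop :=
  b = 0 ∨ hash b ≤ ((2 : ℝ) ^ (T + μ))⁻¹

/-- The level-`μ` superblocks of a set of blocks. -/
noncomputable def up (sb : ℕ → ℕ → Prop) (μ : ℕ) (s : Finset ℕ) : Finset ℕ :=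
  open Classical in s.filter (fun b => sb μ b)

/-- `P{i:j}`: the blocks of `s` whose index `b` in the complete chain satisfies `i ≤ b < j`. -/
def seg (s : Finset ℕ) (i j : ℕ) : Finset ℕ :=
  s.filter (fun b => i ≤ b ∧ b < j)

/-- `s[-n:]`: the last `n` blocks of `s` (all of `s` if it has at most `n` blocks). -/
def lastN (s : Finset ℕ) (n : ℕ) : Finset ℕ :=
  s.filter (fun b => (s.filter (fun x => b < x)).card < n)

/-- `s[-n]`: the `n`-th block of `s`, counted from its end (used when `1 ≤ n ≤ |s|`). -/
noncomputable def nthLast (s : Finset ℕ) (n : ℕ) : ℕ :=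
  sInf (lastN s n : Set ℕ)

/-- First block of the downchain of a level-`μ` superchain that starts at block `b`: the successor
of the previous level-`μ` superblock, and `0` when there is none. -/
noncomputable def downStart (sb : ℕ → ℕ → Prop) (μ b : ℕ) : ℕ :=
  (up sb μ (Finset.range b)).sup Nat.succ

/-- The downchain of a level-`μ` superchain `s`, a segment of the complete chain. -/
noncomputable def downchain (sb : ℕ → ℕ → Prop) (μ : ℕ) (s : Finset ℕ) : Finset ℕ :=
  if h : s.Nonempty then Finset.Ico (downStart sb μ (s.min' h)) (s.max' h) else ∅

/-! ### Good superchains -/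

/-- `(δ, g)`-superquality of a level-`μ` superchain. -/
def Superquality (sb : ℕ → ℕ → Prop) (δ g : ℝ) (μ : ℕ) (s : Finset ℕ) : Prop :=
  ∀ g' : ℕ, g ≤ g' →
    (1 - δ) * ((2 : ℝ) ^ μ)⁻¹ * ((downchain sb μ (lastN s g')).card : ℝ) ≤ ((lastN s g').card : ℝ)

/-- `P'`, with level-range functions `Lf` and `Ll`, is a trimmed chain of the segment `X` of the
complete chain: each level range begins where the range of the next higher level ends (at its last
block or right after it), and level range `ν` retains every level-`ν` superblock of `X` in it.
The first level range may begin anywhere. -/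
structure IsTrimmed (sb : ℕ → ℕ → Prop) (X P' : Finset ℕ) (Lf Ll : ℕ → ℕ) : Prop where
  subset : P' ⊆ X
  le : ∀ ν, Lf ν ≤ Ll ν
  begin_ge : ∀ ν, Ll (ν + 1) ≤ Lf ν
  begin_le : ∀ ν, Lf ν ≤ Ll (ν + 1) + 1
  retains : ∀ ν, ∀ b ∈ X, Lf ν ≤ b → b ≤ Ll ν → sb ν b → b ∈ P'

/-- The level-`μ` superchain with underlying chain `X` is dominant with parameter `g`: a trimmed
chain of `X` whose weight to the right of one of its blocks `l` is at least `2 ^ μ * g` has a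
level-`μ` superblock. The first level range `μ'` may be weighed at a lower level `μ₁`. -/
def Dominant (sb : ℕ → ℕ → Prop) (X : Finset ℕ) (μ : ℕ) (g : ℝ) : Prop :=
  ∀ (P' : Finset ℕ) (Lf Ll : ℕ → ℕ), IsTrimmed sb X P' Lf Ll →
    ∀ μ₁ μ' l : ℕ, μ₁ ≤ μ' → μ' ≤ μ → Lf μ' ≤ l → l ≤ Ll μ' →
      (2 : ℝ) ^ μ * g ≤ (2 : ℝ) ^ μ₁ * ((up sb μ₁ (seg P' l (Ll μ' + 1))).card : ℝ)
        + ∑ ν ∈ Finset.range μ', (2 : ℝ) ^ ν * ((up sb ν (seg P' (Lf ν) (Ll ν + 1))).card : ℝ) →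
      1 ≤ (up sb μ P').card

/-- A level-`μ` superchain is good if it has superquality and is dominant in its downchain. -/
def Good (sb : ℕ → ℕ → Prop) (δ g : ℝ) (μ : ℕ) (s : Finset ℕ) : Prop :=
  Superquality sb δ g μ s ∧ Dominant sb (downchain sb μ s) μ g

/-! ### The trimming protocol -/

/-- Parameters of the protocol: the security parameters and the trimming interval `Q`. -/
structure Params where
  k : ℕ
  k' : ℕ
  a : ℝ
  c : ℝ
  δ : ℝ
  Q : ℕ

/-- What a hybrid node keeps track of: the blocks `P` that it retains, the trimming point, the
highest level range and the level-range functions. -/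
structure TrimState where
  P : Finset ℕ
  trimPt : ℕ
  top : ℕ
  Lf : ℕ → ℕ
  Ll : ℕ → ℕ

/-- The blocks `P{L_f(μ) : L_l(μ)+1}` of level range `μ`. -/
def TrimState.levelRange (st : TrimState) (μ : ℕ) : Finset ℕ :=
  seg st.P (st.Lf μ) (st.Ll μ + 1)

/-- The untrimmed tail `P{B':}`. -/
def TrimState.tail (st : TrimState) : Finset ℕ :=
  st.P.filter (fun b => st.trimPt ≤ b)

/-- The weight `W(P, μ)` of level range `μ`. -/
noncomputable def weight (sb : ℕ → ℕ → Prop) (st : TrimState) (μ : ℕ) : ℕ :=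
  2 ^ μ * (up sb μ (st.levelRange μ)).card

/-- The cumulative weight `S(P, μ)`, from genesis up to and including level range `μ`. For `μ`
above the highest level range, level range `μ` consists of genesis alone and has weight `2 ^ μ`. -/
noncomputable def cumWeight (sb : ℕ → ℕ → Prop) (st : TrimState) (μ : ℕ) : ℕ :=
  ∑ ν ∈ Finset.Icc μ (max μ st.top), weight sb st ν

/-- The required length of the untrimmed tail. -/
noncomputable def tailLen (sb : ℕ → ℕ → Prop) (p : Params) (st : TrimState) : ℝ :=
  p.k' + p.a * Real.log ((cumWeight sb st 0 : ℝ) + (st.tail.card : ℝ))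

/-- The goodness parameter `g(P, μ)`. -/
noncomputable def gPar (sb : ℕ → ℕ → Prop) (p : Params) (st : TrimState) (μ : ℕ) : ℝ :=
  p.k + p.a * Real.log (cumWeight sb st μ : ℝ)

/-- The number `f(P, μ) = c * g(P, μ)` of superblocks, rounded up to an integer. -/
noncomputable def fPar (sb : ℕ → ℕ → Prop) (p : Params) (st : TrimState) (μ : ℕ) : ℕ :=
  ⌈p.c * gPar sb p st μ⌉₊

/-- The loop of `trim` over the levels `n - 1, …, 0`, on the chain `D` with trimming point `B'`.
`E` collects the retained blocks, `A` is the current starting block, and `ok` says whether the last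
upchain looked at was long enough and good. -/
noncomputable def trimLoop (sb : ℕ → ℕ → Prop) (δ g : ℝ) (f : ℕ) (D : Finset ℕ) (B' : ℕ) :
    ℕ → Finset ℕ → ℕ → Prop → Finset ℕ × Prop
  | 0, E, _, ok => (E, ok)
  | n + 1, E, A, _ =>
    let α := up sb n (seg D A B')
    let ok := f ≤ α.card ∧ Good sb δ g n α
    open Classical in
    trimLoop sb δ g f D B' n (E ∪ α) (if ok then nthLast α f else A) ok

/-- The function `trim` at level `μ` with trimming point `B'`: the new state if it succeeds. -/
noncomputable def trim (sb : ℕ → ℕ → Prop) (p : Params) (st : TrimState) (B' μ : ℕ) :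
    Option TrimState :=
  let g := gPar sb p st μ
  let f := fPar sb p st μ
  let E₀ := up sb μ (seg st.P (st.Lf μ) B')
  let r := trimLoop sb p.δ g f st.P B' μ E₀ (nthLast E₀ f) False
  open Classical in
  if r.2 then
    some
      { P := st.P.filter (fun b => b < st.Lf μ) ∪ r.1 ∪ st.P.filter (fun b => B' ≤ b)
        trimPt := B'
        top := max st.top μ
        Lf := fun ν => if ν < μ then B' - 1 else st.Lf ν
        Ll := fun ν => if ν ≤ μ then B' - 1 else st.Ll ν }
  else none

/-- The trimming attempt over the levels `n, n - 1, …, 1`, stopping at the first success. -/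
noncomputable def attemptFrom (sb : ℕ → ℕ → Prop) (p : Params) (st : TrimState) (B' : ℕ) :
    ℕ → TrimState
  | 0 => st
  | n + 1 =>
    open Classical in
    if fPar sb p st (n + 1) ≤ (up sb (n + 1) (seg st.P (st.Lf (n + 1)) B')).card ∧
        Good sb p.δ (gPar sb p st (n + 1)) (n + 1) (up sb (n + 1) (seg st.P (st.Lf (n + 1)) B'))
    then (trim sb p st B' (n + 1)).getD (attemptFrom sb p st B' n)
    else attemptFrom sb p st B' n

/-- The trimming point of an attempt: the index of the last block minus the required tail length,
rounded down. Trimmed blocks are gone, so the trimming point never moves back. -/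
noncomputable def newTrimPt (sb : ℕ → ℕ → Prop) (p : Params) (st : TrimState) : ℕ :=
  max st.trimPt ⌊((st.P.sup (fun b => b) : ℕ) : ℝ) - tailLen sb p st⌋₊

/-- One trimming attempt. -/
noncomputable def attempt (sb : ℕ → ℕ → Prop) (p : Params) (st : TrimState) : TrimState :=
  attemptFrom sb p st (newTrimPt sb p st) (st.top + 1)

/-- The state of a hybrid node after `n` blocks have been appended to genesis, so when the complete
chain is `0, 1, …, n`. Trimming is attempted whenever the chain has grown by `Q` blocks. -/
noncomputable def node (sb : ℕ → ℕ → Prop) (p : Params) : ℕ → TrimState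
  | 0 => { P := {0}, trimPt := 1, top := 0, Lf := fun _ => 0, Ll := fun _ => 0 }
  | n + 1 =>
    let st : TrimState := { node sb p n with P := insert (n + 1) (node sb p n).P }
    if p.Q ∣ n + 1 then attempt sb p st else st

/-! ### Cold storage -/

/-- The number of links in the interlink of block `b`: one for each level of the superblocks
between genesis and `b`, and one to genesis. -/
noncomputable def interlinkSize (sb : ℕ → ℕ → Prop) (b : ℕ) : ℕ :=
  {μ : ℕ | ∃ j, 0 < j ∧ j < b ∧ sb μ j}.ncard + 1

/-- Size of the trimmed chain: each retained block has a header, with fixed fields of total size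
`hdr` and links of size `link`; the blocks of the untrimmed tail also have their transactions, of
size `tx b`. -/
noncomputable def storage (sb : ℕ → ℕ → Prop) (hdr link : ℕ) (tx : ℕ → ℕ) (st : TrimState) : ℕ :=
  ∑ b ∈ st.P, (hdr + link * interlinkSize sb b) + ∑ b ∈ st.tail, tx b

/-! ### The stochastic model with honest nodes only -/

/-- All nodes are honest and mine at total rate `rate`. `N t` blocks are mined up to time `t`, each
appended to the tip of the common longest chain, so at time `t` the complete chain consists of
genesis and the blocks `1, …, N t`. The hashes of the mined blocks are independent of each other
and of the mining times, and uniform on the valid hashes `[0, 2 ^ (-T)]`. -/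
structure HonestMining {Ω : Type*} [MeasurableSpace Ω] (Pr : Measure Ω) (rate : ℝ≥0) (T : ℕ)
    (N : ℝ≥0 → Ω → ℕ) (hash : ℕ → Ω → ℝ) : Prop where
  counts : ∀ ω, Monotone (fun t => N t ω)
  law : ∀ t, HasLaw (N t) (poissonMeasure (rate * t)) Pr
  indep_increments : HasIndepIncrements N Pr
  uniform : ∀ i, pdf.IsUniform (hash i) (Set.Icc 0 (((2 : ℝ) ^ T)⁻¹)) Pr volume
  indep_hash : iIndepFun hash Pr
  indep : IndepFun (fun ω t => N t ω) (fun ω i => hash i ω) Pr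

end HybridNode

namespace HybridNode

/-! ### Counting superblocks -/

/-! All the randomness is confined to one event, `Typical`, about the sequence of hashes. Its
complement has probability exponentially small in `k`, and on it every bound is deterministic and
holds at every chain length, hence at all times at once. The unit of measurement is `scale k a y`,
that is k + a log y: because `a` is large, a failure probability exp(-s * scale) beats a union bound
over positions and levels and still leaves a factor exp(-ηk).

In a typical chain, level-ν superblocks have density about 2^(-ν), up to errors of order `scale`.
The weight of a level range is therefore roughly its length, and since the level ranges tile the
chain, the cumulative weight equals the current position up to a factor of order `scale`
(`Core.cumWeight_le`, `Core.le_mul_cumWeight`). After taking logarithms, the parameter g computed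
from the trimmed chain alone is `scale` up to a factor 1 ± ε.

The heart is `Core.success`: a trim whose starting superchain has f superblocks always succeeds. The
danger is that earlier trims removed superblocks that the loop now needs. The window invariant in
`Core` records that the earlier trim kept level j from a point with about f superblocks of level j+1
on. If fewer than f such superblocks are there now, the positions then and now differ by a factor of
order `scale`, so the two values of f nearly agree. The missing piece then has at most r * scale
superblocks of level j+1, and by `Typical.good` such a piece cannot spoil superquality.

Consequently a level at which an attempt fails has fewer than f superblocks. `attempt_spec` and
`node_spec` turn this into invariants: the top level is O(scale), a level range has O(scale^2)
blocks (O(scale) for each round of the loop), and the tail is O(L). With O(L) links per header,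
`exists_storage_bound` multiplies these to L^4.

Dominance quantifies over all trimmed chains, too many for a direct union bound. In
`dominant_of_not_survives` a violation is encoded as a word of levels that can be read greedily off
the chain before any level-μ superblock appears. A word of N chunks survives with probability at
most exp(-N) (`UniformHashes.prob_survives_le`), while only 5^(μ+1) * (5/4)^N chunk vectors have to
be considered. The other properties in `Typical` are Chernoff bounds, apart from the elementary ones
and the tail bound for the level of one block. -/

theorem mem_up {sb : ℕ → ℕ → Prop} {μ b : ℕ} {s : Finset ℕ} : b ∈ up sb μ s ↔ b ∈ s ∧ sb μ b := by
  simp [up]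

theorem mem_seg {s : Finset ℕ} {i j b : ℕ} : b ∈ seg s i j ↔ b ∈ s ∧ i ≤ b ∧ b < j := by
  simp [seg]

theorem up_mono (sb : ℕ → ℕ → Prop) (μ : ℕ) {s t : Finset ℕ} (h : s ⊆ t) : up sb μ s ⊆ up sb μ t :=
  fun _ hb => mem_up.2 ⟨h (mem_up.1 hb).1, (mem_up.1 hb).2⟩

/-- The number of level-`μ` superblocks of the complete chain with index in `[i, j)`. -/
noncomputable def cnt (sb : ℕ → ℕ → Prop) (μ i j : ℕ) : ℕ := (up sb μ (Finset.Ico i j)).card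

theorem cnt_mono (sb : ℕ → ℕ → Prop) (μ : ℕ) {i j i' j' : ℕ} (hi : i' ≤ i) (hj : j ≤ j') :
    cnt sb μ i j ≤ cnt sb μ i' j' :=
  Finset.card_le_card (up_mono sb μ (Finset.Ico_subset_Ico hi hj))

theorem cnt_le (sb : ℕ → ℕ → Prop) (μ i j : ℕ) : cnt sb μ i j ≤ j - i := by
  have : cnt sb μ i j ≤ (Finset.Ico i j).card :=
    Finset.card_le_card fun _ hb => (mem_up.1 hb).1
  simpa using this

theorem cnt_eq_zero (sb : ℕ → ℕ → Prop) (μ : ℕ) {i j : ℕ} (h : j ≤ i) : cnt sb μ i j = 0 := by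
  have := cnt_le sb μ i j
  omega

theorem cnt_add (sb : ℕ → ℕ → Prop) (μ : ℕ) {i m j : ℕ} (him : i ≤ m) (hmj : m ≤ j) :
    cnt sb μ i m + cnt sb μ m j = cnt sb μ i j := by
  classical
  unfold cnt
  rw [← Finset.card_union_of_disjoint]
  · congr 1
    ext b
    simp only [Finset.mem_union, mem_up, Finset.mem_Ico]
    constructor
    · rintro (⟨h, h'⟩ | ⟨h, h'⟩) <;> exact ⟨by omega, h'⟩
    · rintro ⟨h, h'⟩
      by_cases hb : b < m
      · exact Or.inl ⟨by omega, h'⟩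
      · exact Or.inr ⟨by omega, h'⟩
  · rw [Finset.disjoint_left]
    intro b hb hb'
    simp only [mem_up, Finset.mem_Ico] at hb hb'
    omega

theorem cnt_le_add (sb : ℕ → ℕ → Prop) (μ i m j : ℕ) :
    cnt sb μ i j ≤ cnt sb μ i m + (j - m) := by
  classical
  by_cases h1 : i ≤ m
  · by_cases h2 : m ≤ j
    · have := cnt_add sb μ h1 h2
      have := cnt_le sb μ m j
      omega
    · have := cnt_mono sb μ (le_refl i) (show j ≤ m by omega)
      omega
  · have := cnt_le sb μ i j
    omega

theorem cnt_anti {sb : ℕ → ℕ → Prop} (hanti : ∀ μ ν b, μ ≤ ν → sb ν b → sb μ b) {μ ν : ℕ}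
    (h : μ ≤ ν) (i j : ℕ) : cnt sb ν i j ≤ cnt sb μ i j :=
  Finset.card_le_card fun _ hb =>
    mem_up.2 ⟨(mem_up.1 hb).1, hanti _ _ _ h (mem_up.1 hb).2⟩

/-- A level-`μ` superchain that retains all superblocks of `[i, j)`. -/
theorem cnt_le_card {sb : ℕ → ℕ → Prop} {μ i j : ℕ} {s : Finset ℕ}
    (h : ∀ b, i ≤ b → b < j → sb μ b → b ∈ s) : cnt sb μ i j ≤ s.card :=
  Finset.card_le_card fun b hb => by
    obtain ⟨h1, h2⟩ := mem_up.1 hb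
    rw [Finset.mem_Ico] at h1
    exact h b h1.1 h1.2 h2

theorem card_le_cnt {sb : ℕ → ℕ → Prop} {μ i j : ℕ} {s : Finset ℕ}
    (h : ∀ b ∈ s, i ≤ b ∧ b < j ∧ sb μ b) : s.card ≤ cnt sb μ i j :=
  Finset.card_le_card fun b hb => by
    obtain ⟨h1, h2, h3⟩ := h b hb
    exact mem_up.2 ⟨Finset.mem_Ico.2 ⟨h1, h2⟩, h3⟩

/-! ### The last blocks of a set -/

theorem lastN_subset (s : Finset ℕ) (n : ℕ) : lastN s n ⊆ s := Finset.filter_subset _ _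

theorem mem_lastN_of_le {s : Finset ℕ} {n b b' : ℕ} (hb : b ∈ lastN s n) (hb' : b' ∈ s)
    (h : b ≤ b') : b' ∈ lastN s n := by
  simp only [lastN, Finset.mem_filter] at hb ⊢
  refine ⟨hb', lt_of_le_of_lt (Finset.card_le_card ?_) hb.2⟩
  intro x hx
  simp only [Finset.mem_filter] at hx ⊢
  exact ⟨hx.1, by omega⟩

/-- The number of later elements is an injective rank on `s` with image an initial segment, and
`lastN` is cut out by rank less than `n`. -/
theorem card_lastN (s : Finset ℕ) (n : ℕ) : (lastN s n).card = min n s.card := by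
  classical
  set rank : ℕ → ℕ := fun b => (s.filter (fun x => b < x)).card with hrank
  have hlt : ∀ b ∈ s, ∀ b' ∈ s, b < b' → rank b' < rank b := by
    intro b _ b' hb' h
    refine Finset.card_lt_card ⟨?_, fun hsub => ?_⟩
    · intro x hx
      simp only [Finset.mem_filter] at hx ⊢
      exact ⟨hx.1, by omega⟩
    · have : b' ∈ s.filter (fun x => b' < x) := hsub (by simp [hb', h])
      simp at this
  have hinj : Set.InjOn rank s := by
    intro b hb b' hb' h
    rcases lt_trichotomy b b' with h1 | h1 | h1
    · exact absurd h (hlt b hb b' hb' h1).ne'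
    · exact h1
    · exact absurd h (hlt b' hb' b hb h1).ne
  have himg : s.image rank = Finset.range s.card := by
    refine Finset.eq_of_subset_of_card_le ?_ ?_
    · intro r hr
      obtain ⟨b, hb, rfl⟩ := Finset.mem_image.1 hr
      refine Finset.mem_range.2 (Finset.card_lt_card ⟨Finset.filter_subset _ _, fun hsub => ?_⟩)
      have := hsub hb
      simp at this
    · rw [Finset.card_range, Finset.card_image_of_injOn hinj]
  have h1 : (lastN s n).image rank = Finset.range (min n s.card) := by
    ext r
    simp only [Finset.mem_image, lastN, Finset.mem_filter, Finset.mem_range, lt_min_iff]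
    constructor
    · rintro ⟨b, ⟨hb, hb'⟩, rfl⟩
      exact ⟨hb', by simpa using (himg ▸ Finset.mem_image_of_mem rank hb : rank b ∈ Finset.range _)⟩
    · rintro ⟨h, h'⟩
      have : r ∈ s.image rank := by rw [himg]; simpa using h'
      obtain ⟨b, hb, rfl⟩ := Finset.mem_image.1 this
      exact ⟨b, ⟨hb, h⟩, rfl⟩
  rw [← Finset.card_image_of_injOn (hinj.mono (by exact_mod_cast lastN_subset s n)), h1,
    Finset.card_range]

theorem nthLast_mem_lastN {s : Finset ℕ} {n : ℕ} (h1 : 1 ≤ n) (h2 : n ≤ s.card) :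
    nthLast s n ∈ lastN s n := by
  have hne : (lastN s n : Set ℕ).Nonempty := by
    have : 0 < (lastN s n).card := by rw [card_lastN]; omega
    exact_mod_cast Finset.card_pos.1 this
  exact_mod_cast Nat.sInf_mem hne

theorem nthLast_mem {s : Finset ℕ} {n : ℕ} (h1 : 1 ≤ n) (h2 : n ≤ s.card) : nthLast s n ∈ s :=
  lastN_subset s n (nthLast_mem_lastN h1 h2)

theorem card_filter_nthLast_le {s : Finset ℕ} {n : ℕ} (h1 : 1 ≤ n) (h2 : n ≤ s.card) :
    (s.filter (fun b => nthLast s n ≤ b)).card = n := by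
  have : s.filter (fun b => nthLast s n ≤ b) = lastN s n := by
    ext b
    constructor
    · intro hb
      rw [Finset.mem_filter] at hb
      exact mem_lastN_of_le (nthLast_mem_lastN h1 h2) hb.1 hb.2
    · intro hb
      exact Finset.mem_filter.2 ⟨lastN_subset s n hb, Nat.sInf_le (by exact_mod_cast hb)⟩
  rw [this, card_lastN]
  omega

/-- The `n`-th last block of a superchain which retains all superblocks of `[i, j)`, when there are
at least `n` of these. -/
theorem cnt_nthLast {sb : ℕ → ℕ → Prop} {μ c j n : ℕ} {s : Finset ℕ} (h1 : 1 ≤ n)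
    (hs : ∀ b ∈ s, b < j ∧ sb μ b) (hc : ∀ b, c ≤ b → b < j → sb μ b → b ∈ s)
    (hn : n ≤ cnt sb μ c j) :
    c ≤ nthLast s n ∧ nthLast s n < j ∧ cnt sb μ (nthLast s n) j = n := by
  have h2 : n ≤ s.card := hn.trans (cnt_le_card hc)
  have hA := nthLast_mem h1 h2
  have hcard := card_filter_nthLast_le h1 h2
  have hcA : c ≤ nthLast s n := by
    by_contra hlt
    push Not at hlt
    -- If the `n`-th last block preceded `c`, it and all superblocks from `c` on would be more than
    -- `n` blocks among the last `n`.
    have : (up sb μ (Finset.Ico c j)).card < (s.filter (fun b => nthLast s n ≤ b)).card := by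
      refine Finset.card_lt_card ⟨?_, fun hsub => ?_⟩
      · intro b hb
        obtain ⟨hb1, hb2⟩ := mem_up.1 hb
        rw [Finset.mem_Ico] at hb1
        exact Finset.mem_filter.2 ⟨hc b hb1.1 hb1.2 hb2, by omega⟩
      · have := hsub (Finset.mem_filter.2 ⟨hA, le_refl _⟩)
        have := (mem_up.1 this).1
        rw [Finset.mem_Ico] at this
        omega
    rw [hcard] at this
    exact absurd hn (not_le.2 this)
  refine ⟨hcA, (hs _ hA).1, ?_⟩
  refine Eq.trans ?_ hcard
  apply le_antisymm
  · refine cnt_le_card fun b hb1 hb2 hb3 => Finset.mem_filter.2 ⟨hc b (hcA.trans hb1) hb2 hb3, hb1⟩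
  · refine card_le_cnt fun b hb => ?_
    rw [Finset.mem_filter] at hb
    exact ⟨hb.2, hs b hb.1⟩

/-! ### Downchains -/

theorem downStart_le {sb : ℕ → ℕ → Prop} {μ b : ℕ} : downStart sb μ b ≤ b := by
  refine Finset.sup_le fun x hx => ?_
  have := (mem_up.1 hx).1
  rw [Finset.mem_range] at this
  exact this

theorem not_super_of_downStart_le {sb : ℕ → ℕ → Prop} {μ b x : ℕ} (h : downStart sb μ b ≤ x)
    (hx : x < b) : ¬ sb μ x := fun hs => by
  have : Nat.succ x ≤ downStart sb μ b :=
    Finset.le_sup (f := Nat.succ) (mem_up.2 ⟨Finset.mem_range.2 hx, hs⟩)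
  omega

/-- The growth scale at position `y`. -/
noncomputable def scale (k : ℕ) (a : ℝ) (y : ℕ) : ℝ := k + a * Real.log y

/-- The properties of the complete chain on which the analysis of the trimming protocol rests. -/
structure Typical (sb : ℕ → ℕ → Prop) (k : ℕ) (a δ ε r : ℝ) : Prop where
  anti : ∀ μ ν b, μ ≤ ν → sb ν b → sb μ b
  genesis : ∀ μ, sb μ 0
  zero : ∀ b, sb 0 b
  level : ∀ ν j, 1 ≤ j → sb ν j → (ν : ℝ) ≤ 4 * scale k a j
  lower : ∀ ν i j : ℕ, i ≤ j → 1 ≤ j →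
    (j : ℝ) - i ≤ 5 / 4 * 2 ^ ν * cnt sb ν i j + 10 * 2 ^ ν * scale k a j
  upper : ∀ ν i j : ℕ, i ≤ j → 1 ≤ j →
    (cnt sb ν i j : ℝ) ≤ 5 / 4 * ((j : ℝ) - i) / 2 ^ ν + 12 * scale k a j
  -- The expected count is below 1. This bound keeps the protocol from opening level ν before
  -- position 2^ν.
  top : ∀ ν, 1 ≤ ν → (cnt sb ν 1 (2 ^ ν) : ℝ) < 3 * k + 15 * ν
  -- Superquality survives the loss of [z, c) when that piece has few superblocks of level n+1: the
  -- count on [c, y) alone meets the target for the whole of [z, y).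
  quality : ∀ n z c y : ℕ, z ≤ c → c ≤ y → 1 ≤ y → 2 ^ n ≤ 4 * y →
    (1 - ε) * scale k a y ≤ ((y : ℝ) - z) / 2 ^ n → (cnt sb (n + 1) z c : ℝ) ≤ r * scale k a y →
    (1 - δ) * (((y : ℝ) - z) / 2 ^ n) ≤ cnt sb n c y
  -- Level n should have twice as many superblocks as level n+1; the margin `r * scale` makes up for
  -- a lag of the same size in `Core.window_at`.
  half : ∀ n c y, 1 ≤ c → c ≤ y → 2 ^ n ≤ 4 * y → 2 * scale k a y ≤ cnt sb (n + 1) c y →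
    (cnt sb (n + 1) c y : ℝ) + r * scale k a y ≤ cnt sb n c y
  dominant : ∀ μ i j y g, j ≤ y → 1 ≤ y → 2 ^ μ ≤ 4 * y → (1 - ε) * scale k a y ≤ g →
    Dominant sb (Finset.Ico i j) μ g

/-! ### Good superchains in a typical chain -/

/-- A superchain of level `n` whose last part is complete, and which misses only a part of the
chain with few superblocks of the next higher level, has superquality. -/
theorem Typical.good {sb : ℕ → ℕ → Prop} {k : ℕ} {a δ ε r : ℝ} (H : Typical sb k a δ ε r)
    (hδ : 0 < δ) (hδ' : δ < 1) {n A c y : ℕ} {g : ℝ} {s : Finset ℕ} (hy : 1 ≤ y) (hn : 2 ^ n ≤ 4 * y)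
    (hs : ∀ b ∈ s, A ≤ b ∧ b < y ∧ sb n b) (hc : ∀ b, c ≤ b → b < y → sb n b → b ∈ s) (hcy : c ≤ y)
    (hg : (1 - ε) * scale k a y ≤ g) (hg0 : 0 < g)
    (hA : (cnt sb (n + 1) A c : ℝ) ≤ r * scale k a y) (hr : 0 ≤ r * scale k a y)
    (hcard : g ≤ s.card) : Good sb δ g n s := by
  have hδ1 : 0 < 1 - δ := by linarith
  constructor
  · intro g' hg'
    set s' := lastN s g' with hs'
    have hcs : (s'.card : ℝ) = min (g' : ℝ) s.card := by
      rw [hs', card_lastN]; push_cast; rfl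
    have hgs : g ≤ s'.card := by rw [hcs]; exact le_min hg' hcard
    have hpos : 0 < s'.card := by
      have : (0 : ℝ) < s'.card := lt_of_lt_of_le hg0 hgs
      exact_mod_cast this
    have hne : s'.Nonempty := Finset.card_pos.1 hpos
    rw [downchain, dif_pos hne]
    set z₀ := s'.min' hne with hz₀
    set z := downStart sb n z₀ with hz
    set y' := s'.max' hne with hy'
    have hz₀s : z₀ ∈ s' := Finset.min'_mem _ _
    have hy's : y' ∈ s' := Finset.max'_mem _ _
    have hsub := lastN_subset s g'
    have hz₀y := (hs _ (hsub hz₀s)).2.1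
    have hy'y := (hs _ (hsub hy's)).2.1
    have hzz : z ≤ z₀ := downStart_le
    have hzy' : z₀ ≤ y' := Finset.min'_le _ _ hy's
    have hp : (0 : ℝ) < 2 ^ n := by positivity
    by_contra hlt
    push Not at hlt
    have hlen : ((Finset.Ico z y').card : ℝ) ≤ (y : ℝ) - z := by
      rw [Nat.card_Ico, Nat.cast_sub (hzz.trans hzy')]
      have : (y' : ℝ) ≤ y := by exact_mod_cast hy'y.le
      linarith
    have hlen2 : (s'.card : ℝ) < (1 - δ) * (((y : ℝ) - z) / 2 ^ n) := by
      refine lt_of_lt_of_le hlt ?_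
      rw [mul_assoc]
      refine mul_le_mul_of_nonneg_left ?_ hδ1.le
      rw [div_eq_inv_mul]
      exact mul_le_mul_of_nonneg_left hlen (by positivity)
    -- A violation makes the downchain long: it exceeds the actual count, which is at least g.
    have hlen3 : (1 - ε) * scale k a y ≤ ((y : ℝ) - z) / 2 ^ n := by
      have hyz : 0 ≤ ((y : ℝ) - z) / 2 ^ n := by
        refine div_nonneg ?_ hp.le
        have : (z : ℝ) ≤ y := by exact_mod_cast (hzz.trans hz₀y.le)
        linarith
      nlinarith
    have hlast : ∀ b, z₀ ≤ b → b ∈ s → b ∈ s' := fun b hb hbs => mem_lastN_of_le hz₀s hbs hb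
    have hz₀le : ∀ b, z ≤ b → sb n b → z₀ ≤ b := by
      intro b hb hsb
      by_contra hlt
      exact not_super_of_downStart_le hb (not_le.1 hlt) hsb
    -- Past `c'` the last part of `s` is complete, so `Typical.quality` contradicts the assumed
    -- shortage. The two cases below take for `c'` the start of the downchain and the start `c` of
    -- the complete part.
    have key : ∀ c', z ≤ c' → c' ≤ y → (z₀ ≤ c' ∨ c' = z) → c ≤ max c' z₀ →
        (cnt sb (n + 1) z c' : ℝ) ≤ r * scale k a y → False := by
      intro c' h1 h2 h3 h4 h5
      have h6 := H.quality n z c' y h1 h2 hy hn hlen3 h5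
      have h7 : cnt sb n c' y ≤ s'.card := by
        refine cnt_le_card fun b hb1 hb2 hb3 => ?_
        have hb4 : z₀ ≤ b := hz₀le b (by omega) hb3
        exact hlast b hb4 (hc b (by omega) hb2 hb3)
      have h8 : (cnt sb n c' y : ℝ) ≤ s'.card := by exact_mod_cast h7
      linarith
    by_cases hzc : c ≤ z₀
    · refine key z le_rfl (hzz.trans hz₀y.le) (Or.inr rfl) (by omega) ?_
      rw [cnt_eq_zero _ _ le_rfl]
      simpa using hr
    · refine key c (by omega) hcy (Or.inl (by omega)) (by omega) (le_trans ?_ hA)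
      -- No level-n superblock lies between the start of the downchain and the first block of the
      -- superchain, so everything counted here already lies beyond `A`.
      have : cnt sb (n + 1) z c ≤ cnt sb (n + 1) A c := by
        refine card_le_cnt fun b hb => ?_
        obtain ⟨hb1, hb2⟩ := mem_up.1 hb
        rw [Finset.mem_Ico] at hb1
        have := hz₀le b hb1.1 (H.anti n (n + 1) b (by omega) hb2)
        have := (hs _ (hsub hz₀s)).1
        exact ⟨by omega, hb1.2, hb2⟩
      exact_mod_cast this
  · unfold downchain
    split_ifs with hne
    · exact H.dominant _ _ _ _ _ (hs _ (Finset.max'_mem s hne)).2.1.le hy hn hg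
    · simpa using H.dominant n 0 0 y g (Nat.zero_le _) hy hn hg

/-! ### The loop of a trim -/

/-- The loop invariant is that exactly `f` superblocks of level n of the complete chain lie in [A,
y). By `hwin` the next lower level is missing only a piece with at most `r * scale` of them, so that
level is good and long enough. Its `f`-th last block lies in the complete part, which restores the
invariant. The disjunction `0 < n ∨ ok` covers the exit, where the flag of the last round is
returned. -/
theorem trimLoop_spec {sb : ℕ → ℕ → Prop} {k : ℕ} {a δ ε r : ℝ} (H : Typical sb k a δ ε r)
    (hδ : 0 < δ) (hδ' : δ < 1) {P : Finset ℕ} {y f M m : ℕ} {g : ℝ} (hy : 1 ≤ y)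
    (hm : 2 ^ m ≤ 4 * y) (hf : 1 ≤ f) (hg : (1 - ε) * scale k a y ≤ g) (hg0 : 0 < g)
    (hgf : g ≤ f) (hr : 0 ≤ r * scale k a y)
    (hwin : ∀ j < m, ∃ c ≤ y, (∀ b, c ≤ b → b < y → sb j b → b ∈ P) ∧
      (f : ℝ) - r * scale k a y ≤ cnt sb (j + 1) c y ∧ f ≤ cnt sb j c y)
    (hM : ∀ j < m, ∀ A ≤ y, cnt sb (j + 1) A y ≤ f → cnt sb j A y ≤ M) :
    ∀ (n : ℕ) (E : Finset ℕ) (A : ℕ) (ok : Prop), n ≤ m → A < y → cnt sb n A y = f →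
      (0 < n ∨ ok) →
      (trimLoop sb δ g f P y n E A ok).2 ∧ E ⊆ (trimLoop sb δ g f P y n E A ok).1 ∧
      (trimLoop sb δ g f P y n E A ok).1 ⊆ E ∪ seg P A y ∧
      (trimLoop sb δ g f P y n E A ok).1.card ≤ E.card + n * M ∧
      ∀ j < n, ∃ c, A ≤ c ∧ c < y ∧ f ≤ cnt sb (j + 1) c y ∧
        ∀ b ∈ P, c ≤ b → b < y → sb j b → b ∈ (trimLoop sb δ g f P y n E A ok).1 := by
  classical
  intro n
  induction n with
  | zero =>
    intro E A ok _ _ _ hok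
    refine ⟨by simpa [trimLoop] using hok, by simp [trimLoop], ?_, by simp [trimLoop], by simp⟩
    simp only [trimLoop]
    exact Finset.subset_union_left
  | succ n ih =>
    intro E A ok hnm hAy hA _
    obtain ⟨c, hcy, hcP, hlag, hfc⟩ := hwin n hnm
    set α := up sb n (seg P A y) with hα
    have hαs : ∀ b ∈ α, A ≤ b ∧ b < y ∧ sb n b := fun b hb => by
      obtain ⟨h1, h2⟩ := mem_up.1 hb
      obtain ⟨-, h3, h4⟩ := mem_seg.1 h1
      exact ⟨h3, h4, h2⟩
    have hcα : ∀ b, max c A ≤ b → b < y → sb n b → b ∈ α := fun b h1 h2 h3 =>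
      mem_up.2 ⟨mem_seg.2 ⟨hcP b (by omega) h2 h3, by omega, h2⟩, h3⟩
    have hfcnt : f ≤ cnt sb n (max c A) y := by
      rcases le_total c A with h | h
      · rw [max_eq_right h, ← hA]
        exact cnt_anti H.anti (Nat.le_succ n) _ _
      · rwa [max_eq_left h]
    have hfα : f ≤ α.card := hfcnt.trans (cnt_le_card hcα)
    have hmiss : (cnt sb (n + 1) A (max c A) : ℝ) ≤ r * scale k a y := by
      rcases le_total c A with h | h
      · rw [max_eq_right h, cnt_eq_zero _ _ le_rfl]
        simpa using hr
      · rw [max_eq_left h]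
        have := cnt_add sb (n + 1) h hcy
        rw [hA] at this
        have h' : (cnt sb (n + 1) A c : ℝ) + cnt sb (n + 1) c y = f := by exact_mod_cast this
        linarith
    have hn4 : 2 ^ n ≤ 4 * y :=
      (Nat.pow_le_pow_right (by norm_num) (by omega)).trans hm
    have hgood : Good sb δ g n α :=
      H.good hδ hδ' hy hn4 hαs hcα (by omega) hg hg0 hmiss hr
        (hgf.trans (by exact_mod_cast hfα))
    have hok : f ≤ α.card ∧ Good sb δ g n α := ⟨hfα, hgood⟩
    obtain ⟨hA1, hA2, hA3⟩ := cnt_nthLast hf (fun b hb => (hαs b hb).2) hcα hfcnt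
    have hstep : trimLoop sb δ g f P y (n + 1) E A ok =
        trimLoop sb δ g f P y n (E ∪ α) (nthLast α f) (f ≤ α.card ∧ Good sb δ g n α) := by
      simp only [trimLoop]
      rw [if_pos hok]
    obtain ⟨i1, i2, i3, i4, i5⟩ := ih (E ∪ α) (nthLast α f) (f ≤ α.card ∧ Good sb δ g n α)
      (by omega) hA2 hA3 (Or.inr hok)
    rw [hstep]
    have hAA : A ≤ nthLast α f := by omega
    refine ⟨i1, Finset.subset_union_left.trans i2, i3.trans ?_, ?_, ?_⟩
    · intro b hb
      simp only [Finset.mem_union, mem_seg] at hb ⊢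
      rcases hb with (hb | hb) | hb
      · exact Or.inl hb
      · exact Or.inr (mem_seg.1 (mem_up.1 hb).1)
      · exact Or.inr ⟨hb.1, by omega, hb.2.2⟩
    · have h1 : (E ∪ α).card ≤ E.card + α.card := Finset.card_union_le _ _
      have h2 : α.card ≤ M := (card_le_cnt hαs).trans (hM n hnm A hAy.le hA.le)
      nlinarith
    · intro j hj
      rcases Nat.lt_succ_iff_lt_or_eq.1 hj with hj | rfl
      · obtain ⟨c', h1, h2, h3, h4⟩ := i5 j hj
        exact ⟨c', by omega, h2, h3, h4⟩
      · refine ⟨A, le_rfl, hAy, hA.ge, fun b hbP h1 h2 h3 => i2 ?_⟩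
        exact Finset.mem_union_right _ (mem_up.2 ⟨mem_seg.2 ⟨hbP, h1, h2⟩, h3⟩)

/-! ### A trim succeeds once its superchain is long enough -/

/-- The state after a successful trim at level `μ` with trimming point `y` which retains `E`. -/
def trimmed (st : TrimState) (y μ : ℕ) (E : Finset ℕ) : TrimState where
  P := st.P.filter (fun b => b < st.Lf μ) ∪ E ∪ st.P.filter (fun b => y ≤ b)
  trimPt := y
  top := max st.top μ
  Lf := fun ν => if ν < μ then y - 1 else st.Lf ν
  Ll := fun ν => if ν ≤ μ then y - 1 else st.Ll ν

/-- The superchain at which a trim at level `μ` with trimming point `y` starts. -/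
noncomputable def chain (sb : ℕ → ℕ → Prop) (st : TrimState) (y μ : ℕ) : Finset ℕ :=
  up sb μ (seg st.P (st.Lf μ) y)

/-- At the starting level nothing is missing, so goodness needs no window there; the remaining
levels are those of `trimLoop_spec`, entered with the `f`-th last block of the starting superchain.
-/
theorem trim_spec {sb : ℕ → ℕ → Prop} {k : ℕ} {a δ ε r : ℝ} (H : Typical sb k a δ ε r)
    (hδ : 0 < δ) (hδ' : δ < 1) {p : Params} (hpδ : p.δ = δ) {st : TrimState} {y M m : ℕ}
    (hy : 1 ≤ y) (hm0 : 1 ≤ m)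
    (hm : 2 ^ m ≤ 4 * y) (hf : 1 ≤ fPar sb p st m)
    (hg : (1 - ε) * scale k a y ≤ gPar sb p st m) (hg0 : 0 < gPar sb p st m)
    (hgf : gPar sb p st m ≤ fPar sb p st m) (hr : 0 ≤ r * scale k a y)
    (hwin : ∀ j < m, ∃ c ≤ y, (∀ b, c ≤ b → b < y → sb j b → b ∈ st.P) ∧
      (fPar sb p st m : ℝ) - r * scale k a y ≤ cnt sb (j + 1) c y ∧ fPar sb p st m ≤ cnt sb j c y)
    (hM : ∀ j < m, ∀ A ≤ y, cnt sb (j + 1) A y ≤ fPar sb p st m → cnt sb j A y ≤ M)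
    (hc : ∀ b, st.Lf m ≤ b → b < y → sb m b → b ∈ st.P)
    (hfm : fPar sb p st m ≤ cnt sb m (st.Lf m) y) :
    (fPar sb p st m ≤ (chain sb st y m).card ∧
      Good sb p.δ (gPar sb p st m) m (chain sb st y m)) ∧
    ∃ E, trim sb p st y m = some (trimmed st y m E) ∧ chain sb st y m ⊆ E ∧
      E ⊆ seg st.P (st.Lf m) y ∧ E.card ≤ cnt sb m (st.Lf m) y + m * M ∧
      ∀ j < m, ∃ c < y, fPar sb p st m ≤ cnt sb (j + 1) c y ∧
        ∀ b ∈ st.P, c ≤ b → b < y → sb j b → b ∈ E := by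
  classical
  have hs : ∀ b ∈ chain sb st y m, st.Lf m ≤ b ∧ b < y ∧ sb m b := fun b hb => by
    obtain ⟨h1, h2⟩ := mem_up.1 hb
    obtain ⟨-, h3, h4⟩ := mem_seg.1 h1
    exact ⟨h3, h4, h2⟩
  have hc' : ∀ b, st.Lf m ≤ b → b < y → sb m b → b ∈ chain sb st y m := fun b h1 h2 h3 =>
    mem_up.2 ⟨mem_seg.2 ⟨hc b h1 h2 h3, h1, h2⟩, h3⟩
  have hfc : fPar sb p st m ≤ (chain sb st y m).card := hfm.trans (cnt_le_card hc')
  have hLy : st.Lf m ≤ y := by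
    by_contra h
    rw [cnt_eq_zero _ _ (by omega)] at hfm
    omega
  have hgood : Good sb p.δ (gPar sb p st m) m (chain sb st y m) := by
    rw [hpδ]
    refine H.good hδ hδ' hy hm hs hc' hLy hg hg0 ?_ hr (hgf.trans (by exact_mod_cast hfc))
    rw [cnt_eq_zero _ _ le_rfl]
    simpa using hr
  refine ⟨⟨hfc, hgood⟩, ?_⟩
  obtain ⟨hA1, hA2, hA3⟩ := cnt_nthLast hf (fun b hb => (hs b hb).2) hc' hfm
  obtain ⟨h1, h2, h3, h4, h5⟩ := trimLoop_spec H hδ hδ' hy hm hf hg hg0 hgf hr hwin hM m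
    (chain sb st y m) (nthLast (chain sb st y m) (fPar sb p st m)) False le_rfl hA2 hA3
    (Or.inl hm0)
  rw [← hpδ] at h1 h2 h3 h4 h5
  refine ⟨_, ?_, h2, h3.trans ?_, h4.trans ?_, ?_⟩
  · simp only [trim]
    exact (if_pos h1).trans rfl
  · intro b hb
    rcases Finset.mem_union.1 hb with hb | hb
    · exact (mem_up.1 hb).1
    · obtain ⟨i1, i2, i3⟩ := mem_seg.1 hb
      exact mem_seg.2 ⟨i1, by omega, i3⟩
  · have : (chain sb st y m).card ≤ cnt sb m (st.Lf m) y := card_le_cnt hs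
    omega
  · intro j hj
    obtain ⟨c, -, i2, i3, i4⟩ := h5 j hj
    exact ⟨c, i2, i3, i4⟩

/-- If every trim with a long enough superchain succeeds, the trimming attempt ends at the highest
level with such a superchain. -/
theorem attemptFrom_spec {sb : ℕ → ℕ → Prop} {p : Params} {st : TrimState} {y : ℕ}
    {φ : ℕ → TrimState → Prop} (N : ℕ)
    (hlong : ∀ m, 1 ≤ m → m ≤ N → fPar sb p st m ≤ (chain sb st y m).card →
      Good sb p.δ (gPar sb p st m) m (chain sb st y m) ∧
        ∃ st', trim sb p st y m = some st' ∧ φ m st') :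
    (attemptFrom sb p st y N = st ∧
      ∀ m, 1 ≤ m → m ≤ N → (chain sb st y m).card < fPar sb p st m) ∨
    ∃ m, 1 ≤ m ∧ m ≤ N ∧ φ m (attemptFrom sb p st y N) ∧
      ∀ m', m < m' → m' ≤ N → (chain sb st y m').card < fPar sb p st m' := by
  classical
  induction N with
  | zero => exact Or.inl ⟨rfl, fun m h1 h2 => by omega⟩
  | succ N ih =>
    by_cases hN : fPar sb p st (N + 1) ≤ (chain sb st y (N + 1)).card
    · obtain ⟨hg, st', h1, h2⟩ := hlong (N + 1) (by omega) le_rfl hN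
      refine Or.inr ⟨N + 1, by omega, le_rfl, ?_, fun m' h3 h4 => by omega⟩
      have : attemptFrom sb p st y (N + 1) = st' := by
        simp only [attemptFrom]
        rw [if_pos ⟨hN, hg⟩, h1]
        rfl
      rwa [this]
    · have hstep : attemptFrom sb p st y (N + 1) = attemptFrom sb p st y N := by
        simp only [attemptFrom]
        rw [if_neg fun h => hN h.1]
      rw [hstep]
      push Not at hN
      rcases ih fun m h1 h2 h3 => hlong m h1 (by omega) h3 with ⟨h1, h2⟩ | ⟨m, h1, h2, h3, h4⟩
      · refine Or.inl ⟨h1, fun m h3 h4 => ?_⟩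
        rcases Nat.le_succ_iff.1 h4 with h | rfl
        · exact h2 m h3 h
        · exact hN
      · refine Or.inr ⟨m, h1, by omega, h3, fun m' h5 h6 => ?_⟩
        rcases Nat.le_succ_iff.1 h6 with h | rfl
        · exact h4 m' h5 h
        · exact hN

/-! ### Sizes in the trimmed chain -/

/-- Bound, in units of `scale`, for the superblocks above a level range after an attempt. -/
noncomputable def afterBound (p : Params) : ℝ := 101 + 4 * p.Q + 2 * p.c

/-- Bound, in units of `scale`, for the superblocks above a level range at an attempt. -/
noncomputable def atBound (p : Params) : ℝ := afterBound p + 3 + p.Q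

/-- Conditions on the parameters which hold for all large enough security parameters `k`. -/
structure Regime (p : Params) (ε r : ℝ) : Prop where
  δ_pos : 0 < p.δ
  δ_lt : p.δ < 1
  a_ge : 8 ≤ p.a
  c_gt : 3 < p.c
  Q_pos : 1 ≤ p.Q
  ε_pos : 0 < ε
  ε_le : ε ≤ 1 / 100
  r_eq : r = 4 * p.c * ε
  k_pos : 1 ≤ p.k
  k_ge : 1 ≤ ε * p.k
  log_le : ∀ x : ℝ, p.k ≤ x → p.a * Real.log ((300 + 10 * p.Q + 4 * p.c) * x) ≤ ε * x

/-- The invariants of the trimming protocol, when `n` is the index of the last block. -/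
structure Core (sb : ℕ → ℕ → Prop) (p : Params) (ε : ℝ) (n : ℕ) (st : TrimState) : Prop where
  le_last : ∀ b ∈ st.P, b ≤ n
  one_le : 1 ≤ st.trimPt
  trimPt_le : st.trimPt ≤ n + 1
  Ll_zero : st.Ll 0 + 1 = st.trimPt
  link : ∀ ν, st.Lf ν = st.Ll (ν + 1)
  Ll_anti : ∀ ν, st.Ll (ν + 1) ≤ st.Ll ν
  above : ∀ ν, st.top < ν → st.Ll ν = 0
  complete : ∀ ν b, st.Lf ν ≤ b → b ≤ n → sb ν b → b ∈ st.P
  -- Either nothing of level ν was ever lost, or the window goes back to a trim at trimming point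
  -- `y`, which kept about c * scale superblocks of level ν+1 inside it.
  window : ∀ ν, ∃ c, (∀ b, c ≤ b → b ≤ n → sb ν b → b ∈ st.P) ∧ (c = 0 ∨
    ∃ y, 1 ≤ y ∧ y ≤ st.trimPt ∧ c ≤ y ∧ 2 ^ (ν + 1) ≤ y ∧
      p.c * ((1 - ε) * scale p.k p.a y) ≤ cnt sb (ν + 1) c y)
  top_le : 2 ^ st.top ≤ st.trimPt

/-! ### Stability of the growth scale -/

section Scale

variable {p : Params} {ε r : ℝ}

theorem Regime.scale_mono (R : Regime p ε r) {x y : ℕ} (hx : 1 ≤ x) (h : x ≤ y) :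
    scale p.k p.a x ≤ scale p.k p.a y := by
  unfold scale
  have h1 : (0 : ℝ) < x := by exact_mod_cast hx
  have h2 : (x : ℝ) ≤ y := by exact_mod_cast h
  have := Real.log_le_log h1 h2
  have := R.a_ge
  nlinarith

theorem Regime.k_le_scale (R : Regime p ε r) (y : ℕ) : (p.k : ℝ) ≤ scale p.k p.a y := by
  unfold scale
  have := Real.log_natCast_nonneg y
  have := R.a_ge
  nlinarith

theorem Regime.one_le_scale (R : Regime p ε r) (y : ℕ) : 1 ≤ scale p.k p.a y := by
  have h : (1 : ℝ) ≤ p.k := by exact_mod_cast R.k_pos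
  exact h.trans (R.k_le_scale y)

theorem Regime.log_le_scale (R : Regime p ε r) (y : ℕ) : 8 * Real.log y ≤ scale p.k p.a y := by
  unfold scale
  have h := Real.log_natCast_nonneg y
  have h1 := R.a_ge
  have h2 : (0 : ℝ) ≤ p.k := by positivity
  nlinarith

theorem Regime.log_scale_le (R : Regime p ε r) {K : ℝ} (hK : 0 < K)
    (hK' : K ≤ 300 + 10 * p.Q + 4 * p.c) (y : ℕ) :
    p.a * Real.log (K * scale p.k p.a y) ≤ ε * scale p.k p.a y := by
  have h1 := R.one_le_scale y
  refine le_trans ?_ (R.log_le _ (R.k_le_scale y))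
  have h2 : Real.log (K * scale p.k p.a y) ≤
      Real.log ((300 + 10 * p.Q + 4 * p.c) * scale p.k p.a y) :=
    Real.log_le_log (by positivity) (by nlinarith)
  have := R.a_ge
  nlinarith

/-- Positions which differ by a factor of the order of `scale` have almost the same scale. -/
theorem Regime.scale_le_of_le_mul (R : Regime p ε r) {K x : ℝ} {y : ℕ} (hK : 0 < K)
    (hK' : K ≤ 300 + 10 * p.Q + 4 * p.c) (hy : 1 ≤ y) (hx : 0 < x)
    (h : (y : ℝ) ≤ K * scale p.k p.a y * x) :
    (1 - ε) * scale p.k p.a y ≤ p.k + p.a * Real.log x := by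
  have h1 := R.one_le_scale y
  have h2 := R.log_scale_le hK hK' y
  have h3 : Real.log y ≤ Real.log (K * scale p.k p.a y) + Real.log x := by
    rw [← Real.log_mul (by positivity) hx.ne']
    exact Real.log_le_log (by exact_mod_cast hy) h
  have h4 : scale p.k p.a y = p.k + p.a * Real.log y := rfl
  have := R.a_ge
  nlinarith

end Scale

theorem sum_Icc_sub_succ (u : ℕ → ℝ) {m N : ℕ} (h : m ≤ N) :
    ∑ ν ∈ Finset.Icc m N, (u ν - u (ν + 1)) = u m - u (N + 1) := by
  induction N, h using Nat.le_induction with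
  | base => simp
  | succ N h ih => rw [Finset.sum_Icc_succ_top (by omega), ih]; ring

theorem sum_Icc_two_pow_le (m N : ℕ) : ∑ ν ∈ Finset.Icc m N, (2 : ℝ) ^ ν ≤ 2 ^ (N + 1) := by
  have h1 : ∑ ν ∈ Finset.Icc m N, (2 : ℝ) ^ ν ≤ ∑ ν ∈ Finset.range (N + 1), (2 : ℝ) ^ ν := by
    refine Finset.sum_le_sum_of_subset_of_nonneg ?_ fun _ _ _ => by positivity
    intro ν hν
    simp only [Finset.mem_Icc, Finset.mem_range] at hν ⊢
    omega
  have h2 : ∑ ν ∈ Finset.range (N + 1), (2 : ℝ) ^ ν = 2 ^ (N + 1) - 1 := by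
    rw [geom_sum_eq (by norm_num)]; norm_num
  linarith

/-! ### The node's weights and parameters compared with the true position -/

namespace Core

variable {sb : ℕ → ℕ → Prop} {p : Params} {ε r : ℝ} {n : ℕ} {st : TrimState}

theorem Ll_le (C : Core sb p ε n st) (ν : ℕ) : st.Ll ν + 1 ≤ st.trimPt := by
  have : st.Ll ν ≤ st.Ll 0 := antitone_nat_of_succ_le C.Ll_anti (Nat.zero_le ν)
  have := C.Ll_zero
  omega

theorem Lf_le_Ll (C : Core sb p ε n st) (ν : ℕ) : st.Lf ν ≤ st.Ll ν := by
  rw [C.link]; exact C.Ll_anti ν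

theorem Lf_anti (C : Core sb p ε n st) : Antitone st.Lf := by
  refine antitone_nat_of_succ_le fun ν => ?_
  rw [C.link, C.link]
  exact C.Ll_anti _

theorem Lf_eq_zero (C : Core sb p ε n st) {ν : ℕ} (h : st.top ≤ ν) : st.Lf ν = 0 := by
  rw [C.link]; exact C.above _ (by omega)

/-- Level range ν is complete at level ν, so its weight depends only on its end points and the
complete chain. -/
theorem weight_eq (C : Core sb p ε n st) (ν : ℕ) :
    weight sb st ν = 2 ^ ν * cnt sb ν (st.Lf ν) (st.Ll ν + 1) := by
  unfold weight
  congr 1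
  have h1 := C.Ll_le ν
  have h2 := C.trimPt_le
  apply le_antisymm
  · refine card_le_cnt fun b hb => ?_
    obtain ⟨h3, h4⟩ := mem_up.1 hb
    obtain ⟨-, h5, h6⟩ := mem_seg.1 h3
    exact ⟨h5, h6, h4⟩
  · refine cnt_le_card fun b h3 h4 h5 => mem_up.2 ⟨mem_seg.2 ⟨?_, h3, h4⟩, h5⟩
    exact C.complete ν b h3 (by omega) h5

/-- The last summand is a range that begins at genesis, and genesis alone contributes this much. -/
theorem two_pow_le_cumWeight (C : Core sb p ε n st) (hgen : ∀ μ, sb μ 0) (m : ℕ) :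
    2 ^ (max m st.top) ≤ cumWeight sb st m := by
  unfold cumWeight
  rw [max_comm]
  refine le_trans ?_ (Finset.single_le_sum (f := fun ν => weight sb st ν) (fun _ _ => Nat.zero_le _)
    (Finset.mem_Icc.2 ⟨le_max_right st.top m, by rw [max_comm]⟩))
  rw [C.weight_eq, C.Lf_eq_zero (le_max_left _ _)]
  have : 0 < cnt sb (max st.top m) 0 (st.Ll (max st.top m) + 1) :=
    Finset.card_pos.2 ⟨0, mem_up.2 ⟨by simp, hgen _⟩⟩
  exact Nat.le_mul_of_pos_right _ this

/-- Each weight is at most a constant times the length of its range plus an error of order 2^ν *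
scale. The lengths telescope, and the errors form a geometric sum, controlled because 2^top is at
most the trimming point. -/
theorem cumWeight_le (C : Core sb p ε n st) (R : Regime p ε r)
    (H : Typical sb p.k p.a p.δ ε r) {m : ℕ} (hm : m ≤ st.top + 1) :
    (cumWeight sb st m : ℝ) ≤ 60 * scale p.k p.a st.trimPt * st.trimPt := by
  set T := st.trimPt with hT
  set s := scale p.k p.a T with hs
  have hs1 : 1 ≤ s := R.one_le_scale T
  set N := max m st.top with hN
  have hw : ∀ ν, (weight sb st ν : ℝ) ≤
      5 / 4 * ((st.Ll ν : ℝ) - st.Ll (ν + 1)) + (5 / 4 + 12 * s) * 2 ^ ν := by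
    intro ν
    have h1 := H.upper ν (st.Lf ν) (st.Ll ν + 1) (by have := C.Lf_le_Ll ν; omega) (by omega)
    have h2 : scale p.k p.a (st.Ll ν + 1) ≤ s := R.scale_mono (by omega) (C.Ll_le ν)
    have hp : (1 : ℝ) ≤ 2 ^ ν := one_le_pow₀ (by norm_num)
    rw [C.weight_eq]
    push_cast at h1 ⊢
    rw [C.link] at h1 ⊢
    calc (2 : ℝ) ^ ν * cnt sb ν (st.Ll (ν + 1)) (st.Ll ν + 1)
        ≤ 2 ^ ν * (5 / 4 * ((st.Ll ν : ℝ) + 1 - st.Ll (ν + 1)) / 2 ^ ν + 12 * s) := by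
          refine mul_le_mul_of_nonneg_left ?_ (by positivity)
          linarith
      _ = 5 / 4 * ((st.Ll ν : ℝ) + 1 - st.Ll (ν + 1)) + 12 * s * 2 ^ ν := by
          field_simp
      _ ≤ _ := by nlinarith
  have hsum : (cumWeight sb st m : ℝ) ≤ 5 / 4 * ((st.Ll m : ℝ) - st.Ll (N + 1)) +
      (5 / 4 + 12 * s) * 2 ^ (N + 1) := by
    unfold cumWeight
    push_cast
    refine (Finset.sum_le_sum fun ν _ => hw ν).trans ?_
    rw [Finset.sum_add_distrib, ← Finset.mul_sum, ← Finset.mul_sum,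
      sum_Icc_sub_succ (fun ν => (st.Ll ν : ℝ)) (le_max_left m st.top)]
    have := sum_Icc_two_pow_le m N
    nlinarith
  have h1 : (st.Ll m : ℝ) ≤ T := by
    have := C.Ll_le m
    exact_mod_cast (by omega : st.Ll m ≤ T)
  have h2 : (2 : ℝ) ^ (N + 1) ≤ 4 * T := by
    have h3 : 2 ^ (N + 1) ≤ 2 ^ (st.top + 2) := Nat.pow_le_pow_right (by norm_num) (by omega)
    have h4 := C.top_le
    have h5 : 2 ^ (st.top + 2) = 4 * 2 ^ st.top := by ring
    have : 2 ^ (N + 1) ≤ 4 * T := by omega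
    exact_mod_cast this
  have h3 : (0 : ℝ) ≤ st.Ll (N + 1) := by positivity
  have hT0 : (0 : ℝ) ≤ T := by positivity
  nlinarith [mul_le_mul_of_nonneg_left h2 (by linarith : (0 : ℝ) ≤ 5 / 4 + 12 * s),
    mul_nonneg hT0 (by linarith : 0 ≤ s - 1)]

/-- The telescoping in the other direction. The stretch from the end of range m to `y` is not
weighed and is controlled by `hcnt`; the errors 2^N * scale and 2^m * scale are absorbed since both
powers are at most the cumulative weight. -/
theorem le_mul_cumWeight (C : Core sb p ε n st) (R : Regime p ε r)
    (H : Typical sb p.k p.a p.δ ε r) {m y : ℕ} (hm1 : 1 ≤ m) (hy : st.trimPt ≤ y) {K : ℝ}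
    (hcnt : (cnt sb m (st.Lf (m - 1)) y : ℝ) ≤ K * scale p.k p.a y) :
    (y : ℝ) ≤ (32 + 2 * K) * scale p.k p.a y * cumWeight sb st m := by
  have hT1 := C.one_le
  set s := scale p.k p.a y with hs
  have hs1 : 1 ≤ s := R.one_le_scale y
  set N := max m st.top with hN
  set S : ℝ := ((cumWeight sb st m : ℕ) : ℝ) with hS
  have hNS : (2 : ℝ) ^ N ≤ S := by
    rw [hS, hN]
    exact_mod_cast C.two_pow_le_cumWeight H.genesis m
  have hmS : (2 : ℝ) ^ m ≤ S :=
    (pow_le_pow_right₀ (by norm_num) (le_max_left m st.top)).trans hNS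
  have hw : ∀ ν, ((st.Ll ν : ℝ) - st.Ll (ν + 1)) ≤ 5 / 4 * weight sb st ν + 10 * s * 2 ^ ν := by
    intro ν
    have h1 := H.lower ν (st.Lf ν) (st.Ll ν + 1) (by have := C.Lf_le_Ll ν; omega) (by omega)
    have h2 : scale p.k p.a (st.Ll ν + 1) ≤ s := R.scale_mono (by omega) ((C.Ll_le ν).trans hy)
    have hp : (1 : ℝ) ≤ 2 ^ ν := one_le_pow₀ (by norm_num)
    rw [C.weight_eq]
    push_cast at h1 ⊢
    rw [C.link] at h1 ⊢
    nlinarith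
  have hsum : (st.Ll m : ℝ) ≤ 5 / 4 * S + 10 * s * 2 ^ (N + 1) := by
    have h0 : (st.Ll (N + 1) : ℝ) = 0 := by
      rw [C.above _ (by omega)]; simp
    have h1 := Finset.sum_le_sum fun ν (_ : ν ∈ Finset.Icc m N) => hw ν
    rw [sum_Icc_sub_succ (fun ν => (st.Ll ν : ℝ)) (le_max_left m st.top),
      Finset.sum_add_distrib, ← Finset.mul_sum, ← Finset.mul_sum, h0, sub_zero] at h1
    have h2 := sum_Icc_two_pow_le m N
    have h3 : S = ∑ ν ∈ Finset.Icc m N, (weight sb st ν : ℝ) := by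
      rw [hS, cumWeight]; push_cast; rfl
    rw [h3]
    nlinarith
  have hlink : st.Lf (m - 1) = st.Ll m := by
    rw [C.link, Nat.sub_add_cancel hm1]
  have htail := H.lower m (st.Lf (m - 1)) y
    (by rw [hlink]; have := C.Ll_le m; omega) (by omega)
  rw [hlink] at htail hcnt
  have hS0 : 0 ≤ S := le_trans (by positivity) hNS
  have hc0 : (0 : ℝ) ≤ cnt sb m (st.Ll m) y := by positivity
  have hK : 0 ≤ K * s := hc0.trans hcnt
  have h1 : (2 : ℝ) ^ m * cnt sb m (st.Ll m) y ≤ S * (K * s) := mul_le_mul hmS hcnt hc0 hS0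
  have h2 : (2 : ℝ) ^ m * s ≤ S * s := mul_le_mul_of_nonneg_right hmS (by linarith)
  have h3 : (2 : ℝ) ^ N * s ≤ S * s := mul_le_mul_of_nonneg_right hNS (by linarith)
  have h4 : S ≤ S * s := le_mul_of_one_le_right hS0 hs1
  rw [pow_succ] at hsum
  nlinarith [mul_nonneg hS0 hK]

theorem gPar_le (C : Core sb p ε n st) (R : Regime p ε r)
    (H : Typical sb p.k p.a p.δ ε r) {m : ℕ} (hm : m ≤ st.top + 1) :
    gPar sb p st m ≤ (1 + ε) * scale p.k p.a st.trimPt := by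
  have h1 := C.cumWeight_le R H hm
  have hT : (0 : ℝ) < st.trimPt := by exact_mod_cast C.one_le
  have hs1 := R.one_le_scale st.trimPt
  have h2 : (0 : ℝ) < cumWeight sb st m := by
    have := C.two_pow_le_cumWeight H.genesis m
    exact_mod_cast lt_of_lt_of_le (by positivity) this
  have h3 := Real.log_le_log h2 h1
  rw [Real.log_mul (by positivity) hT.ne'] at h3
  have hc := R.c_gt
  have h4 := R.log_scale_le (K := 60) (by norm_num)
    (by have : (0 : ℝ) ≤ p.Q := by positivity
        linarith) st.trimPt
  have ha := R.a_ge
  have h5 : scale p.k p.a st.trimPt = p.k + p.a * Real.log st.trimPt := rfl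
  unfold gPar
  nlinarith

theorem one_le_gPar (R : Regime p ε r) (sb : ℕ → ℕ → Prop) (st : TrimState) (m : ℕ) :
    1 ≤ gPar sb p st m := by
  have h : (1 : ℝ) ≤ p.k := by exact_mod_cast R.k_pos
  have h1 := Real.log_natCast_nonneg (cumWeight sb st m)
  have := R.a_ge
  unfold gPar
  nlinarith

theorem mul_gPar_le_fPar (m : ℕ) : p.c * gPar sb p st m ≤ fPar sb p st m := Nat.le_ceil _

theorem gPar_le_fPar (R : Regime p ε r) (sb : ℕ → ℕ → Prop) (st : TrimState) (m : ℕ) :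
    gPar sb p st m ≤ fPar sb p st m := by
  have h1 := one_le_gPar R sb st m
  have h2 := R.c_gt
  have h3 : p.c * gPar sb p st m ≤ fPar sb p st m := mul_gPar_le_fPar m
  nlinarith

theorem one_le_fPar (R : Regime p ε r) (sb : ℕ → ℕ → Prop) (st : TrimState) (m : ℕ) :
    1 ≤ fPar sb p st m := by
  have h1 := one_le_gPar R sb st m
  have h2 := gPar_le_fPar R sb st m
  exact_mod_cast h1.trans h2

theorem fPar_le (C : Core sb p ε n st) (R : Regime p ε r)
    (H : Typical sb p.k p.a p.δ ε r) {m : ℕ} (hm : m ≤ st.top + 1) :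
    (fPar sb p st m : ℝ) ≤ p.c * ((1 + ε) * scale p.k p.a st.trimPt) + 1 := by
  have h1 := C.gPar_le R H hm
  have h0 := one_le_gPar R sb st m
  have hc := R.c_gt
  have h2 : (fPar sb p st m : ℝ) < p.c * gPar sb p st m + 1 :=
    Nat.ceil_lt_add_one (by nlinarith)
  nlinarith

theorem fPar_le' (C : Core sb p ε n st) (R : Regime p ε r)
    (H : Typical sb p.k p.a p.δ ε r) {m : ℕ} (hm : m ≤ st.top + 1) :
    (fPar sb p st m : ℝ) ≤ (2 * p.c + 1) * scale p.k p.a st.trimPt := by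
  have h1 := C.fPar_le R H hm
  have hs1 := R.one_le_scale st.trimPt
  have hc := R.c_gt
  have := R.ε_le
  have : (1 + ε) * scale p.k p.a st.trimPt ≤ 2 * scale p.k p.a st.trimPt := by nlinarith
  nlinarith

/-- Together with `gPar_le` this pins g to `scale`: the weight falls short of the position only by a
factor of order `scale`, whose logarithm is negligible. -/
theorem le_gPar (C : Core sb p ε n st) (R : Regime p ε r)
    (H : Typical sb p.k p.a p.δ ε r) {m y : ℕ} (hm1 : 1 ≤ m) (hy : st.trimPt ≤ y)
    (hcnt : (cnt sb m (st.Lf (m - 1)) y : ℝ) ≤ atBound p * scale p.k p.a y) :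
    (1 - ε) * scale p.k p.a y ≤ gPar sb p st m := by
  have h1 := C.le_mul_cumWeight R H hm1 hy hcnt
  have h2 : (0 : ℝ) < cumWeight sb st m := by
    have := C.two_pow_le_cumWeight H.genesis m
    exact_mod_cast lt_of_lt_of_le (by positivity) this
  have hc := R.c_gt
  have hQ : (0 : ℝ) ≤ p.Q := by positivity
  exact R.scale_le_of_le_mul (by unfold atBound afterBound; linarith)
    (by unfold atBound afterBound; linarith) (C.one_le.trans hy) h2 h1

end Core

/-! ### Trimming attempts -/

/-- Passing to the next lower level multiplies the number of superblocks at most by a constant. -/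
theorem Regime.cnt_le_of_cnt_succ_le {sb : ℕ → ℕ → Prop} {p : Params} {ε r : ℝ}
    (H : Typical sb p.k p.a p.δ ε r) {j A y : ℕ} {K : ℝ} (hy : 1 ≤ y) (hA : A ≤ y)
    (hK : 0 ≤ K * scale p.k p.a y) (h : (cnt sb (j + 1) A y : ℝ) ≤ K * scale p.k p.a y) :
    (cnt sb j A y : ℝ) ≤ (4 * K + 37) * scale p.k p.a y := by
  have h1 := H.lower (j + 1) A y hA hy
  have h2 := H.upper j A y hA hy
  have hp : (0 : ℝ) < 2 ^ j := by positivity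
  have h3 : ((y : ℝ) - A) / 2 ^ j ≤ 5 / 2 * (K * scale p.k p.a y) + 20 * scale p.k p.a y := by
    rw [div_le_iff₀ hp]
    rw [pow_succ] at h1
    nlinarith
  have h4 : 5 / 4 * ((y : ℝ) - A) / 2 ^ j = 5 / 4 * (((y : ℝ) - A) / 2 ^ j) := by ring
  rw [h4] at h2
  nlinarith

/-- Bound, in units of `scale`, for the blocks that one round of the trimming loop retains. -/
noncomputable def loopBound (p : Params) : ℝ := 4 * (2 * p.c + 1) + 37

/-- Bound, in units of `scale ^ 2`, for the size of a level range. -/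
noncomputable def rangeBound (p : Params) : ℝ := atBound p + 2 * loopBound p + 1

/-! ### Success of trims and preservation of the invariants -/

namespace Core

variable {sb : ℕ → ℕ → Prop} {p : Params} {ε r : ℝ} {n : ℕ} {st : TrimState}

theorem card_chain (C : Core sb p ε n st) {y : ℕ} (hyn : y ≤ n + 1) (m : ℕ) :
    (chain sb st y m).card = cnt sb m (st.Lf m) y := by
  apply le_antisymm
  · refine card_le_cnt fun b hb => ?_
    obtain ⟨h1, h2⟩ := mem_up.1 hb
    obtain ⟨-, h3, h4⟩ := mem_seg.1 h1
    exact ⟨h3, h4, h2⟩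
  · refine cnt_le_card fun b h1 h2 h3 => mem_up.2 ⟨mem_seg.2 ⟨?_, h1, h2⟩, h3⟩
    exact C.complete m b h1 (by omega) h3

theorem mem_of_trimPt_le (C : Core sb p ε n st) (h0 : ∀ b, sb 0 b) {b : ℕ}
    (h1 : st.trimPt ≤ b + 1) (h2 : b ≤ n) : b ∈ st.P := by
  refine C.complete 0 b ?_ h2 (h0 b)
  have := C.Lf_le_Ll 0
  have := C.Ll_zero
  omega

theorem card_tail (C : Core sb p ε n st) (h0 : ∀ b, sb 0 b) :
    st.tail.card = n + 1 - st.trimPt := by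
  have : st.tail = Finset.Ico st.trimPt (n + 1) := by
    ext b
    simp only [TrimState.tail, Finset.mem_filter, Finset.mem_Ico]
    constructor
    · rintro ⟨h1, h2⟩
      have := C.le_last b h1
      omega
    · rintro ⟨h1, h2⟩
      exact ⟨C.mem_of_trimPt_le h0 (by omega) (by omega), h1⟩
  rw [this, Nat.card_Ico]

/-- Only a new level needs an argument. If `y` were below 2^m, typicality would allow fewer than 1 +
3k + 15m superblocks, whereas f is at least 3(k + 8m log 2) because the cumulative weight is at
least 2^m. -/
theorem two_pow_le (C : Core sb p ε n st) (R : Regime p ε r)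
    (H : Typical sb p.k p.a p.δ ε r) {m y : ℕ} (hm1 : 1 ≤ m) (hm : m ≤ st.top + 1)
    (hy : st.trimPt ≤ y) (hf : fPar sb p st m ≤ cnt sb m (st.Lf m) y) : 2 ^ m ≤ y := by
  by_cases hmt : m ≤ st.top
  · exact (Nat.pow_le_pow_right (by norm_num) hmt).trans (C.top_le.trans hy)
  · by_contra hlt
    push Not at hlt
    rw [C.Lf_eq_zero (by omega)] at hf
    have h1 := C.one_le
    have h2 := cnt_add sb m (Nat.zero_le 1) (h1.trans hy)
    have h3 := cnt_le sb m 0 1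
    have h4 := cnt_mono sb m (le_refl 1) hlt.le
    have h5 := H.top m hm1
    have h6 : (fPar sb p st m : ℝ) ≤ 1 + cnt sb m 1 (2 ^ m) := by
      exact_mod_cast (by omega : fPar sb p st m ≤ 1 + cnt sb m 1 (2 ^ m))
    have h7 : (m : ℝ) * Real.log 2 ≤ Real.log (cumWeight sb st m) := by
      rw [← Real.log_pow]
      refine Real.log_le_log (by positivity) ?_
      have h8 := (Nat.pow_le_pow_right (by norm_num : 0 < 2) (le_max_left m st.top)).trans
        (C.two_pow_le_cumWeight H.genesis m)
      exact_mod_cast h8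
    have h8 := Real.log_two_gt_d9
    have h9 : p.c * gPar sb p st m ≤ fPar sb p st m := mul_gPar_le_fPar m
    have h10 := one_le_gPar R sb st m
    have h11 := R.c_gt
    have h12 := R.a_ge
    have hm0 : (1 : ℝ) ≤ m := by exact_mod_cast hm1
    have h13 : gPar sb p st m = p.k + p.a * Real.log (cumWeight sb st m) := rfl
    have h14 : 0.69 * (m : ℝ) ≤ Real.log (cumWeight sb st m) := by nlinarith
    have h15 : 8 * (0.69 * (m : ℝ)) ≤ p.a * Real.log (cumWeight sb st m) := by nlinarith
    nlinarith

/-- The part of the chain that is missing from the window of level `j` is short. -/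
theorem window_at (C : Core sb p ε n st) (R : Regime p ε r)
    (H : Typical sb p.k p.a p.δ ε r) {m y : ℕ} (hm : m ≤ st.top + 1)
    (hy : st.trimPt ≤ y) (hyn : y ≤ n + 1)
    (hf : fPar sb p st m ≤ cnt sb m (st.Lf m) y) (hmy : 2 ^ m ≤ y) {j : ℕ} (hj : j < m) :
    ∃ c ≤ y, (∀ b, c ≤ b → b < y → sb j b → b ∈ st.P) ∧
      (fPar sb p st m : ℝ) - r * scale p.k p.a y ≤ cnt sb (j + 1) c y ∧
      fPar sb p st m ≤ cnt sb j c y := by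
  obtain ⟨c, hcP, hc⟩ := C.window j
  set f := fPar sb p st m with hfdef
  set s := scale p.k p.a y with hs
  have hs1 : 1 ≤ s := R.one_le_scale y
  have hc3 := R.c_gt
  have hε := R.ε_pos
  have hε1 := R.ε_le
  have hr : 0 ≤ r * s := by rw [R.r_eq]; positivity
  have hy1 : 1 ≤ y := C.one_le.trans hy
  have hcy : c ≤ y := by
    rcases hc with rfl | ⟨y', -, h2, h3, -⟩ <;> omega
  refine ⟨c, hcy, fun b h1 h2 => hcP b h1 (by omega), ?_⟩
  by_cases hD : f ≤ cnt sb (j + 1) c y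
  · refine ⟨?_, hD.trans (cnt_anti H.anti (Nat.le_succ j) _ _)⟩
    have : (f : ℝ) ≤ cnt sb (j + 1) c y := by exact_mod_cast hD
    linarith
  -- A window that reaches back to genesis contains the starting superchain of level m, hence at
  -- least f superblocks of level j+1, against the case assumption.
  rcases hc with rfl | ⟨y', h1, h2, h3, h4, h5⟩
  · exfalso
    refine hD (hf.trans ((cnt_mono sb m (Nat.zero_le _) le_rfl).trans ?_))
    exact cnt_anti H.anti hj _ _
  · push Not at hD
    have hfT := C.fPar_le R H hm
    have hfT' := C.fPar_le' R H hm
    have hTs : scale p.k p.a st.trimPt ≤ s := R.scale_mono C.one_le hy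
    have hy'y : y' ≤ y := h2.trans hy
    have hD' : (cnt sb (j + 1) y' y : ℝ) ≤ (2 * p.c + 1) * s := by
      have h6 : (cnt sb (j + 1) y' y : ℝ) ≤ f := by
        exact_mod_cast (cnt_mono sb (j + 1) h3 le_rfl).trans hD.le
      nlinarith
    have hlen := H.lower (j + 1) y' y hy'y hy1
    have hy'0 : (0 : ℝ) < y' := by exact_mod_cast h1
    have h4' : (2 : ℝ) ^ (j + 1) ≤ y' := by exact_mod_cast h4
    -- Fewer than f superblocks of level j+1 since `y'`, and 2^(j+1) at most `y'`, bound the growth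
    -- since that trim by a factor of order `scale`.
    have hlen2 : (y : ℝ) ≤ (1 + 5 / 4 * (2 * p.c + 1) + 10) * s * y' := by
      have e1 : (2 : ℝ) ^ (j + 1) * cnt sb (j + 1) y' y ≤ y' * ((2 * p.c + 1) * s) :=
        mul_le_mul h4' hD' (by positivity) hy'0.le
      have e2 : (2 : ℝ) ^ (j + 1) * s ≤ y' * s := mul_le_mul_of_nonneg_right h4' (by linarith)
      have e3 : (y' : ℝ) ≤ y' * s := le_mul_of_one_le_right hy'0.le hs1
      nlinarith
    have hQ : (0 : ℝ) ≤ p.Q := by positivity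
    have hscale : (1 - ε) * s ≤ scale p.k p.a y' :=
      R.scale_le_of_le_mul (by positivity) (by linarith) hy1 hy'0 hlen2
    have hDge : p.c * ((1 - ε) * ((1 - ε) * s)) ≤ cnt sb (j + 1) c y := by
      have e1 : (cnt sb (j + 1) c y' : ℝ) ≤ cnt sb (j + 1) c y := by
        exact_mod_cast cnt_mono sb (j + 1) le_rfl hy'y
      have e2 : (1 - ε) * ((1 - ε) * s) ≤ (1 - ε) * scale p.k p.a y' :=
        mul_le_mul_of_nonneg_left hscale (by linarith)
      nlinarith
    have hεs : 1 ≤ ε * s := R.k_ge.trans (mul_le_mul_of_nonneg_left (R.k_le_scale y) hε.le)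
    -- The window holds c(1 - ε)^2 * scale superblocks while f is at most c(1 + ε) * scale + 1; the
    -- choice r = 4cε covers the difference.
    have hlag : (f : ℝ) - r * s ≤ cnt sb (j + 1) c y := by
      rw [R.r_eq]
      have e1 : p.c * ((1 + ε) * scale p.k p.a st.trimPt) ≤ p.c * ((1 + ε) * s) := by
        refine mul_le_mul_of_nonneg_left ?_ (by linarith)
        exact mul_le_mul_of_nonneg_left hTs (by linarith)
      have e2 : 1 ≤ p.c * (ε * s) := by nlinarith
      have e3 : 0 ≤ p.c * (ε * ε * s) := by positivity
      nlinarith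
    refine ⟨hlag, ?_⟩
    -- `Typical.half` is only available away from genesis, which is a superblock of every level.
    have hc1 : 1 ≤ c := by
      by_contra h0
      have : c = 0 := by omega
      subst this
      refine absurd hD (not_lt.2 ((hf.trans (cnt_mono sb m (Nat.zero_le _) le_rfl)).trans ?_))
      exact cnt_anti H.anti hj _ _
    have hj4 : 2 ^ j ≤ 4 * y := by
      have := Nat.pow_le_pow_right (by norm_num : 0 < 2) hj.le
      omega
    have h2s : 2 * s ≤ cnt sb (j + 1) c y := by
      refine le_trans ?_ hDge
      have e1 : 0.98 * s ≤ (1 - ε) * ((1 - ε) * s) := by nlinarith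
      nlinarith
    have := H.half j c y hc1 hcy hj4 h2s
    have : (f : ℝ) ≤ cnt sb j c y := by linarith
    exact_mod_cast this

/-- What a successful trim at level `m` with trimming point `y` achieves. -/
structure Success (sb : ℕ → ℕ → Prop) (p : Params) (st : TrimState) (y m : ℕ) (st' : TrimState)
    (E : Finset ℕ) : Prop where
  eq : st' = trimmed st y m E
  two_pow_le : 2 ^ m ≤ y
  chain_subset : chain sb st y m ⊆ E
  subset : E ⊆ seg st.P (st.Lf m) y
  card_le : (E.card : ℝ) ≤ cnt sb m (st.Lf m) y + m * (loopBound p * scale p.k p.a y)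
  window : ∀ j < m, ∃ c < y, fPar sb p st m ≤ cnt sb (j + 1) c y ∧
    ∀ b ∈ st.P, c ≤ b → b < y → sb j b → b ∈ E

/-- This feeds `window_at` and the estimates for g and f into `trim_spec`. The bound `hcnt` is what
guarantees that g is not too small. -/
theorem success (C : Core sb p ε n st) (R : Regime p ε r)
    (H : Typical sb p.k p.a p.δ ε r) {m y : ℕ} (hm1 : 1 ≤ m) (hm : m ≤ st.top + 1)
    (hy : st.trimPt ≤ y) (hyn : y ≤ n + 1)
    (hcnt : (cnt sb m (st.Lf (m - 1)) y : ℝ) ≤ atBound p * scale p.k p.a y)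
    (hf : fPar sb p st m ≤ cnt sb m (st.Lf m) y) :
    Good sb p.δ (gPar sb p st m) m (chain sb st y m) ∧
      ∃ st', trim sb p st y m = some st' ∧ ∃ E, Success sb p st y m st' E := by
  have hy1 : 1 ≤ y := C.one_le.trans hy
  have hmy := C.two_pow_le R H hm1 hm hy hf
  have hs1 : 1 ≤ scale p.k p.a y := R.one_le_scale y
  have hc3 := R.c_gt
  have hε := R.ε_pos
  have hr : 0 ≤ r * scale p.k p.a y := by rw [R.r_eq]; positivity
  have hM : ∀ j < m, ∀ A ≤ y, cnt sb (j + 1) A y ≤ fPar sb p st m →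
      cnt sb j A y ≤ ⌊loopBound p * scale p.k p.a y⌋₊ := by
    intro j _ A hA h
    refine Nat.le_floor ?_
    refine Regime.cnt_le_of_cnt_succ_le H hy1 hA (by positivity) ?_
    have h1 := C.fPar_le' R H hm
    have h2 : scale p.k p.a st.trimPt ≤ scale p.k p.a y := R.scale_mono C.one_le hy
    have h3 : (cnt sb (j + 1) A y : ℝ) ≤ fPar sb p st m := by exact_mod_cast h
    nlinarith
  obtain ⟨⟨-, hgood⟩, E, h1, h2, h3, h4, h5⟩ := trim_spec H R.δ_pos R.δ_lt rfl hy1 hm1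
    (by omega) (one_le_fPar R sb st m) (C.le_gPar R H hm1 hy hcnt)
    (by linarith [one_le_gPar R sb st m]) (gPar_le_fPar R sb st m) hr
    (fun j hj => C.window_at R H hm hy hyn hf hmy hj) hM
    (fun b h1 h2 => C.complete m b h1 (by omega)) hf
  refine ⟨hgood, _, h1, E, rfl, hmy, h2, h3, ?_, h5⟩
  have h6 : (E.card : ℝ) ≤ cnt sb m (st.Lf m) y + m * (⌊loopBound p * scale p.k p.a y⌋₊ : ℝ) := by
    exact_mod_cast h4
  have h7 : (⌊loopBound p * scale p.k p.a y⌋₊ : ℝ) ≤ loopBound p * scale p.k p.a y :=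
    Nat.floor_le (by unfold loopBound; positivity)
  have h8 : (m : ℝ) * (⌊loopBound p * scale p.k p.a y⌋₊ : ℝ) ≤
      m * (loopBound p * scale p.k p.a y) := mul_le_mul_of_nonneg_left h7 (by positivity)
  linarith

theorem Success.mem {y m b : ℕ} {st' : TrimState} {E : Finset ℕ}
    (S : Success sb p st y m st' E) (hb : b ∈ st.P) (h : b < y → st.Lf m ≤ b → b ∈ E) :
    b ∈ st'.P := by
  rw [S.eq]
  simp only [trimmed, Finset.mem_union, Finset.mem_filter]
  by_cases h1 : b < st.Lf m
  · exact Or.inl (Or.inl ⟨hb, h1⟩)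
  · by_cases h2 : y ≤ b
    · exact Or.inr ⟨hb, h2⟩
    · exact Or.inl (Or.inr (h (by omega) (by omega)))

theorem Success.subset_P {y m : ℕ} {st' : TrimState} {E : Finset ℕ}
    (S : Success sb p st y m st' E) : st'.P ⊆ st.P := by
  rw [S.eq]
  intro b hb
  simp only [trimmed, Finset.mem_union, Finset.mem_filter] at hb
  rcases hb with (hb | hb) | hb
  · exact hb.1
  · exact (mem_seg.1 (S.subset hb)).1
  · exact hb.1

/-- Levels from m on lose no superblocks, since these belong to the starting superchain. Each lower
level keeps a window, the later one of its old window and the one that the loop leaves behind. -/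
theorem Success.core {y m : ℕ} {st' : TrimState} {E : Finset ℕ}
    (S : Success sb p st y m st' E) (C : Core sb p ε n st) (R : Regime p ε r)
    (H : Typical sb p.k p.a p.δ ε r) (hm1 : 1 ≤ m)
    (hm : m ≤ st.top + 1) (hy : st.trimPt ≤ y) (hyn : y ≤ n + 1)
    (hcnt : (cnt sb m (st.Lf (m - 1)) y : ℝ) ≤ atBound p * scale p.k p.a y) :
    Core sb p ε n st' := by
  have hy1 : 1 ≤ y := C.one_le.trans hy
  have hLf : ∀ ν, st'.Lf ν = if ν < m then y - 1 else st.Lf ν := fun ν => by rw [S.eq]; rfl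
  have hLl : ∀ ν, st'.Ll ν = if ν ≤ m then y - 1 else st.Ll ν := fun ν => by rw [S.eq]; rfl
  have htp : st'.trimPt = y := by rw [S.eq]; rfl
  have htop : st'.top = max st.top m := by rw [S.eq]; rfl
  have hkeep : ∀ ν b, m ≤ ν → b ∈ st.P → sb ν b → b ∈ st'.P := fun ν b hν hb hsb =>
    S.mem hb fun h1 h2 => S.chain_subset
      (mem_up.2 ⟨mem_seg.2 ⟨hb, h2, h1⟩, H.anti m ν b hν hsb⟩)
  have hnew : ∀ ν, ν < m → ∃ c, (∀ b, c ≤ b → b ≤ n → sb ν b → b ∈ st'.P) ∧ c < y ∧ (c = 0 ∨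
      ∃ x, 1 ≤ x ∧ x ≤ y ∧ c ≤ x ∧ 2 ^ (ν + 1) ≤ x ∧
      p.c * ((1 - ε) * scale p.k p.a x) ≤ cnt sb (ν + 1) c x) := by
    intro ν hν
    obtain ⟨c, h1, h2⟩ := C.window ν
    obtain ⟨c', h3, h4, h5⟩ := S.window ν hν
    refine ⟨max c c', fun b i1 i2 i3 => ?_, ?_, ?_⟩
    · have hb := h1 b (by omega) i2 i3
      exact S.mem hb fun i4 _ => h5 b hb (by omega) i4 i3
    -- The strict inequality matters because the new lower ranges begin at y - 1. An old window
    -- starting at `y` or later would contain no superblocks, contrary to its lower bound.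
    · by_contra hlt
      have hle : y ≤ c := by omega
      rcases h2 with h2 | ⟨x, i1, i2, i3, i4, i5⟩
      · omega
      · rw [cnt_eq_zero _ _ (by omega : x ≤ c)] at i5
        have := R.c_gt
        have := R.one_le_scale x
        have := R.ε_le
        have : 0 < p.c * ((1 - ε) * scale p.k p.a x) := by
          have : 0 < 1 - ε := by linarith
          positivity
        simp only [Nat.cast_zero] at i5
        linarith
    · rcases le_total c' c with h | h
      · rw [max_eq_left h]
        rcases h2 with h2 | ⟨x, i1, i2, i3⟩
        · exact Or.inl h2
        · exact Or.inr ⟨x, i1, i2.trans hy, i3⟩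
      · rw [max_eq_right h]
        refine Or.inr ⟨y, hy1, le_rfl, h3.le,
          (Nat.pow_le_pow_right (by norm_num) hν).trans S.two_pow_le, ?_⟩
        have i1 := C.le_gPar R H hm1 hy hcnt
        have i2 : p.c * gPar sb p st m ≤ fPar sb p st m := mul_gPar_le_fPar m
        have i3 : (fPar sb p st m : ℝ) ≤ cnt sb (ν + 1) c' y := by exact_mod_cast h4
        have := R.c_gt
        nlinarith
  refine
    { le_last := fun b hb => C.le_last b (S.subset_P hb)
      one_le := by rw [htp]; exact hy1
      trimPt_le := by rw [htp]; exact hyn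
      Ll_zero := by rw [hLl, htp]; simp; omega
      link := fun ν => ?_
      Ll_anti := fun ν => ?_
      above := fun ν hν => ?_
      complete := fun ν b h1 h2 h3 => ?_
      window := fun ν => ?_
      top_le := ?_ }
  · rw [hLf, hLl]
    by_cases h : ν < m
    · rw [if_pos h, if_pos (by omega)]
    · rw [if_neg h, if_neg (by omega), C.link]
  · rw [hLl, hLl]
    have := C.Ll_anti ν
    have := C.Ll_le (ν + 1)
    split_ifs <;> omega
  · rw [hLl, if_neg (by omega)]
    exact C.above ν (by omega)
  · rw [hLf] at h1
    by_cases h : ν < m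
    · rw [if_pos h] at h1
      obtain ⟨c, i1, i2, -⟩ := hnew ν h
      exact i1 b (by omega) h2 h3
    · rw [if_neg h] at h1
      exact hkeep ν b (by omega) (C.complete ν b h1 h2 h3) h3
  · rw [htp]
    by_cases h : ν < m
    · obtain ⟨c, i1, -, i3⟩ := hnew ν h
      exact ⟨c, i1, i3⟩
    · obtain ⟨c, i1, i2⟩ := C.window ν
      refine ⟨c, fun b j1 j2 j3 => hkeep ν b (by omega) (i1 b j1 j2 j3) j3, ?_⟩
      rcases i2 with i2 | ⟨x, j1, j2, j3⟩
      · exact Or.inl i2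
      · exact Or.inr ⟨x, j1, j2.trans hy, j3⟩
  · rw [htop, htp]
    rcases le_total st.top m with h | h
    · rw [max_eq_right h]; exact S.two_pow_le
    · rw [max_eq_left h]; exact C.top_le.trans hy

/-- Ranges below m collapse to the single block y - 1, range m lies in `E`, and higher ranges can
only shrink. -/
theorem Success.card_levelRange_le {y m : ℕ} {st' : TrimState} {E : Finset ℕ}
    (S : Success sb p st y m st' E) (hy1 : 1 ≤ y) {K : ℕ} (hK : 1 ≤ K)
    (hold : ∀ ν, (st.levelRange ν).card ≤ K) (hE : E.card ≤ K) (ν : ℕ) :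
    (st'.levelRange ν).card ≤ K := by
  have hLf : st'.Lf ν = if ν < m then y - 1 else st.Lf ν := by rw [S.eq]; rfl
  have hLl : st'.Ll ν = if ν ≤ m then y - 1 else st.Ll ν := by rw [S.eq]; rfl
  unfold TrimState.levelRange
  rcases lt_trichotomy ν m with h | rfl | h
  · rw [hLf, hLl, if_pos h, if_pos h.le]
    refine le_trans (Finset.card_le_card (t := {y - 1}) fun b hb => ?_) (by simpa using hK)
    obtain ⟨-, h1, h2⟩ := mem_seg.1 hb
    rw [Finset.mem_singleton]
    omega
  · rw [hLf, hLl, if_neg (lt_irrefl _), if_pos le_rfl]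
    refine le_trans (Finset.card_le_card fun b hb => ?_) hE
    obtain ⟨h1, h2, h3⟩ := mem_seg.1 hb
    rw [S.eq] at h1
    simp only [trimmed, Finset.mem_union, Finset.mem_filter] at h1
    rcases h1 with (h1 | h1) | h1
    · omega
    · exact h1
    · omega
  · rw [hLf, hLl, if_neg (by omega), if_neg (by omega)]
    refine le_trans (Finset.card_le_card fun b hb => ?_) (hold ν)
    obtain ⟨h1, h2, h3⟩ := mem_seg.1 hb
    exact mem_seg.2 ⟨S.subset_P h1, h2, h3⟩

end Core

/-! ### The invariants along the protocol -/

/-- After an attempt with trimming point `τ`, no level range below the top has many superblocks of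
the next level before `τ`, and the trimming point of an attempt `q` blocks later is close to `τ`. -/
def Reach (sb : ℕ → ℕ → Prop) (p : Params) (n q : ℕ) (st : TrimState) (τ : ℕ) : Prop :=
  st.trimPt ≤ τ ∧ τ ≤ n + 1 ∧
  (∀ m, 1 ≤ m → m ≤ st.top + 1 →
    (cnt sb m (st.Lf (m - 1)) τ : ℝ) ≤ afterBound p * scale p.k p.a st.trimPt) ∧
  (n : ℝ) - tailLen sb p st ≤ τ + 3 * scale p.k p.a st.trimPt + q

/-- Level ranges are short. -/
def ShortRanges (p : Params) (st : TrimState) : Prop :=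
  ∀ ν, ((st.levelRange ν).card : ℝ) ≤ rangeBound p * scale p.k p.a st.trimPt ^ 2

section

variable {sb : ℕ → ℕ → Prop} {p : Params} {ε r : ℝ} {n : ℕ} {st : TrimState}

theorem Core.one_le_cumWeight (C : Core sb p ε n st) (hgen : ∀ μ, sb μ 0) (m : ℕ) :
    (1 : ℝ) ≤ cumWeight sb st m := by
  have := (Nat.one_le_two_pow (n := max m st.top)).trans (C.two_pow_le_cumWeight hgen m)
  exact_mod_cast this

theorem Core.tailLen_nonneg (C : Core sb p ε n st) (R : Regime p ε r) (hgen : ∀ μ, sb μ 0) :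
    0 ≤ tailLen sb p st := by
  have h1 := C.one_le_cumWeight hgen 0
  have h2 : 0 ≤ Real.log ((cumWeight sb st 0 : ℝ) + (st.tail.card : ℝ)) := by
    refine Real.log_nonneg ?_
    have : (0 : ℝ) ≤ st.tail.card := by positivity
    linarith
  have := R.a_ge
  unfold tailLen
  have : (0 : ℝ) ≤ p.k' := by positivity
  nlinarith

theorem Core.sup_eq (C : Core sb p ε n st) (h0 : ∀ b, sb 0 b) : st.P.sup (fun b => b) = n := by
  apply le_antisymm
  · exact Finset.sup_le C.le_last
  · have := C.trimPt_le
    exact Finset.le_sup (f := fun b => b) (C.mem_of_trimPt_le h0 (by omega) le_rfl)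

theorem Core.newTrimPt_eq (C : Core sb p ε n st) (h0 : ∀ b, sb 0 b) :
    newTrimPt sb p st = max st.trimPt ⌊(n : ℝ) - tailLen sb p st⌋₊ := by
  unfold newTrimPt
  rw [C.sup_eq h0]

theorem Core.newTrimPt_le (C : Core sb p ε n st) (R : Regime p ε r) (h0 : ∀ b, sb 0 b)
    (hgen : ∀ μ, sb μ 0) : newTrimPt sb p st ≤ n + 1 := by
  rw [C.newTrimPt_eq h0]
  refine max_le C.trimPt_le ?_
  have := C.tailLen_nonneg R hgen
  refine (Nat.floor_le_of_le (a := (n : ℝ) - tailLen sb p st) (n := n) (by linarith)).trans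
    (Nat.le_succ n)

theorem Core.sub_tailLen_lt (C : Core sb p ε n st) (h0 : ∀ b, sb 0 b) :
    (n : ℝ) - tailLen sb p st < newTrimPt sb p st + 1 := by
  rw [C.newTrimPt_eq h0]
  refine (Nat.lt_floor_add_one _).trans_le ?_
  have : ((⌊(n : ℝ) - tailLen sb p st⌋₊ : ℕ) : ℝ) ≤
      ((max st.trimPt ⌊(n : ℝ) - tailLen sb p st⌋₊ : ℕ) : ℝ) := by
    exact_mod_cast le_max_right _ _
  linarith

/-- The trimming point advances by an amount of the order of `scale`. -/
theorem Core.cnt_newTrimPt_le (C : Core sb p ε n st) (R : Regime p ε r) (h0 : ∀ b, sb 0 b) {τ : ℕ}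
    (hτ : Reach sb p n p.Q st τ) {m : ℕ} (hm1 : 1 ≤ m) (hm : m ≤ st.top + 1) :
    (cnt sb m (st.Lf (m - 1)) (newTrimPt sb p st) : ℝ) ≤
      atBound p * scale p.k p.a st.trimPt := by
  obtain ⟨h1, -, h3, h4⟩ := hτ
  have hs1 := R.one_le_scale st.trimPt
  set y := newTrimPt sb p st with hy
  -- The new point is either the unchanged trimming point, at most τ, or the rounded target, which
  -- `Reach` bounds. A negative target rounds to 0.
  have h5 : ((y - τ : ℕ) : ℝ) ≤ 3 * scale p.k p.a st.trimPt + p.Q := by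
    rcases le_total y τ with h | h
    · rw [Nat.sub_eq_zero_of_le h]
      simp only [Nat.cast_zero]
      positivity
    · rw [Nat.cast_sub h]
      rw [C.newTrimPt_eq h0] at hy
      rcases max_choice st.trimPt ⌊(n : ℝ) - tailLen sb p st⌋₊ with h6 | h6
      · rw [h6] at hy
        have : (y : ℝ) ≤ τ := by exact_mod_cast hy ▸ h1
        have : 0 ≤ 3 * scale p.k p.a st.trimPt + p.Q := by positivity
        linarith
      · rw [h6] at hy
        by_cases hneg : 0 ≤ (n : ℝ) - tailLen sb p st
        · have h7 := Nat.floor_le hneg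
          rw [← hy] at h7
          linarith
        · push Not at hneg
          have : (y : ℝ) = 0 := by rw [hy, Nat.floor_of_nonpos hneg.le]; simp
          have : 0 ≤ 3 * scale p.k p.a st.trimPt + p.Q := by positivity
          have : (0 : ℝ) ≤ τ := by positivity
          linarith
  have h6 : (cnt sb m (st.Lf (m - 1)) y : ℝ) ≤
      cnt sb m (st.Lf (m - 1)) τ + ((y - τ : ℕ) : ℝ) := by
    exact_mod_cast cnt_le_add sb m (st.Lf (m - 1)) τ y
  have h7 := h3 m hm1 hm
  have h8 : (p.Q : ℝ) ≤ p.Q * scale p.k p.a st.trimPt :=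
    le_mul_of_one_le_right (by positivity) hs1
  unfold atBound
  nlinarith

/-- A successful trim leaves the required tail. -/
theorem Core.Success.sub_tailLen_le {y m : ℕ} {st' : TrimState} {E : Finset ℕ}
    (S : Core.Success sb p st y m st' E) (C : Core sb p ε n st) (C' : Core sb p ε n st')
    (R : Regime p ε r) (H : Typical sb p.k p.a p.δ ε r) (hy : st.trimPt ≤ y) (hyn : y ≤ n + 1)
    (hfl : (n : ℝ) - tailLen sb p st < y + 1) :
    (n : ℝ) - tailLen sb p st' ≤ y + 3 * scale p.k p.a y := by
  have htp : st'.trimPt = y := by rw [S.eq]; rfl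
  have hy1 : 1 ≤ y := C.one_le.trans hy
  have hs1 := R.one_le_scale y
  have hs0 : 0 < scale p.k p.a y := by linarith
  have hS := C.cumWeight_le R H (Nat.zero_le _ : 0 ≤ st.top + 1)
  have hS' := C'.one_le_cumWeight H.genesis 0
  have hS1 := C.one_le_cumWeight H.genesis 0
  have ht : (st.tail.card : ℝ) ≤ st'.tail.card + y := by
    rw [C.card_tail H.zero, C'.card_tail H.zero, htp]
    exact_mod_cast (by omega : n + 1 - st.trimPt ≤ n + 1 - y + y)
  set S0 : ℝ := ((cumWeight sb st 0 : ℕ) : ℝ) with hS0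
  set S0' : ℝ := ((cumWeight sb st' 0 : ℕ) : ℝ) with hS0'
  have ht0 : (0 : ℝ) ≤ st.tail.card := by positivity
  have ht0' : (0 : ℝ) ≤ st'.tail.card := by positivity
  have hy0 : (1 : ℝ) ≤ y := by exact_mod_cast hy1
  have hS2 : S0 ≤ 60 * scale p.k p.a y * y := by
    refine hS.trans ?_
    have e1 : scale p.k p.a st.trimPt ≤ scale p.k p.a y := R.scale_mono C.one_le hy
    have e2 : (st.trimPt : ℝ) ≤ y := by exact_mod_cast hy
    have e3 := R.one_le_scale st.trimPt
    exact mul_le_mul (by linarith) e2 (by positivity) (by linarith)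
  -- A successful trim can shrink the weight and with it the required tail, so the next target may
  -- jump ahead. As weight and tail before were at most 62 * scale * y times those after, the jump
  -- is at most `scale` plus a negligible term.
  have h1 : Real.log (S0 + st.tail.card) ≤
      Real.log (62 * scale p.k p.a y * y) + Real.log (S0' + st'.tail.card) := by
    rw [← Real.log_mul (by positivity) (by linarith)]
    refine Real.log_le_log (by linarith) ?_
    have e1 : 1 + S0 + y ≤ 62 * scale p.k p.a y * y := by nlinarith
    have e2 : S0 + st.tail.card ≤ (1 + S0 + y) * (S0' + st'.tail.card) := by nlinarith
    refine e2.trans (mul_le_mul_of_nonneg_right e1 (by linarith))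
  have h2 : Real.log (62 * scale p.k p.a y * y) =
      Real.log (62 * scale p.k p.a y) + Real.log y := Real.log_mul (by positivity) (by linarith)
  have hc := R.c_gt
  have h3 := R.log_scale_le (K := 62) (by norm_num)
    (by have : (0 : ℝ) ≤ p.Q := by positivity
        linarith) y
  have ha := R.a_ge
  have h4 : scale p.k p.a y = p.k + p.a * Real.log y := rfl
  have h5 : (0 : ℝ) ≤ p.k := by positivity
  have h6 : tailLen sb p st = p.k' + p.a * Real.log (S0 + st.tail.card) := rfl
  have h7 : tailLen sb p st' = p.k' + p.a * Real.log (S0' + st'.tail.card) := rfl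
  have h8 : p.a * Real.log (S0 + st.tail.card) ≤ p.a * (Real.log (62 * scale p.k p.a y) +
      Real.log y + Real.log (S0' + st'.tail.card)) :=
    mul_le_mul_of_nonneg_left (by rw [← h2]; exact h1) (by linarith)
  have hε := R.ε_le
  have h9 : ε * scale p.k p.a y ≤ 1 / 100 * scale p.k p.a y :=
    mul_le_mul_of_nonneg_right hε (by linarith)
  rw [h6] at hfl
  rw [h7]
  nlinarith

/-- The constants close up when a new top level is opened: passing up one level multiplies the bound
by (5/8)(5/4) = 25/32 and adds 25/4 + 12, which is less than 19. -/
theorem Regime.afterBound_ge (R : Regime p ε r) {s : ℝ} (hs : 1 ≤ s) :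
    25 / 32 * (atBound p * s) + 19 * s ≤ afterBound p * s := by
  have : (0 : ℝ) ≤ p.Q := by positivity
  have := R.c_gt
  unfold atBound afterBound
  nlinarith

theorem Regime.level_le_scale (R : Regime p ε r) {m y : ℕ} (h : 2 ^ m ≤ y) :
    (m : ℝ) ≤ scale p.k p.a y := by
  have h1 : (m : ℝ) * Real.log 2 ≤ Real.log y := by
    rw [← Real.log_pow]
    exact Real.log_le_log (by positivity) (by exact_mod_cast h)
  have h2 := R.log_le_scale y
  have h3 := Real.log_two_gt_d9
  have h4 : (0 : ℝ) ≤ m := by positivity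
  nlinarith

/-- By `Core.success` an attempt stops at the highest level with a long enough superchain, so every
higher level has fewer than f superblocks; this renews the bounds in `Reach`. -/
theorem attempt_spec (C : Core sb p ε n st) (R : Regime p ε r)
    (H : Typical sb p.k p.a p.δ ε r) (hshort : ShortRanges p st) {τ : ℕ}
    (hτ : Reach sb p n p.Q st τ) :
    Core sb p ε n (attempt sb p st) ∧ ShortRanges p (attempt sb p st) ∧
      ∃ τ, Reach sb p n 0 (attempt sb p st) τ := by
  set y := newTrimPt sb p st with hydef
  have hy : st.trimPt ≤ y := le_max_left _ _
  have hyn : y ≤ n + 1 := C.newTrimPt_le R H.zero H.genesis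
  have hy1 : 1 ≤ y := C.one_le.trans hy
  have hfl : (n : ℝ) - tailLen sb p st < y + 1 := C.sub_tailLen_lt H.zero
  have hTs : scale p.k p.a st.trimPt ≤ scale p.k p.a y := R.scale_mono C.one_le hy
  have hs1 := R.one_le_scale y
  have hsT := R.one_le_scale st.trimPt
  have hc3 := R.c_gt
  have hQ0 : (0 : ℝ) ≤ p.Q := by positivity
  have hat : 0 ≤ atBound p := by unfold atBound afterBound; linarith
  have hcntT : ∀ m, 1 ≤ m → m ≤ st.top + 1 →
      (cnt sb m (st.Lf (m - 1)) y : ℝ) ≤ atBound p * scale p.k p.a st.trimPt :=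
    fun m h1 h2 => C.cnt_newTrimPt_le R H.zero hτ h1 h2
  have hcnt : ∀ m, 1 ≤ m → m ≤ st.top + 1 →
      (cnt sb m (st.Lf (m - 1)) y : ℝ) ≤ atBound p * scale p.k p.a y :=
    fun m h1 h2 => (hcntT m h1 h2).trans (mul_le_mul_of_nonneg_left hTs hat)
  have hspec := attemptFrom_spec (sb := sb) (p := p) (st := st) (y := y)
    (φ := fun m st' => fPar sb p st m ≤ (chain sb st y m).card ∧
      ∃ E, Core.Success sb p st y m st' E) (st.top + 1)
    (fun m h1 h2 h3 => by
      have h3' := h3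
      rw [C.card_chain hyn] at h3'
      obtain ⟨i1, st', i2, E, i3⟩ := C.success R H h1 h2 hy hyn (hcnt m h1 h2) h3'
      exact ⟨i1, st', i2, h3, E, i3⟩)
  have hfail : ∀ m, m ≤ st.top + 1 → (chain sb st y m).card < fPar sb p st m →
      (cnt sb m (st.Lf m) y : ℝ) ≤ (2 * p.c + 1) * scale p.k p.a st.trimPt := by
    intro m h1 h2
    rw [C.card_chain hyn] at h2
    have : (cnt sb m (st.Lf m) y : ℝ) ≤ fPar sb p st m := by exact_mod_cast h2.le
    exact this.trans (C.fPar_le' R H h1)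
  have hLf : ∀ m, cnt sb m (st.Lf (m - 1)) y ≤ cnt sb m (st.Lf m) y :=
    fun m => cnt_mono sb m (C.Lf_anti (Nat.sub_le m 1)) le_rfl
  have hf_after : (2 * p.c + 1) ≤ afterBound p := by unfold afterBound; linarith
  change Core sb p ε n (attemptFrom sb p st y (st.top + 1)) ∧
    ShortRanges p (attemptFrom sb p st y (st.top + 1)) ∧
      ∃ τ, Reach sb p n 0 (attemptFrom sb p st y (st.top + 1)) τ
  rcases hspec with ⟨h1, h2⟩ | ⟨m, hm1, hm, ⟨hfc, E, S⟩, hhigh⟩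
  · rw [h1]
    -- When every level fails the state is unchanged, but the reference point τ moves up to the
    -- point `y` just tried.
    refine ⟨C, hshort, y, hy, hyn, fun m i1 i2 => ?_, ?_⟩
    · have i3 : (cnt sb m (st.Lf (m - 1)) y : ℝ) ≤ cnt sb m (st.Lf m) y := by
        exact_mod_cast hLf m
      have i4 := hfail m i2 (h2 m i1 i2)
      nlinarith
    · simp only [Nat.cast_zero, add_zero]
      linarith
  · set st' := attemptFrom sb p st y (st.top + 1) with hst'
    have C' : Core sb p ε n st' := S.core C R H hm1 hm hy hyn (hcnt m hm1 hm)
    have htp : st'.trimPt = y := by rw [S.eq]; rfl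
    have htop : st'.top = max st.top m := by rw [S.eq]; rfl
    have hLf' : ∀ ν, st'.Lf ν = if ν < m then y - 1 else st.Lf ν := fun ν => by rw [S.eq]; rfl
    -- If m is not a new level, level m+1 failed and passing down one level costs a constant factor.
    -- If it is, the range begins at genesis and the bound at the attempt applies directly.
    have hE0 : (cnt sb m (st.Lf m) y : ℝ) ≤ (atBound p + loopBound p) * scale p.k p.a y := by
      have hlb : 0 ≤ loopBound p := by unfold loopBound; linarith
      by_cases hmt : m ≤ st.top
      · have i1 := hfail (m + 1) (by omega) (hhigh (m + 1) (by omega) (by omega))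
        have i2 : (cnt sb (m + 1) (st.Lf m) y : ℝ) ≤ (2 * p.c + 1) * scale p.k p.a y := by
          have i3 : (cnt sb (m + 1) (st.Lf m) y : ℝ) ≤ cnt sb (m + 1) (st.Lf (m + 1)) y := by
            exact_mod_cast hLf (m + 1)
          nlinarith
        have i4 : st.Lf m ≤ y := by
          have := C.Lf_le_Ll m
          have := C.Ll_le m
          omega
        have i5 := Regime.cnt_le_of_cnt_succ_le H hy1 i4 (by positivity) i2
        change _ ≤ loopBound p * scale p.k p.a y at i5
        nlinarith
      · have i1 := hcnt m hm1 hm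
        rw [C.Lf_eq_zero (by omega)] at i1
        rw [C.Lf_eq_zero (by omega)]
        nlinarith
    refine ⟨C', ?_, y, ?_, hyn, ?_, ?_⟩
    · have hlb : 0 ≤ loopBound p := by unfold loopBound; linarith
      have hms := R.level_le_scale S.two_pow_le
      set s := scale p.k p.a y with hs
      have hss : s ≤ s ^ 2 := by nlinarith
      have hrb : rangeBound p = atBound p + 2 * loopBound p + 1 := rfl
      have hfloor : ∀ x : ℕ, (x : ℝ) ≤ rangeBound p * s ^ 2 → x ≤ ⌊rangeBound p * s ^ 2⌋₊ :=
        fun x hx => Nat.le_floor hx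
      have hrb0 : 0 ≤ rangeBound p := by rw [hrb]; linarith
      intro ν
      rw [htp]
      have hK := S.card_levelRange_le hy1 (K := ⌊rangeBound p * s ^ 2⌋₊)
        (hfloor 1 (by push_cast; nlinarith)) (fun ν => hfloor _ ((hshort ν).trans ?_))
        (hfloor _ ?_) ν
      · refine le_trans ?_ (Nat.floor_le (by positivity : 0 ≤ rangeBound p * s ^ 2))
        exact_mod_cast hK
      · refine mul_le_mul_of_nonneg_left ?_ hrb0
        exact pow_le_pow_left₀ (by linarith) hTs 2
      · have i1 := S.card_le
        have i2 : (m : ℝ) * (loopBound p * s) ≤ s * (loopBound p * s) :=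
          mul_le_mul_of_nonneg_right hms (by positivity)
        rw [hrb]
        nlinarith
    · rw [htp]
    · intro m' i1 i2
      rw [htp, hLf']
      -- Three kinds of level: those whose bounding range now starts at y - 1, old levels above m,
      -- which all failed, and the level above a newly opened top.
      by_cases hmm : m' - 1 < m
      · rw [if_pos hmm]
        have i3 : (cnt sb m' (y - 1) y : ℝ) ≤ 1 := by
          exact_mod_cast (cnt_le sb m' (y - 1) y).trans (by omega)
        nlinarith
      · rw [if_neg hmm]
        by_cases hmt : m' ≤ st.top + 1
        · have i3 : (cnt sb m' (st.Lf (m' - 1)) y : ℝ) ≤ cnt sb m' (st.Lf m') y := by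
            exact_mod_cast hLf m'
          have i4 := hfail m' hmt (hhigh m' (by omega) hmt)
          nlinarith
        -- No attempt was made at this level. Its count from genesis is about half that of the
        -- previous level, which keeps it below `afterBound`.
        · have e1 : m = st.top + 1 := by omega
          have e2 : m' = m + 1 := by omega
          rw [e2, Nat.add_sub_cancel, C.Lf_eq_zero (by omega)]
          have i3 := hcnt m hm1 hm
          rw [C.Lf_eq_zero (by omega)] at i3
          have i4 := H.lower m 0 y (Nat.zero_le _) hy1
          have i5 := H.upper (m + 1) 0 y (Nat.zero_le _) hy1
          have hp : (0 : ℝ) < 2 ^ m := by positivity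
          rw [Nat.cast_zero, sub_zero] at i4 i5
          have i6 : (y : ℝ) / 2 ^ m ≤
              5 / 4 * (atBound p * scale p.k p.a y) + 10 * scale p.k p.a y := by
            rw [div_le_iff₀ hp]
            nlinarith
          have i7 : 5 / 4 * (y : ℝ) / 2 ^ (m + 1) = 5 / 8 * ((y : ℝ) / 2 ^ m) := by
            rw [pow_succ]; field_simp; norm_num
          rw [i7] at i5
          have i8 := R.afterBound_ge hs1
          nlinarith
    · simp only [Nat.cast_zero, add_zero]
      rw [htp]
      exact S.sub_tailLen_le C C' R H hy hyn hfl

/-- A block that is appended to the chain. -/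
def append (st : TrimState) (b : ℕ) : TrimState := { st with P := insert b st.P }

theorem seg_insert_of_le {s : Finset ℕ} {b i j : ℕ} (h : j ≤ b) : seg (insert b s) i j = seg s i j := by
  ext x
  simp only [mem_seg, Finset.mem_insert]
  constructor
  · rintro ⟨rfl | h1, h2⟩
    · omega
    · exact ⟨h1, h2⟩
  · rintro ⟨h1, h2⟩
    exact ⟨Or.inr h1, h2⟩

theorem Core.append_levelRange (C : Core sb p ε n st) (ν : ℕ) :
    (append st (n + 1)).levelRange ν = st.levelRange ν := by
  have h1 : (HybridNode.append st (n + 1)).Ll ν + 1 ≤ st.trimPt := C.Ll_le ν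
  have h2 := C.trimPt_le
  exact seg_insert_of_le (by omega)

theorem Core.append_cumWeight (C : Core sb p ε n st) (m : ℕ) :
    cumWeight sb (append st (n + 1)) m = cumWeight sb st m := by
  unfold cumWeight
  refine Finset.sum_congr rfl fun ν _ => ?_
  unfold weight
  rw [C.append_levelRange]

theorem Core.append (C : Core sb p ε n st) : Core sb p ε (n + 1) (append st (n + 1)) where
  le_last b hb := by
    rcases Finset.mem_insert.1 hb with rfl | hb
    · exact le_rfl
    · exact (C.le_last b hb).trans (Nat.le_succ n)
  one_le := C.one_le
  trimPt_le := C.trimPt_le.trans (Nat.le_succ _)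
  Ll_zero := C.Ll_zero
  link := C.link
  Ll_anti := C.Ll_anti
  above := C.above
  complete ν b h1 h2 h3 := by
    refine Finset.mem_insert.2 ?_
    rcases Nat.le_succ_iff.1 h2 with h | rfl
    · exact Or.inr (C.complete ν b h1 h h3)
    · exact Or.inl rfl
  window ν := by
    obtain ⟨c, h1, h2⟩ := C.window ν
    refine ⟨c, fun b i1 i2 i3 => Finset.mem_insert.2 ?_, h2⟩
    rcases Nat.le_succ_iff.1 i2 with h | rfl
    · exact Or.inr (h1 b i1 h i3)
    · exact Or.inl rfl
  top_le := C.top_le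

/-- Appending a block only lengthens the required tail, so the target advances by at most one. -/
theorem Core.reach_append (C : Core sb p ε n st) (R : Regime p ε r) (H : Typical sb p.k p.a p.δ ε r)
    {τ q : ℕ} (hτ : Reach sb p n q st τ) :
    Reach sb p (n + 1) (q + 1) (HybridNode.append st (n + 1)) τ := by
  obtain ⟨h1, h2, h3, h4⟩ := hτ
  refine ⟨h1, by omega, h3, ?_⟩
  have i1 : tailLen sb p st ≤ tailLen sb p (HybridNode.append st (n + 1)) := by
    unfold tailLen
    rw [C.append_cumWeight, C.append.card_tail H.zero, C.card_tail H.zero]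
    have e1 := C.one_le_cumWeight H.genesis 0
    have e2 : ((n + 1 - st.trimPt : ℕ) : ℝ) ≤
        ((n + 1 + 1 - (HybridNode.append st (n + 1)).trimPt : ℕ) : ℝ) := by
      exact_mod_cast Nat.sub_le_sub_right (Nat.le_succ (n + 1)) st.trimPt
    have e3 : (0 : ℝ) ≤ ((n + 1 - st.trimPt : ℕ) : ℝ) := by positivity
    have := Real.log_le_log (by linarith) (add_le_add_right e2 (cumWeight sb st 0 : ℝ))
    have := R.a_ge
    nlinarith
  have : (HybridNode.append st (n + 1)).trimPt = st.trimPt := rfl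
  rw [this]
  push_cast
  linarith

theorem node_spec (R : Regime p ε r) (H : Typical sb p.k p.a p.δ ε r) (n : ℕ) :
    Core sb p ε n (node sb p n) ∧ ShortRanges p (node sb p n) ∧
      ∃ τ, Reach sb p n (n % p.Q) (node sb p n) τ := by
  have hc3 := R.c_gt
  have hQ0 : (0 : ℝ) ≤ p.Q := by positivity
  induction n with
  | zero =>
    have C : Core sb p ε 0 (node sb p 0) :=
      { le_last := by simp [node]
        one_le := by simp [node]
        trimPt_le := by simp [node]
        Ll_zero := by simp [node]
        link := by simp [node]
        Ll_anti := by simp [node]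
        above := by simp [node]
        complete := fun ν b _ h _ => by
          have : b = 0 := by omega
          subst this
          simp [node]
        window := fun ν => ⟨0, fun b _ h _ => by
          have : b = 0 := by omega
          subst this
          simp [node], Or.inl rfl⟩
        top_le := by simp [node] }
    have htp : (node sb p 0).trimPt = 1 := by simp [node]
    have hs1 := R.one_le_scale 1
    have hat : 100 ≤ afterBound p := by unfold afterBound; linarith
    refine ⟨C, fun ν => ?_, 1, by rw [htp], by simp, fun m _ _ => ?_, ?_⟩
    · have h1 : ((node sb p 0).levelRange ν).card ≤ 1 := by
        refine (Finset.card_le_card (t := {0}) fun b hb => ?_).trans (by simp)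
        have := C.le_last b (mem_seg.1 hb).1
        rw [Finset.mem_singleton]
        omega
      have h2 : (((node sb p 0).levelRange ν).card : ℝ) ≤ 1 := by exact_mod_cast h1
      have h3 : 1 ≤ rangeBound p := by
        unfold rangeBound atBound loopBound
        linarith
      rw [htp]
      nlinarith [one_le_pow₀ hs1 (n := 2)]
    · have h1 : (cnt sb m ((node sb p 0).Lf (m - 1)) 1 : ℝ) ≤ 1 := by
        exact_mod_cast (cnt_le sb m _ 1).trans (Nat.sub_le _ _)
      rw [htp]
      nlinarith
    · have := C.tailLen_nonneg R H.genesis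
      rw [htp]
      simp only [Nat.cast_zero, Nat.cast_one, Nat.zero_mod]
      linarith
  | succ n ih =>
    obtain ⟨C, hshort, τ, hτ⟩ := ih
    have C1 := C.append
    have h1 : ShortRanges p (append (node sb p n) (n + 1)) := fun ν => by
      rw [C.append_levelRange]
      exact hshort ν
    have h2 := C.reach_append R H hτ
    have hnode : node sb p (n + 1) = if p.Q ∣ n + 1 then
        attempt sb p (append (node sb p n) (n + 1)) else append (node sb p n) (n + 1) := rfl
    rw [hnode]
    have hlt := Nat.mod_lt n R.Q_pos
    split_ifs with hdvd
    · have h3 : Reach sb p (n + 1) p.Q (append (node sb p n) (n + 1)) τ := by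
        obtain ⟨i1, i2, i3, i4⟩ := h2
        refine ⟨i1, i2, i3, i4.trans ?_⟩
        have : ((n % p.Q + 1 : ℕ) : ℝ) ≤ p.Q := by exact_mod_cast hlt
        linarith
      rw [Nat.mod_eq_zero_of_dvd hdvd]
      exact attempt_spec C1 R H h1 h3
    · refine ⟨C1, h1, τ, ?_⟩
      have : (n + 1) % p.Q = n % p.Q + 1 := by
        have h5 : (n + 1) % p.Q ≠ 0 := fun h => hdvd (Nat.dvd_of_mod_eq_zero h)
        rw [Nat.add_mod] at h5 ⊢
        rcases Nat.lt_or_ge 1 p.Q with h6 | h6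
        · rw [Nat.mod_eq_of_lt h6] at h5 ⊢
          rcases Nat.lt_or_ge (n % p.Q + 1) p.Q with h7 | h7
          · rw [Nat.mod_eq_of_lt h7]
          · have : n % p.Q + 1 = p.Q := by omega
            rw [this, Nat.mod_self] at h5
            exact absurd rfl h5
        · have : p.Q = 1 := le_antisymm h6 R.Q_pos
          rw [this] at h5
          simp [Nat.mod_one] at h5
      rw [this]
      exact h2

end

/-! ### Cold storage in a typical chain -/

section

variable {sb : ℕ → ℕ → Prop} {p : Params} {ε r : ℝ} {n : ℕ} {st : TrimState}

/-- The lowest level whose range starts no later than `b` works: consecutive ranges share an end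
point, and the top range starts at genesis. -/
theorem Core.mem_tail_or_levelRange (C : Core sb p ε n st) {b : ℕ} (hb : b ∈ st.P) :
    b ∈ st.tail ∨ ∃ ν ∈ Finset.range (st.top + 1), b ∈ st.levelRange ν := by
  classical
  by_cases h : st.trimPt ≤ b
  · exact Or.inl (Finset.mem_filter.2 ⟨hb, h⟩)
  right
  have hex : ∃ ν, st.Lf ν ≤ b := ⟨st.top, by rw [C.Lf_eq_zero le_rfl]; exact Nat.zero_le _⟩
  refine ⟨Nat.find hex, ?_, mem_seg.2 ⟨hb, Nat.find_spec hex, ?_⟩⟩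
  · have : Nat.find hex ≤ st.top := Nat.find_min' hex (by
      rw [C.Lf_eq_zero le_rfl]; exact Nat.zero_le _)
    exact Finset.mem_range.2 (by omega)
  · rcases Nat.eq_zero_or_pos (Nat.find hex) with h0 | h0
    · rw [h0]
      have := C.Ll_zero
      omega
    · have h1 := Nat.find_min hex (Nat.sub_lt h0 one_pos)
      rw [C.link, Nat.sub_add_cancel (show 1 ≤ Nat.find hex from h0)] at h1
      omega

theorem Core.card_P_le (C : Core sb p ε n st) {K : ℝ}
    (hK : ∀ ν, ((st.levelRange ν).card : ℝ) ≤ K) :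
    (st.P.card : ℝ) ≤ st.tail.card + (st.top + 1) * K := by
  classical
  have h1 : st.P ⊆ st.tail ∪ (Finset.range (st.top + 1)).biUnion st.levelRange := by
    intro b hb
    rcases C.mem_tail_or_levelRange hb with h | ⟨ν, h1, h2⟩
    · exact Finset.mem_union_left _ h
    · exact Finset.mem_union_right _ (Finset.mem_biUnion.2 ⟨ν, h1, h2⟩)
  have h2 : st.P.card ≤ st.tail.card + ∑ ν ∈ Finset.range (st.top + 1), (st.levelRange ν).card :=
    (Finset.card_le_card h1).trans ((Finset.card_union_le _ _).trans
      (Nat.add_le_add_left Finset.card_biUnion_le _))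
  have h3 : (∑ ν ∈ Finset.range (st.top + 1), ((st.levelRange ν).card : ℝ)) ≤
      (st.top + 1) * K := by
    refine (Finset.sum_le_sum fun ν _ => hK ν).trans ?_
    simp
  have h4 : (st.P.card : ℝ) ≤
      st.tail.card + ∑ ν ∈ Finset.range (st.top + 1), ((st.levelRange ν).card : ℝ) := by
    exact_mod_cast h2
  linarith

theorem interlinkSize_le {a δ : ℝ} {k : ℕ} (H : Typical sb k a δ ε r) {K : ℝ} {b : ℕ}
    (hK : ∀ j, 1 ≤ j → j < b → 4 * scale k a j ≤ K) (hK0 : 0 ≤ K) :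
    (interlinkSize sb b : ℝ) ≤ K + 2 := by
  have hsub : {μ : ℕ | ∃ j, 0 < j ∧ j < b ∧ sb μ j} ⊆ (Finset.range (⌊K⌋₊ + 1) : Set ℕ) := by
    rintro μ ⟨j, h1, h2, h3⟩
    have h4 := (H.level μ j h1 h3).trans (hK j h1 h2)
    simp only [Finset.coe_range, Set.mem_Iio]
    exact Nat.lt_succ_of_le (Nat.le_floor h4)
  have h1 := Set.ncard_le_ncard hsub (Finset.finite_toSet _)
  rw [Set.ncard_coe_finset, Finset.card_range] at h1
  unfold interlinkSize
  have h2 : ({μ : ℕ | ∃ j, 0 < j ∧ j < b ∧ sb μ j}.ncard : ℝ) ≤ ⌊K⌋₊ + 1 := by exact_mod_cast h1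
  have h3 := Nat.floor_le hK0
  push_cast
  linarith

/-- Bound for the untrimmed tail. -/
noncomputable def tailBound (p : Params) : ℝ :=
  2 + 2 * p.a + (5 / 2 * afterBound p + 23) * p.a + p.Q

/-- Two distances are added: from the trimming point to τ, bounded through the level-1 superblocks
counted in `Reach`, and from τ to the tip, bounded by the required tail plus O(scale) and fewer than
`Q` blocks. -/
theorem card_tail_le (R : Regime p ε r) (H : Typical sb p.k p.a p.δ ε r) (C : Core sb p ε n st)
    {τ : ℕ} (hτ : Reach sb p n (n % p.Q) st τ) :
    (st.tail.card : ℝ) ≤ tailBound p * (p.k + p.k' + Real.log ((n + 1 : ℕ) : ℝ)) := by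
  obtain ⟨L, hL⟩ : ∃ L : ℝ, L = p.k + p.k' + Real.log ((n + 1 : ℕ) : ℝ) := ⟨_, rfl⟩
  rw [← hL]
  obtain ⟨h1, h2, h3, h4⟩ := hτ
  have ha := R.a_ge
  have hk1 : (1 : ℝ) ≤ p.k := by exact_mod_cast R.k_pos
  have hk'0 : (0 : ℝ) ≤ p.k' := by positivity
  have hlog0 := Real.log_natCast_nonneg (n + 1)
  have hL1 : 1 ≤ L := by linarith
  obtain ⟨s, hs⟩ : ∃ s, s = scale p.k p.a (n + 1) := ⟨_, rfl⟩
  have hs1 : 1 ≤ s := hs ▸ R.one_le_scale _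
  have hsL : s ≤ p.a * L := by rw [hs, scale, hL]; nlinarith
  have hT1 := C.one_le
  have hTs : scale p.k p.a st.trimPt ≤ s := hs ▸ R.scale_mono hT1 C.trimPt_le
  have hτs : scale p.k p.a τ ≤ s := hs ▸ R.scale_mono (hT1.trans h1) h2
  have hQ0 : (0 : ℝ) ≤ p.Q := by positivity
  have hc3 := R.c_gt
  have haft : 0 ≤ afterBound p := by unfold afterBound; linarith
  have hLl := C.Ll_zero
  have hLf := C.Lf_le_Ll 0
  have h5 := h3 1 le_rfl (by omega)
  simp only [Nat.sub_self] at h5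
  have h6 := H.lower 1 (st.Lf 0) τ (by omega) (hT1.trans h1)
  have h7 : (st.Lf 0 : ℝ) + 1 ≤ st.trimPt := by exact_mod_cast (by omega : st.Lf 0 + 1 ≤ st.trimPt)
  have h8 : (τ : ℝ) - st.trimPt ≤ (5 / 2 * afterBound p + 20) * s := by
    have : afterBound p * scale p.k p.a st.trimPt ≤ afterBound p * s :=
      mul_le_mul_of_nonneg_left hTs haft
    nlinarith
  have hS := C.cumWeight_le R H (Nat.zero_le _ : 0 ≤ st.top + 1)
  have hS1 := C.one_le_cumWeight H.genesis 0
  have htail := C.card_tail H.zero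
  have hTn : (st.trimPt : ℝ) ≤ (n + 1 : ℕ) := by exact_mod_cast C.trimPt_le
  have htail2 : (st.tail.card : ℝ) = (n + 1 : ℕ) - st.trimPt := by
    rw [htail, Nat.cast_sub C.trimPt_le]
  have h9 : tailLen sb p st ≤ p.k' + ε * s + p.a * Real.log ((n + 1 : ℕ) : ℝ) := by
    unfold tailLen
    have hn1 : (1 : ℝ) ≤ (n + 1 : ℕ) := by exact_mod_cast Nat.succ_le_succ (Nat.zero_le n)
    have e1 : (cumWeight sb st 0 : ℝ) + st.tail.card ≤ (61 * s) * (n + 1 : ℕ) := by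
      have e2 : 60 * scale p.k p.a st.trimPt * st.trimPt ≤ 60 * s * (n + 1 : ℕ) :=
        mul_le_mul (by linarith) hTn (by positivity) (by linarith)
      rw [htail2]
      have : (0 : ℝ) ≤ st.trimPt := by positivity
      nlinarith
    have e3 := Real.log_le_log (by have : (0 : ℝ) ≤ st.tail.card := by positivity
                                   linarith) e1
    rw [Real.log_mul (by positivity) (by positivity)] at e3
    have e4 := R.log_scale_le (K := 61) (by norm_num) (by linarith) (n + 1)
    rw [← hs] at e4
    nlinarith
  have h10 : ((n % p.Q : ℕ) : ℝ) ≤ p.Q := by exact_mod_cast (Nat.mod_lt n R.Q_pos).le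
  have h11 : ε * s ≤ s := by have := R.ε_le; nlinarith
  have h12 : p.a * Real.log ((n + 1 : ℕ) : ℝ) ≤ p.a * L :=
    mul_le_mul_of_nonneg_left (by linarith) (by linarith)
  have h13 : (5 / 2 * afterBound p + 23) * s ≤ (5 / 2 * afterBound p + 23) * (p.a * L) :=
    mul_le_mul_of_nonneg_left hsL (by linarith)
  have h14 : (p.Q : ℝ) ≤ p.Q * L := le_mul_of_one_le_right hQ0 hL1
  have h15 : (p.k' : ℝ) ≤ L := by linarith
  have h16 : tailBound p * L = 2 * L + 2 * (p.a * L) + (5 / 2 * afterBound p + 23) * (p.a * L) +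
      p.Q * L := by unfold tailBound; ring
  have h17 : ((n + 1 : ℕ) : ℝ) = n + 1 := by push_cast; ring
  rw [htail2, h16]
  linarith

/-- The bounds on cold storage, with a constant that only depends on the fixed parameters. -/
theorem exists_storage_bound (a c : ℝ) (Q hdr link txMax : ℕ) :
    ∃ K : ℝ, ∀ (p : Params) (ε r : ℝ) (sb : ℕ → ℕ → Prop) (tx : ℕ → ℕ) (n : ℕ),
      p.a = a → p.c = c → p.Q = Q → Regime p ε r → Typical sb p.k p.a p.δ ε r →
      (∀ b, tx b ≤ txMax) →
      (storage sb hdr link tx (node sb p n) : ℝ) ≤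
        K * (p.k + p.k' + Real.log ((n + 1 : ℕ) : ℝ)) ^ 4 ∧
      ((node sb p n).top : ℝ) ≤ K * (p.k + p.k' + Real.log ((n + 1 : ℕ) : ℝ)) ∧
      (∀ μ, (((node sb p n).levelRange μ).card : ℝ) ≤
        K * (p.k + p.k' + Real.log ((n + 1 : ℕ) : ℝ)) ^ 2) ∧
      ((node sb p n).tail.card : ℝ) ≤ K * (p.k + p.k' + Real.log ((n + 1 : ℕ) : ℝ)) ∧
      (∀ b < n + 1, (interlinkSize sb b : ℝ) ≤
        K * (p.k + p.k' + Real.log ((n + 1 : ℕ) : ℝ))) := by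
  -- The security parameters and δ are set to 0 because the constants do not involve them; this
  -- makes `K` uniform.
  set p₀ : Params := ⟨0, 0, a, c, 0, Q⟩ with hp₀
  obtain ⟨KT, hKT⟩ : ∃ x : ℝ, x = tailBound p₀ := ⟨_, rfl⟩
  obtain ⟨KR, hKR⟩ : ∃ x : ℝ, x = rangeBound p₀ * a ^ 2 := ⟨_, rfl⟩
  obtain ⟨KI, hKI⟩ : ∃ x : ℝ, x = 4 * a + 2 := ⟨_, rfl⟩
  obtain ⟨KP, hKP⟩ : ∃ x : ℝ, x = KT + (a + 1) * KR := ⟨_, rfl⟩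
  obtain ⟨KS, hKS⟩ : ∃ x : ℝ, x = KP * (hdr + link * KI) + KT * txMax := ⟨_, rfl⟩
  refine ⟨KS + KR + KT + KI, fun p ε r sb tx n hpa hpc hpQ R H htx => ?_⟩
  have hKTp : tailBound p = KT := by
    rw [hKT, tailBound, tailBound, afterBound, afterBound, hpa, hpc, hpQ]
  have hKRp : rangeBound p = rangeBound p₀ := by
    simp only [rangeBound, atBound, afterBound, loopBound, hpc, hpQ, hp₀]
  obtain ⟨C, hshort, τ, hτ⟩ := node_spec R H n
  obtain ⟨st, hst⟩ : ∃ st, st = node sb p n := ⟨_, rfl⟩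
  rw [← hst] at C hshort hτ ⊢
  have htail := card_tail_le R H C hτ
  obtain ⟨L, hL⟩ : ∃ L : ℝ, L = p.k + p.k' + Real.log ((n + 1 : ℕ) : ℝ) := ⟨_, rfl⟩
  rw [← hL] at htail ⊢
  rw [hKTp] at htail
  have ha := R.a_ge
  rw [hpa] at ha
  have hc3 := R.c_gt
  have hQ0 : (0 : ℝ) ≤ p.Q := by positivity
  have hk1 : (1 : ℝ) ≤ p.k := by exact_mod_cast R.k_pos
  have hk'0 : (0 : ℝ) ≤ p.k' := by positivity
  have hlog0 := Real.log_natCast_nonneg (n + 1)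
  have hL1 : 1 ≤ L := by linarith
  have hscale : ∀ y, 1 ≤ y → y ≤ n + 1 → scale p.k p.a y ≤ a * L := by
    intro y h1 h2
    refine (R.scale_mono h1 h2).trans ?_
    rw [scale, hL, hpa]
    nlinarith
  have hKR0 : 0 ≤ KR := by
    have : 0 ≤ rangeBound p := by unfold rangeBound atBound afterBound loopBound; linarith
    rw [hKR, ← hKRp]
    positivity
  have hKT0 : 0 ≤ KT := by
    rw [← hKTp]
    unfold tailBound afterBound
    rw [hpa]
    have : 0 ≤ (5 / 2 * (101 + 4 * (p.Q : ℝ) + 2 * p.c) + 23) * a := by positivity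
    linarith
  have hKI0 : 0 ≤ KI := by linarith
  have hKP0 : 0 ≤ KP := by rw [hKP]; positivity
  have hKS0 : 0 ≤ KS := by rw [hKS]; positivity
  have htop : (st.top : ℝ) ≤ a * L :=
    (R.level_le_scale C.top_le).trans (hscale _ C.one_le C.trimPt_le)
  have hrange : ∀ μ, ((st.levelRange μ).card : ℝ) ≤ KR * L ^ 2 := by
    intro μ
    refine (hshort μ).trans ?_
    rw [hKRp, hKR, mul_assoc, ← mul_pow]
    have h0 := R.one_le_scale st.trimPt
    refine mul_le_mul_of_nonneg_left
      (pow_le_pow_left₀ (by linarith) (hscale _ C.one_le C.trimPt_le) 2) ?_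
    rw [← hKRp]
    unfold rangeBound atBound afterBound loopBound
    linarith
  have hlink : ∀ b < n + 1, (interlinkSize sb b : ℝ) ≤ KI * L := by
    intro b hb
    have h1 := interlinkSize_le H (K := 4 * (a * L)) (b := b)
      (fun j h1 h2 => by have := hscale j h1 (by omega); linarith) (by positivity)
    rw [hKI]
    nlinarith
  -- O(L) ranges of O(L^2) blocks each; the tail is of lower order.
  have hP : (st.P.card : ℝ) ≤ KP * L ^ 3 := by
    have h1 := C.card_P_le hrange
    have h2 : L ≤ L ^ 3 := le_self_pow₀ hL1 (by norm_num)
    have h3 : ((st.top : ℝ) + 1) * (KR * L ^ 2) ≤ ((a + 1) * L) * (KR * L ^ 2) :=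
      mul_le_mul_of_nonneg_right (by linarith) (by positivity)
    have h4 : KT * L ≤ KT * L ^ 3 := mul_le_mul_of_nonneg_left h2 hKT0
    have h5 : KP * L ^ 3 = KT * L ^ 3 + (a + 1) * L * (KR * L ^ 2) := by rw [hKP]; ring
    linarith
  have hstore : (storage sb hdr link tx st : ℝ) ≤ KS * L ^ 4 := by
    have h1 : (storage sb hdr link tx st : ℝ) ≤
        st.P.card * ((hdr + link * KI) * L) + st.tail.card * txMax := by
      unfold storage
      push_cast
      refine add_le_add ?_ ?_
      · refine (Finset.sum_le_card_nsmul _ _ ((hdr + link * KI) * L) fun b hb => ?_).trans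
          (by rw [nsmul_eq_mul])
        have h2 := hlink b (Nat.lt_succ_of_le (C.le_last b hb))
        have h3 : (hdr : ℝ) ≤ hdr * L := le_mul_of_one_le_right (by positivity) hL1
        have h4 : (link : ℝ) * interlinkSize sb b ≤ link * (KI * L) :=
          mul_le_mul_of_nonneg_left h2 (by positivity)
        linarith
      · refine (Finset.sum_le_card_nsmul _ _ (txMax : ℝ) fun b _ => ?_).trans
          (by rw [nsmul_eq_mul])
        exact_mod_cast htx b
    have h5 : (st.P.card : ℝ) * ((hdr + link * KI) * L) ≤
        (KP * L ^ 3) * ((hdr + link * KI) * L) := mul_le_mul_of_nonneg_right hP (by positivity)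
    have h6 : (st.tail.card : ℝ) * txMax ≤ (KT * L) * txMax :=
      mul_le_mul_of_nonneg_right htail (by positivity)
    have h7 : L ≤ L ^ 4 := le_self_pow₀ hL1 (by norm_num)
    have h8 : KT * txMax * L ≤ KT * txMax * L ^ 4 := mul_le_mul_of_nonneg_left h7 (by positivity)
    have h9 : KS * L ^ 4 = KP * L ^ 3 * ((hdr + link * KI) * L) + KT * txMax * L ^ 4 := by
      rw [hKS]; ring
    have h10 : KT * L * txMax = KT * txMax * L := by ring
    linarith
  have hmono : ∀ {x y z : ℝ}, 0 ≤ z → x ≤ y → x * z ≤ y * z := fun hz hxy =>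
    mul_le_mul_of_nonneg_right hxy hz
  refine ⟨hstore.trans (hmono (by positivity) (by linarith)),
    htop.trans (hmono (by linarith) (by linarith)),
    fun μ => (hrange μ).trans (hmono (by positivity) (by linarith)),
    htail.trans (hmono (by linarith) (by linarith)),
    fun b hb => (hlink b hb).trans (hmono (by linarith) (by linarith))⟩

end

/-! ### Dominance and surviving words -/

/-- Reading the chain from block `x` on, one finds superblocks of the levels listed in the word, in
this order, within the given number of blocks and before the first level-`μ` superblock. -/
def Survives (sb : ℕ → ℕ → Prop) (μ : ℕ) : ℕ → List ℕ → ℕ → Prop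
  | _, [], _ => True
  | 0, _ :: _, _ => False
  | h + 1, v :: w, x => ¬ sb μ x ∧
      ((sb v x ∧ Survives sb μ h w (x + 1)) ∨ (¬ sb v x ∧ Survives sb μ h (v :: w) (x + 1)))

section

variable {sb : ℕ → ℕ → Prop} {μ : ℕ}

theorem survives_nil (h x : ℕ) : Survives sb μ h [] x := by
  cases h <;> trivial

/-- Starting earlier and dropping a letter are proved by a joint induction on the horizon: if the
new block matches the first letter, the greedy reading consumes it and only the rest of the word is
still required. -/
theorem Survives.extend_of {h x : ℕ} (htail : ∀ v w, Survives sb μ h (v :: w) (x + 1) →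
    Survives sb μ h w (x + 1)) {w : List ℕ} (hw : Survives sb μ h w (x + 1)) (hx : ¬ sb μ x) :
    Survives sb μ (h + 1) w x := by
  cases w with
  | nil => trivial
  | cons v w =>
    by_cases hv : sb v x
    · exact ⟨hx, Or.inl ⟨hv, htail v w hw⟩⟩
    · exact ⟨hx, Or.inr ⟨hv, hw⟩⟩

theorem Survives.tail {h : ℕ} : ∀ {x v : ℕ} {w : List ℕ}, Survives sb μ h (v :: w) x →
    Survives sb μ h w x := by
  induction h with
  | zero => intro x v w hw; exact hw.elim
  | succ h ih =>
    rintro x v w ⟨hx, ⟨-, hw⟩ | ⟨-, hw⟩⟩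
    · exact Survives.extend_of (fun _ _ => ih) hw hx
    · exact Survives.extend_of (fun _ _ => ih) (ih hw) hx

theorem Survives.extend {h x : ℕ} {w : List ℕ} (hw : Survives sb μ h w (x + 1)) (hx : ¬ sb μ x) :
    Survives sb μ (h + 1) w x := Survives.extend_of (fun _ _ => Survives.tail) hw hx

theorem cnt_succ_left (sb : ℕ → ℕ → Prop) (v x d : ℕ) :
    (sb v x → cnt sb v x (x + (d + 1)) = cnt sb v (x + 1) (x + 1 + d) + 1) ∧
    (¬ sb v x → cnt sb v x (x + (d + 1)) = cnt sb v (x + 1) (x + 1 + d)) := by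
  classical
  have h1 := cnt_add sb v (show x ≤ x + 1 by omega) (show x + 1 ≤ x + (d + 1) by omega)
  have h2 : x + (d + 1) = x + 1 + d := by omega
  rw [h2] at h1 ⊢
  have h3 : cnt sb v x (x + 1) = (up sb v {x}).card := by
    unfold cnt; congr 2; ext; simp
  constructor
  · intro hv
    have : up sb v {x} = {x} := by
      ext b; rw [mem_up, Finset.mem_singleton]
      exact ⟨fun h => h.1, fun h => ⟨h, h ▸ hv⟩⟩
    rw [this, Finset.card_singleton] at h3
    omega
  · intro hv
    have : up sb v {x} = ∅ := by
      ext b; rw [mem_up, Finset.mem_singleton]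
      simp only [Finset.notMem_empty, iff_false]
      rintro ⟨rfl, h⟩; exact hv h
    rw [this, Finset.card_empty] at h3
    omega

/-- Greedy reading is at least as fast as any other: once enough level-`v` superblocks occur before
x + d, the reader finishes that run by then, and `extend` lets it go on early. -/
theorem Survives.replicate_add {h v : ℕ} {w : List ℕ} (d : ℕ) : ∀ {x m : ℕ},
    Survives sb μ h w (x + d) → (∀ b, x ≤ b → b < x + d → ¬ sb μ b) → m ≤ cnt sb v x (x + d) →
    Survives sb μ (h + d) (List.replicate m v ++ w) x := by
  induction d with
  | zero =>
    intro x m hw _ hm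
    rw [cnt_eq_zero _ _ (by omega)] at hm
    have : m = 0 := by omega
    subst this
    simpa using hw
  | succ d ih =>
    intro x m hw hμ hm
    have hx : ¬ sb μ x := hμ x le_rfl (by omega)
    obtain ⟨c1, c2⟩ := cnt_succ_left sb v x d
    have ih' : ∀ m', m' ≤ cnt sb v (x + 1) (x + 1 + d) →
        Survives sb μ (h + d) (List.replicate m' v ++ w) (x + 1) := fun m' hm' =>
      ih (by rwa [show x + 1 + d = x + (d + 1) by omega])
        (fun b h1 h2 => hμ b (by omega) (by omega)) hm'
    cases m with
    | zero => exact (ih' 0 (Nat.zero_le _)).extend hx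
    | succ m =>
      rw [List.replicate_succ, List.cons_append]
      by_cases hv : sb v x
      · rw [c1 hv] at hm
        exact ⟨hx, Or.inl ⟨hv, ih' m (by omega)⟩⟩
      · rw [c2 hv] at hm
        exact ⟨hx, Or.inr ⟨hv, ih' (m + 1) hm⟩⟩

theorem Survives.replicate {h v x z m : ℕ} {w : List ℕ} (hxz : x ≤ z) (hw : Survives sb μ h w z)
    (hμ : ∀ b, x ≤ b → b < z → ¬ sb μ b) (hm : m ≤ cnt sb v x z) :
    Survives sb μ (h + (z - x)) (List.replicate m v ++ w) x := by
  obtain ⟨d, rfl⟩ := Nat.exists_eq_add_of_le hxz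
  rw [Nat.add_sub_cancel_left]
  exact Survives.replicate_add d hw hμ hm

/-- The word that consists, for the levels `ν - 1, …, 0`, of `n i` chunks of level `i`, each of
`2 ^ (μ - i)` superblocks. -/
def chunkWord (μ : ℕ) (n : ℕ → ℕ) : ℕ → List ℕ
  | 0 => []
  | ν + 1 => List.replicate (n ν * 2 ^ (μ - ν)) ν ++ chunkWord μ n ν

theorem chunkWord_eq {n : ℕ → ℕ} {ν' ν : ℕ} (h : ν' ≤ ν) (hn : ∀ i, ν' ≤ i → i < ν → n i = 0) :
    chunkWord μ n ν = chunkWord μ n ν' := by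
  induction ν, h using Nat.le_induction with
  | base => rfl
  | succ ν hν ih =>
    rw [chunkWord, hn ν hν (Nat.lt_succ_self ν)]
    simpa using ih fun i h1 h2 => hn i h1 (by omega)

/-- A word of `n μ` chunks of an arbitrary level `μ₁`, followed by `n i` chunks of the levels
`i = μ - 1, …, 0`. -/
def fullWord (μ μ₁ : ℕ) (n : ℕ → ℕ) : List ℕ :=
  List.replicate (n μ * 2 ^ (μ - μ₁)) μ₁ ++ chunkWord μ n μ

/-- Rounding to chunks of weight 2^μ loses less than one chunk per level; the extra superblock on
the left is the one shared by neighbouring level ranges. -/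
theorem two_pow_mul_le {μ ν : ℕ} (h : ν ≤ μ) (m : ℕ) :
    2 ^ ν * (m + 1) ≤ 2 ^ μ * (m / 2 ^ (μ - ν) + 1) := by
  have h1 : m < 2 ^ (μ - ν) * (m / 2 ^ (μ - ν) + 1) :=
    Nat.lt_mul_div_succ m (by positivity)
  have h2 : 2 ^ μ = 2 ^ ν * 2 ^ (μ - ν) := by rw [← pow_add]; congr 1; omega
  rw [h2, mul_assoc]
  exact Nat.mul_le_mul_left _ h1

/-- A trimmed chain retains level-μ superblocks in all ranges ν ≤ μ, so without one in it the
complete chain has none from `l` to the end of range 0. Its superblocks then spell a surviving word,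
with one chunk at most lost at each of the levels: hence g - μ - 1. -/
theorem dominant_of_not_survives (hanti : ∀ μ ν b, μ ≤ ν → sb ν b → sb μ b) {i j y : ℕ} {g : ℝ}
    (hjy : j ≤ y) (hg : 0 < g)
    (hword : ∀ x ≤ y, ∀ h (n : ℕ → ℕ), ∀ μ₁ < μ,
      g - μ - 1 ≤ ((∑ ν ∈ Finset.range (μ + 1), n ν : ℕ) : ℝ) →
      ¬ Survives sb μ h (fullWord μ μ₁ n) x) :
    Dominant sb (Finset.Ico i j) μ g := by
  classical
  intro P' Lf Ll hT μ₁ μ' l hμ₁ hμ' hl1 hl2 hw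
  by_contra hcon
  have hempty : up sb μ P' = ∅ := Finset.card_eq_zero.1 (by omega)
  have hno : ∀ b ∈ P', ¬ sb μ b := fun b hb hs => by
    have : b ∈ up sb μ P' := mem_up.2 ⟨hb, hs⟩
    rw [hempty] at this
    simp at this
  have hLl : Antitone Ll := antitone_nat_of_succ_le fun ν => (hT.begin_ge ν).trans (hT.le ν)
  have hij : i < j := by
    by_contra hji
    have hP' : P' = ∅ := by
      have h1 := hT.subset
      rw [Finset.Ico_eq_empty (by omega)] at h1
      exact Finset.subset_empty.1 h1
    have hzero : ∀ ν u v, (up sb ν (seg P' u v)).card = 0 := by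
      intro ν u v
      rw [Finset.card_eq_zero, hP']
      ext b
      simp [mem_up, mem_seg]
    simp only [hzero, Nat.cast_zero, mul_zero, Finset.sum_const_zero, add_zero] at hw
    have : (0 : ℝ) < 2 ^ μ * g := by positivity
    linarith
  have hcover : ∀ ν b, Lf ν ≤ b → b ≤ Ll 0 → ∃ ν' ≤ ν, Lf ν' ≤ b ∧ b ≤ Ll ν' := by
    intro ν b
    induction ν with
    | zero => exact fun h1 h2 => ⟨0, le_rfl, h1, h2⟩
    | succ ν ih =>
      intro h1 h2
      by_cases h3 : b ≤ Ll (ν + 1)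
      · exact ⟨ν + 1, le_rfl, h1, h3⟩
      · have := hT.begin_le ν
        obtain ⟨ν', h4, h5⟩ := ih (by omega) h2
        exact ⟨ν', by omega, h5⟩
  have hfree : ∀ b, i ≤ b → b < j → l ≤ b → b ≤ Ll 0 → ¬ sb μ b := by
    intro b h1 h2 h3 h4 hs
    obtain ⟨ν, h5, h6, h7⟩ := hcover μ' b (hl1.trans h3) h4
    exact hno b (hT.retains ν b (Finset.mem_Ico.2 ⟨h1, h2⟩) h6 h7 (hanti ν μ b (by omega) hs)) hs
  -- The right ends of the level ranges, clipped to the segment [i, j).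
  set z : ℕ → ℕ := fun ν => max i (min (Ll ν + 1) j) with hz
  have hzanti : Antitone z := fun ν ν' h => by
    have := hLl h
    simp only [hz]
    omega
  have hP'X : ∀ b ∈ P', i ≤ b ∧ b < j := fun b hb => Finset.mem_Ico.1 (hT.subset hb)
  set x₀ := min (max l i) (z μ') with hx₀
  set c₀ := cnt sb μ₁ x₀ (z μ') with hc₀
  set c : ℕ → ℕ := fun ν => cnt sb ν (z (ν + 1)) (z ν) with hc
  -- Slot μ holds the chunks of the first range, weighed at level `μ₁`. It is otherwise free, as the
  -- lower ranges have level below μ' ≤ μ.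
  set n : ℕ → ℕ := fun ν => if ν < μ' then c ν / 2 ^ (μ - ν) else
    if ν = μ ∧ μ₁ < μ then c₀ / 2 ^ (μ - μ₁) else 0 with hn
  have hpiece : ∀ ν, (up sb ν (seg P' (Lf ν) (Ll ν + 1))).card ≤ c ν + 1 := by
    intro ν
    have hsub : up sb ν (seg P' (Lf ν) (Ll ν + 1)) ⊆
        insert (Ll (ν + 1)) (up sb ν (Finset.Ico (z (ν + 1)) (z ν))) := by
      intro b hb
      obtain ⟨h1, h2⟩ := mem_up.1 hb
      obtain ⟨h3, h4, h5⟩ := mem_seg.1 h1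
      obtain ⟨h6, h7⟩ := hP'X b h3
      have h8 := hT.begin_ge ν
      rw [Finset.mem_insert]
      by_cases h9 : b = Ll (ν + 1)
      · exact Or.inl h9
      · right
        refine mem_up.2 ⟨Finset.mem_Ico.2 ?_, h2⟩
        simp only [hz]
        omega
    exact (Finset.card_le_card hsub).trans (Finset.card_insert_le _ _)
  have hfirst : (up sb μ₁ (seg P' l (Ll μ' + 1))).card ≤ c₀ := by
    refine card_le_cnt fun b hb => ?_
    obtain ⟨h1, h2⟩ := mem_up.1 hb
    obtain ⟨h3, h4, h5⟩ := mem_seg.1 h1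
    obtain ⟨h6, h7⟩ := hP'X b h3
    refine ⟨?_, ?_, h2⟩
    · simp only [hx₀]; omega
    · simp only [hz]; omega
  have hweight1 : 2 ^ μ₁ * (up sb μ₁ (seg P' l (Ll μ' + 1))).card ≤ 2 ^ μ * (n μ + 1) := by
    by_cases h : μ₁ < μ
    · have hnμ : n μ = c₀ / 2 ^ (μ - μ₁) := by
        simp only [hn]
        rw [if_neg (by omega), if_pos ⟨trivial, h⟩]
      rw [hnμ]
      refine le_trans ?_ (two_pow_mul_le h.le c₀)
      exact Nat.mul_le_mul_left _ (hfirst.trans (Nat.le_succ _))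
    -- Weighed at level μ itself, the first range contributes nothing.
    · have h1 : μ₁ = μ := by omega
      have h2 : (up sb μ₁ (seg P' l (Ll μ' + 1))).card = 0 := by
        rw [Finset.card_eq_zero]
        ext b
        simp only [mem_up, mem_seg, Finset.notMem_empty, iff_false]
        rintro ⟨⟨h3, -⟩, h4⟩
        exact hno b h3 (h1 ▸ h4)
      rw [h2, mul_zero]
      exact Nat.zero_le _
  have hweight2 : ∀ ν ∈ Finset.range μ',
      2 ^ ν * (up sb ν (seg P' (Lf ν) (Ll ν + 1))).card ≤ 2 ^ μ * (n ν + 1) := by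
    intro ν hν
    have hν' := Finset.mem_range.1 hν
    have hnν : n ν = c ν / 2 ^ (μ - ν) := by
      simp only [hn]
      rw [if_pos hν']
    rw [hnν]
    exact (Nat.mul_le_mul_left _ (hpiece ν)).trans (two_pow_mul_le (by omega) (c ν))
  have hsum : g - μ - 1 ≤ ((∑ ν ∈ Finset.range (μ + 1), n ν : ℕ) : ℝ) := by
    have h1 : 2 ^ μ₁ * (up sb μ₁ (seg P' l (Ll μ' + 1))).card +
        ∑ ν ∈ Finset.range μ', 2 ^ ν * (up sb ν (seg P' (Lf ν) (Ll ν + 1))).card ≤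
        2 ^ μ * ((∑ ν ∈ Finset.range (μ + 1), n ν) + μ + 1) := by
      have h2 := Finset.sum_le_sum hweight2
      rw [← Finset.mul_sum, Finset.sum_add_distrib] at h2
      simp only [Finset.sum_const, Finset.card_range, smul_eq_mul, mul_one] at h2
      have h3 : ∑ ν ∈ Finset.range μ', n ν ≤ ∑ ν ∈ Finset.range μ, n ν :=
        Finset.sum_le_sum_of_subset (Finset.range_mono hμ')
      rw [Finset.sum_range_succ]
      calc _ ≤ 2 ^ μ * (n μ + 1) + 2 ^ μ * (∑ ν ∈ Finset.range μ', n ν + μ') :=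
            Nat.add_le_add hweight1 h2
        _ = 2 ^ μ * (n μ + 1 + (∑ ν ∈ Finset.range μ', n ν + μ')) := by ring
        _ ≤ _ := Nat.mul_le_mul_left _ (by omega)
    have h2 : (2 : ℝ) ^ μ * g ≤ 2 ^ μ * (((∑ ν ∈ Finset.range (μ + 1), n ν : ℕ) : ℝ) + μ + 1) := by
      refine hw.trans ?_
      exact_mod_cast h1
    have h3 := le_of_mul_le_mul_left h2 (by positivity)
    linarith
  have hsurv : ∀ ν ≤ μ', Survives sb μ (z 0 - z ν) (chunkWord μ n ν) (z ν) := by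
    intro ν
    induction ν with
    | zero => exact fun _ => survives_nil _ _
    | succ ν ih =>
      intro hν
      have h1 := hzanti (show ν ≤ ν + 1 by omega)
      have h2 := hzanti (Nat.zero_le ν)
      have h3 := ih (by omega)
      have h4 : z 0 - z (ν + 1) = z 0 - z ν + (z ν - z (ν + 1)) := by omega
      rw [h4, chunkWord]
      refine Survives.replicate h1 h3 (fun b h5 h6 => ?_) ?_
      · have h7 : Ll μ' ≤ Ll (ν + 1) := hLl hν
        have h8 : Ll ν ≤ Ll 0 := hLl (Nat.zero_le ν)
        simp only [hz] at h5 h6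
        exact hfree b (by omega) (by omega) (by omega) (by omega)
      · have hnν : n ν = c ν / 2 ^ (μ - ν) := by
          simp only [hn]
          rw [if_pos (by omega)]
        rw [hnν]
        exact Nat.div_mul_le_self _ _
  have hchunk : chunkWord μ n μ = chunkWord μ n μ' :=
    chunkWord_eq hμ' fun ν h1 h2 => by
      simp only [hn]
      rw [if_neg (by omega), if_neg (by omega)]
  have hxz : x₀ ≤ z μ' := min_le_right _ _
  have hfree₀ : ∀ b, x₀ ≤ b → b < z μ' → ¬ sb μ b := by
    intro b h1 h2
    have h3 : Ll μ' ≤ Ll 0 := hLl (Nat.zero_le μ')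
    simp only [hx₀, hz] at h1 h2
    exact hfree b (by omega) (by omega) (by omega) (by omega)
  have hμ0 : 0 < μ ∨ μ = 0 := Nat.eq_zero_or_pos μ |>.symm
  have hx₀y : x₀ ≤ y := by
    simp only [hx₀, hz]
    omega
  by_cases h : μ₁ < μ
  · refine hword x₀ hx₀y (z 0 - z μ' + (z μ' - x₀)) n μ₁ h hsum ?_
    rw [fullWord, hchunk]
    refine Survives.replicate hxz (hsurv μ' le_rfl) hfree₀ ?_
    have hnμ : n μ = c₀ / 2 ^ (μ - μ₁) := by
      simp only [hn]
      rw [if_neg (by omega), if_pos ⟨trivial, h⟩]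
    rw [hnμ]
    exact Nat.div_mul_le_self _ _
  · have hnμ : n μ = 0 := by
      simp only [hn]
      rw [if_neg (by omega), if_neg (by omega)]
    rcases hμ0 with hμ0 | hμ0
    -- With slot μ empty, any level below μ may serve as the level of the first run; 0 is taken.
    · refine hword x₀ hx₀y (z 0 - z μ' + (z μ' - x₀)) n 0 hμ0 hsum ?_
      rw [fullWord, hchunk]
      refine Survives.replicate hxz (hsurv μ' le_rfl) hfree₀ ?_
      rw [hnμ]
      simp
    · subst hμ0
      have h1 : μ' = 0 := by omega
      have h2 : μ₁ = 0 := by omega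
      have h3 : (up sb μ₁ (seg P' l (Ll μ' + 1))).card = 0 := by
        rw [Finset.card_eq_zero]
        ext b
        simp only [mem_up, mem_seg, Finset.notMem_empty, iff_false]
        rintro ⟨⟨h3, -⟩, h4⟩
        exact hno b h3 (h2 ▸ h4)
      rw [h3, h1] at hw
      simp only [Nat.cast_zero, mul_zero, Finset.range_zero, Finset.sum_empty, add_zero, pow_zero,
        one_mul] at hw
      linarith

end

/-! ### Chernoff bounds for numbers of superblocks -/

/-- Measurable independent hashes, with the probabilities that uniformity on `[0, 2 ^ (-T)]` gives
to the superblock levels. -/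
structure UniformHashes {Ω : Type*} [MeasurableSpace Ω] (Pr : Measure Ω) (T : ℕ)
    (hash : ℕ → Ω → ℝ) : Prop where
  measurable : ∀ b, Measurable (hash b)
  indep : iIndepFun hash Pr
  prob : ∀ b ν, Pr {ω | hash b ω ≤ ((2 : ℝ) ^ (T + ν))⁻¹} = ENNReal.ofReal ((2 ^ ν)⁻¹)

/-- The log-weight of a block: `s` for level `n + 1`, `t` for exact level `n`, and `0` otherwise. -/
noncomputable def logWeight (sb : ℕ → ℕ → Prop) (n : ℕ) (s t : ℝ) (b : ℕ) : ℝ :=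
  open Classical in if sb (n + 1) b then s else if sb n b then t else 0

theorem sum_logWeight {sb : ℕ → ℕ → Prop} (hanti : ∀ μ ν b, μ ≤ ν → sb ν b → sb μ b)
    (n : ℕ) (s t : ℝ) (i j : ℕ) :
    ∑ b ∈ Finset.Ico i j, logWeight sb n s t b =
      t * ((cnt sb n i j : ℝ) - cnt sb (n + 1) i j) + s * cnt sb (n + 1) i j := by
  classical
  have h : ∀ b, logWeight sb n s t b =
      (s - t) * (if sb (n + 1) b then 1 else 0) + t * (if sb n b then 1 else 0) := by
    intro b
    unfold logWeight
    by_cases h1 : sb (n + 1) b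
    · simp [h1, hanti n (n + 1) b (by omega) h1]
    · by_cases h2 : sb n b <;> simp [h1, h2]
  simp only [h, Finset.sum_add_distrib, ← Finset.mul_sum, Finset.sum_boole]
  have h3 : ∀ ν, (Finset.filter (fun b => sb ν b) (Finset.Ico i j)).card = cnt sb ν i j := by
    intro ν
    unfold cnt up
    congr!
  rw [h3, h3]
  ring

theorem isSuper_anti (T : ℕ) (hash : ℕ → ℝ) (μ ν b : ℕ) (h : μ ≤ ν) (hb : IsSuper T hash ν b) :
    IsSuper T hash μ b := by
  refine hb.imp id fun hb => hb.trans ?_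
  gcongr
  norm_num

section

variable {Ω : Type*} [MeasurableSpace Ω] {Pr : Measure Ω} {T : ℕ}
  {hash : ℕ → Ω → ℝ}

theorem measurableSet_isSuper (T ν b : ℕ) :
    MeasurableSet {x : ℝ | IsSuper T (fun _ => x) ν b} := by
  unfold IsSuper
  exact (MeasurableSet.const _).union measurableSet_Iic

theorem UniformHashes.measurableSet_super (H : UniformHashes Pr T hash) (ν b : ℕ) :
    MeasurableSet {ω | IsSuper T (fun b => hash b ω) ν b} :=
  H.measurable b (measurableSet_isSuper T ν b)

theorem UniformHashes.prob_super (H : UniformHashes Pr T hash) (ν : ℕ) {b : ℕ} (hb : 1 ≤ b) :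
    Pr {ω | IsSuper T (fun b => hash b ω) ν b} = ENNReal.ofReal ((2 ^ ν)⁻¹) := by
  rw [← H.prob b ν]
  congr 1
  ext ω
  simp only [IsSuper, Set.mem_ofPred_eq]
  constructor
  · rintro (h | h)
    · omega
    · exact h
  · exact Or.inr

variable [IsProbabilityMeasure Pr]

/-- Half of the level-n superblocks have level n+1, so the exponential moment of a random block is 1
+ 2^(-n) * ((e^t + e^s)/2 - 1). -/
theorem UniformHashes.lintegral_weight_le (H : UniformHashes Pr T hash) (n : ℕ) (s t : ℝ) (b : ℕ)
    (hb : 1 ≤ b ∨ (s ≤ t ∧ t ≤ 0)) :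
    ∫⁻ ω, ENNReal.ofReal (Real.exp (logWeight (IsSuper T fun b => hash b ω) n s t b)) ∂Pr ≤
      ENNReal.ofReal (Real.exp ((2 ^ n)⁻¹ * ((Real.exp t + Real.exp s) / 2 - 1))) := by
  classical
  have hp : (0 : ℝ) < (2 ^ n)⁻¹ := by positivity
  have hp1 : ((2 : ℝ) ^ n)⁻¹ ≤ 1 := inv_le_one_of_one_le₀ (one_le_pow₀ (by norm_num))
  -- Genesis has weight `s` with certainty; the bound still holds when both weights are nonpositive
  -- and `s ≤ t`.
  rcases Nat.eq_zero_or_pos b with rfl | hb1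
  · obtain ⟨hst, ht⟩ : s ≤ t ∧ t ≤ 0 := hb.resolve_left (by omega)
    have : ∀ ω, logWeight (IsSuper T fun b => hash b ω) n s t 0 = s := by
      intro ω
      simp [logWeight, IsSuper]
    simp only [this, lintegral_const, measure_univ, mul_one]
    refine ENNReal.ofReal_le_ofReal (Real.exp_le_exp.2 ?_)
    have h1 := Real.add_one_le_exp s
    have h2 := Real.exp_le_exp.2 hst
    have h3 := Real.exp_le_one_iff.2 ht
    nlinarith
  · set A := {ω | IsSuper T (fun b => hash b ω) (n + 1) b} with hA
    set B := {ω | IsSuper T (fun b => hash b ω) n b} with hB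
    have hAm : MeasurableSet A := H.measurableSet_super _ _
    have hBm : MeasurableSet B := H.measurableSet_super _ _
    have hAB : A ⊆ B := fun ω h =>
      isSuper_anti T (fun b => hash b ω) n (n + 1) b (by omega) h
    have hPA : Pr A = ENNReal.ofReal ((2 ^ (n + 1))⁻¹) := H.prob_super _ hb1
    have hPB : Pr B = ENNReal.ofReal ((2 ^ n)⁻¹) := H.prob_super _ hb1
    have hsum : ∀ ω, ENNReal.ofReal (Real.exp (logWeight (IsSuper T fun b => hash b ω) n s t b)) =
        A.indicator (fun _ => ENNReal.ofReal (Real.exp s)) ω +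
        ((B \ A).indicator (fun _ => ENNReal.ofReal (Real.exp t)) ω +
          Bᶜ.indicator (fun _ => 1) ω) := by
      intro ω
      by_cases h1 : ω ∈ A
      · have h2 := hAB h1
        have h1' := h1
        simp only [hA, Set.mem_ofPred_eq] at h1'
        simp [h1, h2, logWeight, h1']
      · have h1' := h1
        simp only [hA, Set.mem_ofPred_eq] at h1'
        by_cases h2 : ω ∈ B
        · have h2' := h2
          simp only [hB, Set.mem_ofPred_eq] at h2'
          simp [h1, h2, logWeight, h1', h2']
        · have h2' := h2
          simp only [hB, Set.mem_ofPred_eq] at h2'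
          simp [h1, h2, logWeight, h1', h2']
    simp only [hsum]
    rw [lintegral_add_left (measurable_const.indicator hAm),
      lintegral_add_left (measurable_const.indicator (hBm.diff hAm)),
      lintegral_indicator_const hAm, lintegral_indicator_const (hBm.diff hAm),
      lintegral_indicator_const hBm.compl, prob_compl_eq_one_sub hBm,
      measure_sdiff hAB hAm.nullMeasurableSet (measure_ne_top _ _), hPA, hPB]
    have hq : ((2 : ℝ) ^ (n + 1))⁻¹ = (2 ^ n)⁻¹ / 2 := by rw [pow_succ]; field_simp
    rw [hq, ← ENNReal.ofReal_one, ← ENNReal.ofReal_sub _ (by positivity),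
      ← ENNReal.ofReal_sub _ (by positivity), ← ENNReal.ofReal_mul (by positivity),
      ← ENNReal.ofReal_mul (by positivity), ← ENNReal.ofReal_mul (by positivity),
      ← ENNReal.ofReal_add (by have := Real.exp_pos t; nlinarith) (by nlinarith),
      ← ENNReal.ofReal_add (by positivity) (by have := Real.exp_pos t; nlinarith)]
    refine ENNReal.ofReal_le_ofReal (le_trans (le_of_eq ?_) (Real.add_one_le_exp _))
    ring

theorem UniformHashes.lintegral_prod_weight_le (H : UniformHashes Pr T hash) (n z y : ℕ)
    (s t : ℕ → ℝ) (hb : ∀ b, z ≤ b → b < y → 1 ≤ b ∨ (s b ≤ t b ∧ t b ≤ 0)) :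
    ∫⁻ ω, ENNReal.ofReal (Real.exp (∑ b ∈ Finset.Ico z y,
        logWeight (IsSuper T fun b => hash b ω) n (s b) (t b) b)) ∂Pr ≤
      ENNReal.ofReal (Real.exp (∑ b ∈ Finset.Ico z y,
        (2 ^ n)⁻¹ * ((Real.exp (t b) + Real.exp (s b)) / 2 - 1))) := by
  classical
  set G : ℕ → ℝ → ENNReal := fun b x =>
    ENNReal.ofReal (Real.exp (logWeight (IsSuper T fun _ => x) n (s b) (t b) b)) with hG
  have hGm : ∀ b, Measurable (G b) := by
    intro b
    refine ENNReal.measurable_ofReal.comp (Real.measurable_exp.comp ?_)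
    unfold logWeight
    exact Measurable.ite (measurableSet_isSuper T _ _) measurable_const
      (Measurable.ite (measurableSet_isSuper T _ _) measurable_const measurable_const)
  have hind : iIndepFun (fun b ω => G b (hash b ω)) Pr := H.indep.comp G hGm
  have h1 : ∀ ω, ENNReal.ofReal (Real.exp (∑ b ∈ Finset.Ico z y,
      logWeight (IsSuper T fun b => hash b ω) n (s b) (t b) b)) =
      ∏ b ∈ Finset.Ico z y, G b (hash b ω) := by
    intro ω
    rw [Real.exp_sum, ENNReal.ofReal_prod_of_nonneg fun _ _ => (Real.exp_pos _).le]
    rfl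
  simp only [h1]
  rw [lintegral_prod_eq_prod_lintegral_of_indepFun _ _ hind fun b => (hGm b).comp (H.measurable b),
    Real.exp_sum, ENNReal.ofReal_prod_of_nonneg fun _ _ => (Real.exp_pos _).le]
  refine Finset.prod_le_prod' fun b hbm => ?_
  rw [Finset.mem_Ico] at hbm
  exact H.lintegral_weight_le n (s b) (t b) b (hb b hbm.1 hbm.2)

/-- A Chernoff bound for two adjacent intervals of blocks. -/
theorem UniformHashes.chernoff (H : UniformHashes Pr T hash) (n : ℕ) {z c y : ℕ}
    (hzc : z ≤ c) (hcy : c ≤ y) (s₁ t₁ s₂ t₂ x : ℝ) (h1 : 1 ≤ z ∨ (s₁ ≤ t₁ ∧ t₁ ≤ 0))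
    (h2 : 1 ≤ c ∨ (s₂ ≤ t₂ ∧ t₂ ≤ 0)) (R : Ω → Prop)
    (hR : ∀ ω, R ω → ∀ sb, sb = IsSuper T (fun b => hash b ω) →
      x ≤ t₁ * ((cnt sb n z c : ℝ) - cnt sb (n + 1) z c) + s₁ * cnt sb (n + 1) z c +
        (t₂ * ((cnt sb n c y : ℝ) - cnt sb (n + 1) c y) + s₂ * cnt sb (n + 1) c y)) :
    Pr {ω | R ω} ≤ ENNReal.ofReal (Real.exp ((2 ^ n)⁻¹ *
      (((c : ℝ) - z) * ((Real.exp t₁ + Real.exp s₁) / 2 - 1) +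
        ((y : ℝ) - c) * ((Real.exp t₂ + Real.exp s₂) / 2 - 1)) - x)) := by
  classical
  set s : ℕ → ℝ := fun b => if b < c then s₁ else s₂ with hs
  set t : ℕ → ℝ := fun b => if b < c then t₁ else t₂ with ht
  have hb : ∀ b, z ≤ b → b < y → 1 ≤ b ∨ (s b ≤ t b ∧ t b ≤ 0) := by
    intro b hb1 hb2
    by_cases hbc : b < c
    · simp only [hs, ht, if_pos hbc]
      exact h1.imp (fun h => h.trans hb1) id
    · simp only [hs, ht, if_neg hbc]
      exact h2.imp (fun h => by omega) id
  have key := H.lintegral_prod_weight_le n z y s t hb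
  have hsplit : ∀ f : ℕ → ℝ, ∑ b ∈ Finset.Ico z y, f b =
      ∑ b ∈ Finset.Ico z c, f b + ∑ b ∈ Finset.Ico c y, f b :=
    fun f => (Finset.sum_Ico_consecutive f hzc hcy).symm
  have hlow : ∀ b ∈ Finset.Ico z c, s b = s₁ ∧ t b = t₁ := fun b hb => by
    have := (Finset.mem_Ico.1 hb).2
    simp [hs, ht, this]
  have hhigh : ∀ b ∈ Finset.Ico c y, s b = s₂ ∧ t b = t₂ := fun b hb => by
    have := (Finset.mem_Ico.1 hb).1
    simp [hs, ht, not_lt.2 this]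
  have hrhs : ∑ b ∈ Finset.Ico z y, ((2 : ℝ) ^ n)⁻¹ * ((Real.exp (t b) + Real.exp (s b)) / 2 - 1) =
      (2 ^ n)⁻¹ * (((c : ℝ) - z) * ((Real.exp t₁ + Real.exp s₁) / 2 - 1) +
        ((y : ℝ) - c) * ((Real.exp t₂ + Real.exp s₂) / 2 - 1)) := by
    rw [hsplit, Finset.sum_congr rfl fun b hb => by rw [(hlow b hb).1, (hlow b hb).2],
      Finset.sum_congr (s₁ := Finset.Ico c y) rfl fun b hb => by
        rw [(hhigh b hb).1, (hhigh b hb).2]]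
    simp only [Finset.sum_const, Nat.card_Ico, nsmul_eq_mul]
    rw [Nat.cast_sub hzc, Nat.cast_sub hcy]
    ring
  rw [hrhs] at key
  have hlhs : ∀ ω, R ω → ENNReal.ofReal (Real.exp x) ≤
      ENNReal.ofReal (Real.exp (∑ b ∈ Finset.Ico z y,
        logWeight (IsSuper T fun b => hash b ω) n (s b) (t b) b)) := by
    intro ω hω
    refine ENNReal.ofReal_le_ofReal (Real.exp_le_exp.2 ((hR ω hω _ rfl).trans (le_of_eq ?_)))
    rw [hsplit, Finset.sum_congr rfl fun b hb => by rw [(hlow b hb).1, (hlow b hb).2],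
      Finset.sum_congr (s₁ := Finset.Ico c y) rfl fun b hb => by
        rw [(hhigh b hb).1, (hhigh b hb).2],
      sum_logWeight (isSuper_anti T _), sum_logWeight (isSuper_anti T _)]
  rw [Real.exp_sub, ENNReal.ofReal_div_of_pos (Real.exp_pos _)]
  rw [ENNReal.le_div_iff_mul_le (Or.inl (by simp [Real.exp_pos])) (Or.inl ENNReal.ofReal_ne_top),
    mul_comm]
  calc ENNReal.ofReal (Real.exp x) * Pr {ω | R ω}
      ≤ ENNReal.ofReal (Real.exp x) * Pr {ω | ENNReal.ofReal (Real.exp x) ≤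
          ENNReal.ofReal (Real.exp (∑ b ∈ Finset.Ico z y,
            logWeight (IsSuper T fun b => hash b ω) n (s b) (t b) b))} := by
        gcongr
        exact fun hω => hlhs _ hω
    _ ≤ _ := mul_meas_ge_le_lintegral₀ ?_ _
    _ ≤ _ := key
  refine Measurable.aemeasurable ?_
  refine ENNReal.measurable_ofReal.comp (Real.measurable_exp.comp ?_)
  refine Finset.measurable_sum _ fun b _ => ?_
  unfold logWeight
  exact Measurable.ite (H.measurableSet_super _ _) measurable_const
    (Measurable.ite (H.measurableSet_super _ _) measurable_const measurable_const)

end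

/-! ### The probability that a word survives -/

section

variable {Ω : Type*}

/-- The information in the hashes of the blocks from `x` on. -/
abbrev fromBlock (hash : ℕ → Ω → ℝ) (x : ℕ) : MeasurableSpace Ω :=
  ⨆ b ∈ Set.Ici x, MeasurableSpace.comap (hash b) inferInstance

theorem fromBlock_anti (hash : ℕ → Ω → ℝ) {x x' : ℕ} (h : x ≤ x') :
    fromBlock hash x' ≤ fromBlock hash x :=
  biSup_mono fun _ hb => h.trans hb

theorem measurableSet_super_comap (T ν b : ℕ) (hash : ℕ → Ω → ℝ) :
    MeasurableSet[MeasurableSpace.comap (hash b) inferInstance]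
      {ω | IsSuper T (fun b => hash b ω) ν b} :=
  ⟨_, measurableSet_isSuper T ν b, rfl⟩

theorem measurableSet_super_fromBlock (T ν b : ℕ) (hash : ℕ → Ω → ℝ) :
    MeasurableSet[fromBlock hash b] {ω | IsSuper T (fun b => hash b ω) ν b} :=
  le_iSup₂ (f := fun b' (_ : b' ∈ Set.Ici b) => MeasurableSpace.comap (hash b') inferInstance)
    b (Set.mem_Ici.2 le_rfl) _ (measurableSet_super_comap T ν b hash)

theorem measurableSet_survives (T μ : ℕ) (hash : ℕ → Ω → ℝ) (h : ℕ) : ∀ (w : List ℕ) (x : ℕ),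
    MeasurableSet[fromBlock hash x] {ω | Survives (IsSuper T fun b => hash b ω) μ h w x} := by
  induction h with
  | zero =>
    intro w x
    cases w <;> exact MeasurableSet.const _
  | succ h ih =>
    intro w x
    cases w with
    | nil => exact MeasurableSet.const _
    | cons v w =>
      have hmono := fromBlock_anti hash (Nat.le_succ x)
      have h1 := fun w' => hmono _ (ih w' (x + 1))
      have h2 := fun ν => measurableSet_super_fromBlock T ν x hash
      exact (h2 μ).compl.inter (((h2 v).inter (h1 w)).union ((h2 v).compl.inter (h1 (v :: w))))

variable [MeasurableSpace Ω] {Pr : Measure Ω} {T : ℕ} {hash : ℕ → Ω → ℝ}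

theorem UniformHashes.measure_inter (H : UniformHashes Pr T hash) {x : ℕ} {A B : Set Ω}
    (hA : MeasurableSet[MeasurableSpace.comap (hash x) inferInstance] A)
    (hB : MeasurableSet[fromBlock hash (x + 1)] B) : Pr (A ∩ B) = Pr A * Pr B := by
  have h1 : Indep (⨆ b ∈ ({x} : Set ℕ), MeasurableSpace.comap (hash b) inferInstance)
      (fromBlock hash (x + 1)) Pr := by
    refine indep_iSup_of_disjoint (fun b => (H.measurable b).comap_le) H.indep ?_
    rw [Set.disjoint_singleton_left, Set.mem_Ici]
    omega
  rw [Indep_iff] at h1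
  refine h1 A B ?_ hB
  rwa [iSup_singleton]

/-- The probability bound for the survival of a word. -/
noncomputable def wordBound (μ : ℕ) (w : List ℕ) : ℝ :=
  (w.map fun v => 1 - (2 : ℝ) ^ v / 2 ^ μ).prod

theorem wordBound_nonneg {μ : ℕ} {w : List ℕ} (hw : ∀ v ∈ w, v < μ) : 0 ≤ wordBound μ w := by
  refine List.prod_nonneg fun p hp => ?_
  obtain ⟨v, hv, rfl⟩ := List.mem_map.1 hp
  rw [sub_nonneg, div_le_one (by positivity)]
  exact pow_le_pow_right₀ (by norm_num) (hw v hv).le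

/-- Among superblocks of level v, a fraction 2^(v-μ) has level μ, so each letter costs a factor 1 -
2^(v-μ). In the induction one block is independent of the later ones, and `wordBound` is the fixed
point of the resulting recursion. -/
theorem UniformHashes.prob_survives_le [IsProbabilityMeasure Pr] (H : UniformHashes Pr T hash)
    (μ h : ℕ) : ∀ (w : List ℕ) (x : ℕ), (∀ v ∈ w, v < μ) →
    Pr {ω | Survives (IsSuper T fun b => hash b ω) μ h w x} ≤ ENNReal.ofReal (wordBound μ w) := by
  induction h with
  | zero =>
    intro w x hw
    cases w with
    | nil => simpa [wordBound] using prob_le_one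
    | cons v w => simp [Survives]
  | succ h ih =>
    intro w x hw
    cases w with
    | nil => simpa [wordBound] using prob_le_one
    | cons v w =>
      -- Genesis has level μ, so no nonempty word survives from it.
      rcases Nat.eq_zero_or_pos x with rfl | hx
      · have : {ω | Survives (IsSuper T fun b => hash b ω) μ (h + 1) (v :: w) 0} = ∅ := by
          ext ω
          simp [Survives, IsSuper]
        rw [this, measure_empty]
        exact zero_le
      have hvμ : v < μ := hw v (by simp)
      have hw' : ∀ u ∈ w, u < μ := fun u hu => hw u (by simp [hu])
      set A : ℕ → Set Ω := fun ν => {ω | IsSuper T (fun b => hash b ω) ν x} with hA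
      set S : List ℕ → Set Ω := fun w =>
        {ω | Survives (IsSuper T fun b => hash b ω) μ h w (x + 1)} with hS
      have hAc := fun ν => measurableSet_super_comap T ν x hash
      have hSm := fun w => measurableSet_survives T μ hash h w (x + 1)
      have hAm : ∀ ν, MeasurableSet (A ν) := fun ν => H.measurableSet_super ν x
      have hsub : {ω | Survives (IsSuper T fun b => hash b ω) μ (h + 1) (v :: w) x} ⊆
          ((A v \ A μ) ∩ S w) ∪ ((A v)ᶜ ∩ S (v :: w)) := by
        rintro ω ⟨h1, ⟨h2, h3⟩ | ⟨h2, h3⟩⟩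
        · exact Or.inl ⟨⟨h2, h1⟩, h3⟩
        · exact Or.inr ⟨h2, h3⟩
      have hAA : A μ ⊆ A v := fun ω hω =>
        isSuper_anti T (fun b => hash b ω) v μ x hvμ.le hω
      have hp : (2 : ℝ) ^ v ≤ 2 ^ μ := pow_le_pow_right₀ (by norm_num) hvμ.le
      have hpi : ((2 : ℝ) ^ μ)⁻¹ ≤ (2 ^ v)⁻¹ := inv_anti₀ (by positivity) hp
      have h1v : ((2 : ℝ) ^ v)⁻¹ ≤ 1 := inv_le_one_of_one_le₀ (one_le_pow₀ (by norm_num))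
      have hP1 : Pr (A v \ A μ) = ENNReal.ofReal ((2 ^ v)⁻¹ - (2 ^ μ)⁻¹) := by
        rw [measure_sdiff hAA (hAm μ).nullMeasurableSet (measure_ne_top _ _),
          H.prob_super v hx, H.prob_super μ hx, ENNReal.ofReal_sub _ (by positivity)]
      have hP2 : Pr (A v)ᶜ = ENNReal.ofReal (1 - (2 ^ v)⁻¹) := by
        rw [prob_compl_eq_one_sub (hAm v), H.prob_super v hx, ENNReal.ofReal_sub _ (by positivity),
          ENNReal.ofReal_one]
      have hW := wordBound_nonneg hw'
      have hW' := wordBound_nonneg hw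
      calc Pr {ω | Survives (IsSuper T fun b => hash b ω) μ (h + 1) (v :: w) x}
          ≤ Pr ((A v \ A μ) ∩ S w) + Pr ((A v)ᶜ ∩ S (v :: w)) :=
            (measure_mono hsub).trans (measure_union_le _ _)
        _ = Pr (A v \ A μ) * Pr (S w) + Pr (A v)ᶜ * Pr (S (v :: w)) := by
            rw [H.measure_inter ((hAc v).diff (hAc μ)) (hSm w),
              H.measure_inter (hAc v).compl (hSm (v :: w))]
        _ ≤ ENNReal.ofReal ((2 ^ v)⁻¹ - (2 ^ μ)⁻¹) * ENNReal.ofReal (wordBound μ w) +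
            ENNReal.ofReal (1 - (2 ^ v)⁻¹) * ENNReal.ofReal (wordBound μ (v :: w)) := by
            rw [hP1, hP2]
            gcongr
            · exact ih w (x + 1) hw'
            · exact ih (v :: w) (x + 1) hw
        _ = ENNReal.ofReal (wordBound μ (v :: w)) := by
            rw [← ENNReal.ofReal_mul (by linarith), ← ENNReal.ofReal_mul (by linarith),
              ← ENNReal.ofReal_add (mul_nonneg (by linarith) hW) (mul_nonneg (by linarith) hW')]
            congr 1
            simp only [wordBound, List.map_cons, List.prod_cons]
            field_simp
            ring

/-- A chunk has 2^(μ-v) letters, each costing at most exp(-2^(v-μ)), hence a factor exp(-1) at every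
level. -/
theorem wordBound_chunk {μ v : ℕ} (hv : v < μ) (m : ℕ) (w : List ℕ) (hw : 0 ≤ wordBound μ w) :
    wordBound μ (List.replicate (m * 2 ^ (μ - v)) v ++ w) ≤ Real.exp (-m) * wordBound μ w := by
  unfold wordBound at hw ⊢
  rw [List.map_append, List.prod_append, List.map_replicate, List.prod_replicate]
  refine mul_le_mul_of_nonneg_right ?_ hw
  have h1 : 1 - (2 : ℝ) ^ v / 2 ^ μ ≤ Real.exp (-(2 ^ v / 2 ^ μ)) := by
    have := Real.add_one_le_exp (-((2 : ℝ) ^ v / 2 ^ μ))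
    linarith
  have h0 : 0 ≤ 1 - (2 : ℝ) ^ v / 2 ^ μ := by
    rw [sub_nonneg, div_le_one (by positivity)]
    exact pow_le_pow_right₀ (by norm_num) hv.le
  refine (pow_le_pow_left₀ h0 h1 _).trans (le_of_eq ?_)
  rw [← Real.exp_nat_mul]
  congr 1
  have h2 : (2 : ℝ) ^ μ = 2 ^ v * 2 ^ (μ - v) := by rw [← pow_add]; congr 1; omega
  rw [h2]
  push_cast
  field_simp

theorem mem_chunkWord {μ : ℕ} {n : ℕ → ℕ} {ν v : ℕ} (h : v ∈ chunkWord μ n ν) : v < ν := by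
  induction ν with
  | zero => simp [chunkWord] at h
  | succ ν ih =>
    rw [chunkWord, List.mem_append] at h
    rcases h with h | h
    · rw [List.eq_of_mem_replicate h]; omega
    · exact (ih h).trans (Nat.lt_succ_self ν)

theorem wordBound_chunkWord {μ : ℕ} (n : ℕ → ℕ) {ν : ℕ} (hν : ν ≤ μ) :
    wordBound μ (chunkWord μ n ν) ≤ Real.exp (-((∑ i ∈ Finset.range ν, n i : ℕ) : ℝ)) := by
  induction ν with
  | zero => simp [chunkWord, wordBound]
  | succ ν ih =>
    rw [chunkWord]
    refine (wordBound_chunk (by omega) _ _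
      (wordBound_nonneg fun v hv => (mem_chunkWord hv).trans (by omega))).trans ?_
    refine (mul_le_mul_of_nonneg_left (ih (by omega)) (Real.exp_pos _).le).trans (le_of_eq ?_)
    rw [← Real.exp_add, Finset.sum_range_succ]
    congr 1
    push_cast
    ring

theorem mem_fullWord {μ μ₁ : ℕ} (hμ₁ : μ₁ < μ) {n : ℕ → ℕ} {v : ℕ} (h : v ∈ fullWord μ μ₁ n) :
    v < μ := by
  rw [fullWord, List.mem_append] at h
  rcases h with h | h
  · rw [List.eq_of_mem_replicate h]; exact hμ₁
  · exact mem_chunkWord h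

theorem wordBound_fullWord {μ μ₁ : ℕ} (hμ₁ : μ₁ < μ) (n : ℕ → ℕ) :
    wordBound μ (fullWord μ μ₁ n) ≤
      Real.exp (-((∑ i ∈ Finset.range (μ + 1), n i : ℕ) : ℝ)) := by
  refine (wordBound_chunk hμ₁ _ _ (wordBound_nonneg fun v hv => mem_chunkWord hv)).trans ?_
  refine (mul_le_mul_of_nonneg_left (wordBound_chunkWord n le_rfl) (Real.exp_pos _).le).trans
    (le_of_eq ?_)
  rw [← Real.exp_add, Finset.sum_range_succ]
  congr 1
  push_cast
  ring

end

/-! ### The probability that some heavy word survives -/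

theorem survives_succ {sb : ℕ → ℕ → Prop} {μ h : ℕ} : ∀ {w : List ℕ} {x : ℕ},
    Survives sb μ h w x → Survives sb μ (h + 1) w x := by
  induction h with
  | zero =>
    intro w x hw
    cases w with
    | nil => trivial
    | cons v w => exact hw.elim
  | succ h ih =>
    intro w x hw
    cases w with
    | nil => trivial
    | cons v w => exact ⟨hw.1, hw.2.imp (fun h => ⟨h.1, ih h.2⟩) fun h => ⟨h.1, ih h.2⟩⟩

/-- This is the generating function (1 - x)^(-|s|) at x = 4/5: the number of solutions grows in N at
a rate smaller than e, which leaves decay in the union bound. -/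
theorem card_piAntidiag_le (s : Finset ℕ) : ∀ N : ℕ,
    ((s.piAntidiag N).card : ℝ) ≤ 5 ^ s.card * (5 / 4) ^ N := by
  classical
  induction s using Finset.cons_induction with
  | empty =>
    intro N
    have h1 : (1 : ℝ) ≤ (5 / 4) ^ N := one_le_pow₀ (by norm_num)
    rw [Finset.piAntidiag_empty]
    split_ifs <;> simp <;> linarith
  | cons i s hi ih =>
    intro N
    rw [Finset.piAntidiag_cons, Finset.card_disjiUnion, Finset.card_cons]
    simp only [Finset.card_map]
    push_cast
    have h1 : ∀ N : ℕ, ∑ j ∈ Finset.range (N + 1), ((5 : ℝ) / 4) ^ j ≤ 5 * (5 / 4) ^ N := by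
      intro N
      induction N with
      | zero => norm_num
      | succ N ihN =>
        rw [Finset.sum_range_succ, pow_succ]
        linarith
    calc ∑ p ∈ Finset.HasAntidiagonal.antidiagonal N, ((s.piAntidiag p.2).card : ℝ)
        ≤ ∑ p ∈ Finset.HasAntidiagonal.antidiagonal N, (5 : ℝ) ^ s.card * (5 / 4) ^ p.2 :=
          Finset.sum_le_sum fun p _ => ih p.2
      _ = 5 ^ s.card * ∑ j ∈ Finset.range (N + 1), ((5 : ℝ) / 4) ^ j := by
          rw [← Finset.mul_sum]
          congr 1
          rw [Finset.Nat.sum_antidiagonal_eq_sum_range_succ_mk]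
          exact Finset.sum_range_reflect (fun j => ((5 : ℝ) / 4) ^ j) (N + 1)
      _ ≤ 5 ^ s.card * (5 * (5 / 4) ^ N) := by gcongr; exact h1 N
      _ = _ := by ring

theorem chunkWord_congr {μ : ℕ} {n n' : ℕ → ℕ} {ν : ℕ} (h : ∀ i < ν, n i = n' i) :
    chunkWord μ n ν = chunkWord μ n' ν := by
  induction ν with
  | zero => rfl
  | succ ν ih => rw [chunkWord, chunkWord, h ν (by omega), ih fun i hi => h i (by omega)]

theorem fullWord_congr {μ μ₁ : ℕ} {n n' : ℕ → ℕ} (h : ∀ i < μ + 1, n i = n' i) :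
    fullWord μ μ₁ n = fullWord μ μ₁ n' := by
  rw [fullWord, fullWord, h μ (by omega), chunkWord_congr fun i hi => h i (by omega)]

section

variable {Ω : Type*} [MeasurableSpace Ω] {Pr : Measure Ω} [IsProbabilityMeasure Pr] {T : ℕ}
  {hash : ℕ → Ω → ℝ}

theorem UniformHashes.prob_exists_survives_le (H : UniformHashes Pr T hash) {μ : ℕ} {w : List ℕ}
    (x : ℕ) (hw : ∀ v ∈ w, v < μ) :
    Pr {ω | ∃ h, Survives (IsSuper T fun b => hash b ω) μ h w x} ≤
      ENNReal.ofReal (wordBound μ w) := by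
  have h1 : {ω | ∃ h, Survives (IsSuper T fun b => hash b ω) μ h w x} =
      ⋃ h, {ω | Survives (IsSuper T fun b => hash b ω) μ h w x} := by
    ext ω; simp
  rw [h1, Monotone.measure_iUnion]
  · exact iSup_le fun h => H.prob_survives_le μ h w x hw
  · exact monotone_nat_of_le_succ fun h ω hω => survives_succ hω

theorem five_quarters_le : (5 : ℝ) / 4 * Real.exp (-1) ≤ Real.exp (-(775 / 1000)) := by
  have h1 := Real.quadratic_le_exp_of_nonneg (show (0 : ℝ) ≤ 225 / 1000 by norm_num)
  have h2 : Real.exp (-(775 / 1000)) = Real.exp (225 / 1000) * Real.exp (-1) := by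
    rw [← Real.exp_add]; norm_num
  rw [h2]
  gcongr
  refine le_trans ?_ h1
  norm_num

theorem UniformHashes.prob_exists_chunks_le (H : UniformHashes Pr T hash) {μ μ₁ : ℕ} (x N : ℕ)
    (hμ₁ : μ₁ < μ) :
    Pr {ω | ∃ h, ∃ n : ℕ → ℕ, ∑ ν ∈ Finset.range (μ + 1), n ν = N ∧
        Survives (IsSuper T fun b => hash b ω) μ h (fullWord μ μ₁ n) x} ≤
      ENNReal.ofReal (5 ^ (μ + 1) * Real.exp (-(775 / 1000)) ^ N) := by
  classical
  set I := (Finset.range (μ + 1)).piAntidiag N with hI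
  have hsub : {ω | ∃ h, ∃ n : ℕ → ℕ, ∑ ν ∈ Finset.range (μ + 1), n ν = N ∧
        Survives (IsSuper T fun b => hash b ω) μ h (fullWord μ μ₁ n) x} ⊆
      ⋃ n ∈ I, {ω | ∃ h, Survives (IsSuper T fun b => hash b ω) μ h (fullWord μ μ₁ n) x} := by
    rintro ω ⟨h, n, hn, hs⟩
    -- The word sees only the first μ+1 values, so the rest are set to 0 to land in a finite family.
    set n' : ℕ → ℕ := fun i => if i < μ + 1 then n i else 0 with hn'
    have hnn : ∀ i < μ + 1, n i = n' i := fun i hi => (if_pos hi).symm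
    simp only [Set.mem_iUnion]
    refine ⟨n', ?_, h, ?_⟩
    · rw [hI, Finset.mem_piAntidiag]
      constructor
      · rw [← hn]
        exact Finset.sum_congr rfl fun i hi => (hnn i (Finset.mem_range.1 hi)).symm
      · intro i hi
        by_contra hlt
        rw [Finset.mem_range] at hlt
        exact hi (if_neg hlt)
    · rwa [← fullWord_congr hnn]
  refine (measure_mono hsub).trans ((measure_biUnion_finset_le _ _).trans ?_)
  have h1 : ∀ n ∈ I, Pr {ω | ∃ h, Survives (IsSuper T fun b => hash b ω) μ h (fullWord μ μ₁ n) x} ≤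
      ENNReal.ofReal (Real.exp (-(N : ℝ))) := by
    intro n hn
    refine (H.prob_exists_survives_le x fun v hv => mem_fullWord hμ₁ hv).trans ?_
    refine ENNReal.ofReal_le_ofReal ((wordBound_fullWord hμ₁ n).trans (le_of_eq ?_))
    rw [hI, Finset.mem_piAntidiag] at hn
    rw [← hn.1]
  refine (Finset.sum_le_sum h1).trans ?_
  rw [Finset.sum_const, nsmul_eq_mul, ← ENNReal.ofReal_natCast, ← ENNReal.ofReal_mul (by positivity)]
  refine ENNReal.ofReal_le_ofReal ?_
  have h2 := card_piAntidiag_le (Finset.range (μ + 1)) N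
  rw [Finset.card_range, ← hI] at h2
  have h3 : Real.exp (-(N : ℝ)) = Real.exp (-1) ^ N := by
    rw [← Real.exp_nat_mul]; congr 1; ring
  calc (I.card : ℝ) * Real.exp (-(N : ℝ))
      ≤ 5 ^ (μ + 1) * (5 / 4) ^ N * Real.exp (-1) ^ N := by
        rw [h3]; gcongr
    _ = 5 ^ (μ + 1) * (5 / 4 * Real.exp (-1)) ^ N := by rw [mul_pow]; ring
    _ ≤ _ := by gcongr; exact five_quarters_le

/-- A geometric series over the number N of chunks, with ratio at most 1/2, accounts for the factor
2, and the choice of `μ₁` for the factor μ. -/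
theorem UniformHashes.prob_heavy_le (H : UniformHashes Pr T hash) (μ x : ℕ) (G : ℝ) :
    Pr {ω | ∃ h, ∃ n : ℕ → ℕ, ∃ μ₁ < μ, G ≤ ((∑ ν ∈ Finset.range (μ + 1), n ν : ℕ) : ℝ) ∧
        Survives (IsSuper T fun b => hash b ω) μ h (fullWord μ μ₁ n) x} ≤
      ENNReal.ofReal (2 * μ * 5 ^ (μ + 1) * Real.exp (-(775 / 1000) * G)) := by
  classical
  set q := Real.exp (-(775 / 1000)) with hq
  have hq0 : 0 < q := Real.exp_pos _
  have hq2 : q ≤ 1 / 2 := by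
    have h1 := Real.quadratic_le_exp_of_nonneg (show (0 : ℝ) ≤ 775 / 1000 by norm_num)
    rw [hq, Real.exp_neg, inv_le_comm₀ (Real.exp_pos _) (by norm_num)]
    refine le_trans ?_ h1
    norm_num
  set A : ℕ → ℕ → Set Ω := fun μ₁ N => {ω | ∃ h, ∃ n : ℕ → ℕ,
      ∑ ν ∈ Finset.range (μ + 1), n ν = N ∧
        Survives (IsSuper T fun b => hash b ω) μ h (fullWord μ μ₁ n) x} with hA
  have hsub : {ω | ∃ h, ∃ n : ℕ → ℕ, ∃ μ₁ < μ,
        G ≤ ((∑ ν ∈ Finset.range (μ + 1), n ν : ℕ) : ℝ) ∧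
        Survives (IsSuper T fun b => hash b ω) μ h (fullWord μ μ₁ n) x} ⊆
      ⋃ μ₁ ∈ Finset.range μ, ⋃ i : ℕ, A μ₁ (⌈G⌉₊ + i) := by
    rintro ω ⟨h, n, μ₁, hμ₁, hG, hs⟩
    simp only [Set.mem_iUnion]
    refine ⟨μ₁, Finset.mem_range.2 hμ₁, (∑ ν ∈ Finset.range (μ + 1), n ν) - ⌈G⌉₊, h, n, ?_, hs⟩
    have := Nat.ceil_le.2 hG
    omega
  refine (measure_mono hsub).trans ((measure_biUnion_finset_le _ _).trans ?_)
  have h1 : ∀ μ₁ ∈ Finset.range μ, Pr (⋃ i : ℕ, A μ₁ (⌈G⌉₊ + i)) ≤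
      ENNReal.ofReal (2 * 5 ^ (μ + 1) * Real.exp (-(775 / 1000) * G)) := by
    intro μ₁ hμ₁
    rw [Finset.mem_range] at hμ₁
    refine (measure_iUnion_le _).trans ?_
    have h2 : ∀ i : ℕ, Pr (A μ₁ (⌈G⌉₊ + i)) ≤ ENNReal.ofReal (5 ^ (μ + 1) * q ^ ⌈G⌉₊ * q ^ i) := by
      intro i
      refine (H.prob_exists_chunks_le x (⌈G⌉₊ + i) hμ₁).trans (le_of_eq ?_)
      rw [pow_add _ ⌈G⌉₊ i, mul_assoc]
    refine (ENNReal.tsum_le_tsum h2).trans ?_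
    have hs : Summable fun i : ℕ => 5 ^ (μ + 1) * q ^ ⌈G⌉₊ * q ^ i :=
      (summable_geometric_of_lt_one hq0.le (by linarith)).mul_left _
    rw [← ENNReal.ofReal_tsum_of_nonneg (fun i => by positivity) hs, tsum_mul_left,
      tsum_geometric_of_lt_one hq0.le (by linarith)]
    refine ENNReal.ofReal_le_ofReal ?_
    have h3 : q ^ ⌈G⌉₊ ≤ Real.exp (-(775 / 1000) * G) := by
      rw [hq, ← Real.exp_nat_mul]
      refine Real.exp_le_exp.2 ?_
      have := Nat.le_ceil G
      linarith
    have h4 : (1 - q)⁻¹ ≤ 2 := by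
      rw [inv_le_comm₀ (by linarith) (by norm_num)]
      linarith
    have h5 : 0 < (1 - q)⁻¹ := inv_pos.2 (by linarith)
    calc 5 ^ (μ + 1) * q ^ ⌈G⌉₊ * (1 - q)⁻¹
        ≤ 5 ^ (μ + 1) * Real.exp (-(775 / 1000) * G) * 2 := by gcongr
      _ = _ := by ring
  refine (Finset.sum_le_sum h1).trans (le_of_eq ?_)
  rw [Finset.sum_const, nsmul_eq_mul, Finset.card_range, ← ENNReal.ofReal_natCast,
    ← ENNReal.ofReal_mul (by positivity)]
  congr 1
  ring

end

/-! ### Union bounds -/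

/-- In the union bounds the number of levels is charged as y^(1/4). -/
theorem level_le_rpow {n y : ℕ} (hy : 1 ≤ y) (h : 2 ^ n ≤ 4 * y) :
    (n : ℝ) + 1 ≤ 13 * (y : ℝ) ^ (1 / 4 : ℝ) := by
  have hy' : (1 : ℝ) ≤ y := by exact_mod_cast hy
  have h' : (2 : ℝ) ^ n ≤ 4 * y := by exact_mod_cast h
  have h1 : (n : ℝ) * Real.log 2 ≤ Real.log (4 * y) := by
    rw [← Real.log_pow]
    exact Real.log_le_log (by positivity) h'
  have h2 := Real.log_le_rpow_div (x := 4 * (y : ℝ)) (by positivity) (show (0 : ℝ) < 1 / 4 by norm_num)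
  have h3 : (4 * (y : ℝ)) ^ (1 / 4 : ℝ) ≤ 2 * (y : ℝ) ^ (1 / 4 : ℝ) := by
    rw [Real.mul_rpow (by norm_num) (by positivity)]
    gcongr
    calc (4 : ℝ) ^ (1 / 4 : ℝ) ≤ 16 ^ (1 / 4 : ℝ) := by gcongr; norm_num
      _ = 2 := by
        rw [show (16 : ℝ) = 2 ^ (4 : ℝ) by norm_num, ← Real.rpow_mul (by norm_num)]
        norm_num
  have h4 := Real.log_two_gt_d9
  have h5 : 1 ≤ (y : ℝ) ^ (1 / 4 : ℝ) := Real.one_le_rpow hy' (by norm_num)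
  have h6 : (0 : ℝ) ≤ n := by positivity
  nlinarith

/-- The constant of the union bound over all positions, levels and starting points. -/
noncomputable def unionConst : ℝ := 26 * ∑' y : ℕ, (y : ℝ) ^ (-(9 / 8) : ℝ)

section

variable {Ω : Type*} [MeasurableSpace Ω] {Pr : Measure Ω}

/-- There are at most 13 y^(1/4) levels and 2y starting points, so y^(-19/8) leaves the summable
y^(-9/8). -/
theorem measure_exists_le {A : ℝ} (hA : 0 ≤ A) (bad : ℕ → ℕ → ℕ → Ω → Prop)
    (h : ∀ n z y, 1 ≤ y → 2 ^ n ≤ 4 * y → z ≤ y →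
      Pr {ω | bad n z y ω} ≤ ENNReal.ofReal (A * (y : ℝ) ^ (-(19 / 8) : ℝ))) :
    Pr {ω | ∃ n z y, 1 ≤ y ∧ 2 ^ n ≤ 4 * y ∧ z ≤ y ∧ bad n z y ω} ≤
      ENNReal.ofReal (unionConst * A) := by
  classical
  set U : ℕ → Set Ω := fun y => {ω | ∃ n z, 1 ≤ y ∧ 2 ^ n ≤ 4 * y ∧ z ≤ y ∧ bad n z y ω} with hU
  have h1 : ∀ y, Pr (U y) ≤ ENNReal.ofReal (26 * A * (y : ℝ) ^ (-(9 / 8) : ℝ)) := by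
    intro y
    rcases Nat.eq_zero_or_pos y with rfl | hy
    · have : U 0 = ∅ := by ext ω; simp [hU]
      rw [this, measure_empty]
      exact zero_le
    · set m := Nat.log 2 (4 * y) with hm
      have hm2 : 2 ^ m ≤ 4 * y := Nat.pow_log_le_self 2 (by omega)
      have hsub : U y ⊆ ⋃ n ∈ Finset.range (m + 1), ⋃ z ∈ Finset.range (y + 1),
          {ω | 2 ^ n ≤ 4 * y ∧ bad n z y ω} := by
        rintro ω ⟨n, z, -, hn, hz, hb⟩
        simp only [Set.mem_iUnion, Finset.mem_range]
        refine ⟨n, ?_, z, by omega, hn, hb⟩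
        have := Nat.le_log_of_pow_le (by norm_num) hn
        omega
      have h2 : ∀ n ∈ Finset.range (m + 1), ∀ z ∈ Finset.range (y + 1),
          Pr {ω | 2 ^ n ≤ 4 * y ∧ bad n z y ω} ≤
            ENNReal.ofReal (A * (y : ℝ) ^ (-(19 / 8) : ℝ)) := by
        intro n _ z hz
        rw [Finset.mem_range] at hz
        by_cases hn : 2 ^ n ≤ 4 * y
        · simpa [hn] using h n z y hy hn (by omega)
        · simp [hn]
      refine (measure_mono hsub).trans ((measure_biUnion_finset_le _ _).trans ?_)
      refine (Finset.sum_le_sum fun n hn => (measure_biUnion_finset_le _ _).trans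
        (Finset.sum_le_sum (h2 n hn))).trans ?_
      rw [Finset.sum_const, Finset.sum_const, nsmul_eq_mul, nsmul_eq_mul, Finset.card_range,
        Finset.card_range, ← ENNReal.ofReal_natCast, ← ENNReal.ofReal_natCast,
        ← ENNReal.ofReal_mul (by positivity), ← ENNReal.ofReal_mul (by positivity)]
      refine ENNReal.ofReal_le_ofReal ?_
      have hy' : (1 : ℝ) ≤ y := by exact_mod_cast hy
      have h3 := level_le_rpow hy hm2
      push_cast
      have h4 : (y : ℝ) ^ (1 / 4 : ℝ) * (y * (y : ℝ) ^ (-(19 / 8) : ℝ)) = (y : ℝ) ^ (-(9 / 8) : ℝ) := by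
        have : (y : ℝ) * (y : ℝ) ^ (-(19 / 8) : ℝ) = (y : ℝ) ^ (1 + -(19 / 8) : ℝ) := by
          rw [Real.rpow_add (by linarith), Real.rpow_one]
        rw [this, ← Real.rpow_add (by linarith)]
        norm_num
      calc ((m : ℝ) + 1) * (((y : ℝ) + 1) * (A * (y : ℝ) ^ (-(19 / 8) : ℝ)))
          ≤ (13 * (y : ℝ) ^ (1 / 4 : ℝ)) * ((2 * y) * (A * (y : ℝ) ^ (-(19 / 8) : ℝ))) := by
            gcongr
            linarith
        _ = 26 * A * ((y : ℝ) ^ (1 / 4 : ℝ) * (y * (y : ℝ) ^ (-(19 / 8) : ℝ))) := by ring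
        _ = _ := by rw [h4]
  have hsub : {ω | ∃ n z y, 1 ≤ y ∧ 2 ^ n ≤ 4 * y ∧ z ≤ y ∧ bad n z y ω} ⊆ ⋃ y, U y := by
    rintro ω ⟨n, z, y, hω⟩
    exact Set.mem_iUnion.2 ⟨y, n, z, hω⟩
  refine (measure_mono hsub).trans ((measure_iUnion_le _).trans ((ENNReal.tsum_le_tsum h1).trans ?_))
  have hs : Summable fun y : ℕ => (y : ℝ) ^ (-(9 / 8) : ℝ) :=
    Real.summable_nat_rpow.2 (by norm_num)
  rw [← ENNReal.ofReal_tsum_of_nonneg (fun y => by positivity) (hs.mul_left _), tsum_mul_left]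
  refine ENNReal.ofReal_le_ofReal (le_of_eq ?_)
  unfold unionConst
  ring

/-- One more position costs one more power of y: 27/8 instead of 19/8. -/
theorem measure_exists_mid_le {A : ℝ} (hA : 0 ≤ A) (bad : ℕ → ℕ → ℕ → ℕ → Ω → Prop)
    (h : ∀ n z c y, 1 ≤ y → 2 ^ n ≤ 4 * y → z ≤ c → c ≤ y →
      Pr {ω | bad n z c y ω} ≤ ENNReal.ofReal (A * (y : ℝ) ^ (-(27 / 8) : ℝ))) :
    Pr {ω | ∃ n z c y, 1 ≤ y ∧ 2 ^ n ≤ 4 * y ∧ z ≤ c ∧ c ≤ y ∧ bad n z c y ω} ≤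
      ENNReal.ofReal (unionConst * (2 * A)) := by
  classical
  have key := measure_exists_le (Pr := Pr) (A := 2 * A) (by positivity)
    (fun n z y ω => ∃ c, z ≤ c ∧ c ≤ y ∧ bad n z c y ω) ?_
  · refine (measure_mono ?_).trans key
    rintro ω ⟨n, z, c, y, hy, hn, hz, hc, hb⟩
    exact ⟨n, z, y, hy, hn, hz.trans hc, c, hz, hc, hb⟩
  · intro n z y hy hn hz
    have hsub : {ω | ∃ c, z ≤ c ∧ c ≤ y ∧ bad n z c y ω} ⊆
        ⋃ c ∈ Finset.range (y + 1), {ω | z ≤ c ∧ bad n z c y ω} := by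
      rintro ω ⟨c, hzc, hc, hb⟩
      simp only [Set.mem_iUnion, Finset.mem_range]
      exact ⟨c, by omega, hzc, hb⟩
    have h2 : ∀ c ∈ Finset.range (y + 1), Pr {ω | z ≤ c ∧ bad n z c y ω} ≤
        ENNReal.ofReal (A * (y : ℝ) ^ (-(27 / 8) : ℝ)) := by
      intro c hc
      rw [Finset.mem_range] at hc
      by_cases hzc : z ≤ c
      · simpa [hzc] using h n z c y hy hn hzc (by omega)
      · simp [hzc]
    refine (measure_mono hsub).trans ((measure_biUnion_finset_le _ _).trans
      ((Finset.sum_le_sum h2).trans ?_))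
    rw [Finset.sum_const, nsmul_eq_mul, Finset.card_range, ← ENNReal.ofReal_natCast,
      ← ENNReal.ofReal_mul (by positivity)]
    refine ENNReal.ofReal_le_ofReal ?_
    have hy' : (1 : ℝ) ≤ y := by exact_mod_cast hy
    have h4 : (y : ℝ) * (y : ℝ) ^ (-(27 / 8) : ℝ) = (y : ℝ) ^ (-(19 / 8) : ℝ) := by
      have : (y : ℝ) * (y : ℝ) ^ (-(27 / 8) : ℝ) = (y : ℝ) ^ (1 + -(27 / 8) : ℝ) := by
        rw [Real.rpow_add (by linarith), Real.rpow_one]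
      rw [this]
      norm_num
    push_cast
    calc ((y : ℝ) + 1) * (A * (y : ℝ) ^ (-(27 / 8) : ℝ))
        ≤ (2 * y) * (A * (y : ℝ) ^ (-(27 / 8) : ℝ)) := by gcongr; linarith
      _ = 2 * A * (y * (y : ℝ) ^ (-(27 / 8) : ℝ)) := by ring
      _ = _ := by rw [h4]

end

/-- Exponential decay in the growth scale. -/
theorem exp_scale_le {k y : ℕ} {a s η p : ℝ} (hy : 1 ≤ y) (hη : η ≤ s) (hp : p ≤ s * a) :
    Real.exp (-s * scale k a y) ≤ Real.exp (-η * k) * (y : ℝ) ^ (-p) := by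
  have hy' : (0 : ℝ) < y := by exact_mod_cast hy
  rw [Real.rpow_def_of_pos hy', ← Real.exp_add]
  refine Real.exp_le_exp.2 ?_
  unfold scale
  have h1 := Real.log_natCast_nonneg y
  have h2 : (0 : ℝ) ≤ k := by positivity
  nlinarith

/-! ### The probabilities of atypical events -/

theorem exp_two_fifths_le : Real.exp (2 / 5) ≤ 3 / 2 := by
  refine le_of_pow_le_pow_left₀ (n := 5) (by norm_num) (by norm_num) ?_
  have h1 : Real.exp (2 / 5) ^ 5 = Real.exp 1 ^ 2 := by
    rw [← Real.exp_nat_mul, ← Real.exp_nat_mul]; norm_num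
  rw [h1]
  have h2 := Real.exp_one_lt_d9
  have h3 := Real.exp_pos 1
  nlinarith

theorem exp_neg_two_fifths_le : Real.exp (-(2 / 5)) ≤ 17 / 25 := by
  rw [Real.exp_neg, inv_le_comm₀ (Real.exp_pos _) (by norm_num)]
  refine le_trans ?_ (Real.quadratic_le_exp_of_nonneg (by norm_num))
  norm_num

section

variable {Ω : Type*} [MeasurableSpace Ω] {Pr : Measure Ω} {T : ℕ}
  {hash : ℕ → Ω → ℝ} {k : ℕ} {a η : ℝ}

theorem UniformHashes.prob_not_level_le (H : UniformHashes Pr T hash) (ha : 8 ≤ a) (hη : η ≤ 1 / 4) :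
    Pr {ω | ∃ n z y : ℕ, 1 ≤ y ∧ 2 ^ n ≤ 4 * y ∧ z ≤ y ∧
      IsSuper T (fun b => hash b ω) (⌊4 * scale k a y⌋₊ + 1) y} ≤
      ENNReal.ofReal (unionConst * Real.exp (-η * k)) := by
  refine measure_exists_le (Real.exp_pos _).le _ fun n z y hy hn hz => ?_
  rw [H.prob_super _ hy]
  refine ENNReal.ofReal_le_ofReal (le_trans ?_
    (exp_scale_le (k := k) (a := a) (s := 1) hy (by linarith) (by linarith)))
  have h3 : 0 ≤ scale k a y := by
    unfold scale
    have := Real.log_natCast_nonneg y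
    positivity
  have h4 := (Nat.lt_floor_add_one (4 * scale k a y)).le
  have h5 := Real.log_two_gt_d9
  rw [← Real.exp_log (show (0 : ℝ) < 2 by norm_num), ← Real.exp_nat_mul, ← Real.exp_neg]
  refine Real.exp_le_exp.2 ?_
  push_cast
  nlinarith

variable [IsProbabilityMeasure Pr]

theorem UniformHashes.prob_not_lower_le (H : UniformHashes Pr T hash) (ha : 8 ≤ a) (hη : η ≤ 1 / 4) :
    Pr {ω | ∃ n z y, 1 ≤ y ∧ 2 ^ n ≤ 4 * y ∧ z ≤ y ∧
      5 / 4 * 2 ^ n * (cnt (IsSuper T fun b => hash b ω) n z y : ℝ) + 10 * 2 ^ n * scale k a y <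
        (y : ℝ) - z} ≤ ENNReal.ofReal (unionConst * Real.exp (-η * k)) := by
  refine measure_exists_le (Real.exp_pos _).le _ fun n z y hy hn hz => ?_
  -- The weight -2/5 gives e^(-2/5) - 1 ≤ -8/25, and (5/4)(8/25) = 2/5, so the interval length
  -- cancels in the exponent.
  have key := H.chernoff n (le_refl z) hz 0 0 (-(2 / 5)) (-(2 / 5))
    (-(8 / 25) * (((y : ℝ) - z) * (2 ^ n)⁻¹ - 10 * scale k a y)) (Or.inr ⟨le_rfl, le_rfl⟩)
    (Or.inr ⟨le_rfl, by norm_num⟩)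
    (fun ω => 5 / 4 * 2 ^ n * (cnt (IsSuper T fun b => hash b ω) n z y : ℝ) +
      10 * 2 ^ n * scale k a y < (y : ℝ) - z) ?_
  · refine key.trans (ENNReal.ofReal_le_ofReal (le_trans (Real.exp_le_exp.2 ?_)
      (exp_scale_le (k := k) (a := a) (s := 1) hy (by linarith) (by linarith))))
    have h1 := exp_neg_two_fifths_le
    have h2 : 0 ≤ ((y : ℝ) - z) * (2 ^ n)⁻¹ := by
      have : (z : ℝ) ≤ y := by exact_mod_cast hz
      exact mul_nonneg (by linarith) (by positivity)
    have h3 : 0 ≤ scale k a y := by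
      unfold scale
      have := Real.log_natCast_nonneg y
      positivity
    nlinarith
  · intro ω hω sb hsb
    rw [← hsb] at hω
    have h0 : cnt sb n z z = 0 := cnt_eq_zero _ _ le_rfl
    have hp : (0 : ℝ) < 2 ^ n := by positivity
    have h1 : 5 / 4 * (cnt sb n z y : ℝ) + 10 * scale k a y ≤ ((y : ℝ) - z) * (2 ^ n)⁻¹ := by
      rw [← div_eq_mul_inv, le_div_iff₀ hp]
      linarith
    simp only [h0, Nat.cast_zero]
    linarith

theorem UniformHashes.prob_not_upper_le (H : UniformHashes Pr T hash) (ha : 8 ≤ a) (hη : η ≤ 1 / 4) :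
    Pr {ω | ∃ n z y : ℕ, 1 ≤ y ∧ 2 ^ n ≤ 4 * y ∧ z ≤ y ∧ (1 ≤ z ∧
      5 / 4 * ((y : ℝ) - z) / 2 ^ n + 10 * scale k a y <
        (cnt (IsSuper T fun b => hash b ω) n z y : ℝ))} ≤
      ENNReal.ofReal (unionConst * Real.exp (-η * k)) := by
  refine measure_exists_le (Real.exp_pos _).le _ fun n z y hy hn hz => ?_
  by_cases hz1 : 1 ≤ z
  swap
  · simp [hz1]
  -- With weight 2/5, e^(2/5) - 1 ≤ 1/2 = (5/4)(2/5), and again the length cancels.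
  have key := H.chernoff n (le_refl z) hz 0 0 (2 / 5) (2 / 5)
    (2 / 5 * (5 / 4 * (((y : ℝ) - z) * (2 ^ n)⁻¹) + 10 * scale k a y)) (Or.inl hz1)
    (Or.inl hz1)
    (fun ω => 1 ≤ z ∧ 5 / 4 * ((y : ℝ) - z) / 2 ^ n + 10 * scale k a y <
        (cnt (IsSuper T fun b => hash b ω) n z y : ℝ)) ?_
  · refine key.trans (ENNReal.ofReal_le_ofReal (le_trans (Real.exp_le_exp.2 ?_)
      (exp_scale_le (k := k) (a := a) (s := 1) hy (by linarith) (by linarith))))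
    have h1 := exp_two_fifths_le
    have h2 : 0 ≤ ((y : ℝ) - z) * (2 ^ n)⁻¹ := by
      have : (z : ℝ) ≤ y := by exact_mod_cast hz
      exact mul_nonneg (by linarith) (by positivity)
    have h3 : 0 ≤ scale k a y := by
      unfold scale
      have := Real.log_natCast_nonneg y
      positivity
    nlinarith
  · rintro ω ⟨-, hω⟩ sb hsb
    rw [← hsb] at hω
    have h0 : cnt sb n z z = 0 := cnt_eq_zero _ _ le_rfl
    simp only [h0, Nat.cast_zero]
    rw [div_eq_mul_inv, mul_assoc] at hω
    linarith

theorem UniformHashes.prob_not_top_le (H : UniformHashes Pr T hash) (hη : η ≤ 1 / 4) :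
    Pr {ω | ∃ n z y : ℕ, 1 ≤ y ∧ 2 ^ n ≤ 4 * y ∧ z ≤ y ∧
      3 * (k : ℝ) + 15 * y ≤ cnt (IsSuper T fun b => hash b ω) y 1 (2 ^ y)} ≤
      ENNReal.ofReal (unionConst * (Real.exp 2 * Real.exp (-η * k))) := by
  refine measure_exists_le (by positivity) _ fun n z y hy hn hz => ?_
  have key := H.chernoff y (le_refl 1) (Nat.one_le_two_pow (n := y)) 0 0 1 1 (3 * (k : ℝ) + 15 * y)
    (Or.inl le_rfl) (Or.inl le_rfl)
    (fun ω => 3 * (k : ℝ) + 15 * y ≤ cnt (IsSuper T fun b => hash b ω) y 1 (2 ^ y)) ?_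
  · refine key.trans (ENNReal.ofReal_le_ofReal ?_)
    have hy' : (0 : ℝ) < y := by exact_mod_cast hy
    rw [Real.rpow_def_of_pos hy', ← Real.exp_add, ← Real.exp_add]
    refine Real.exp_le_exp.2 ?_
    have h1 := Real.exp_one_lt_d9
    have h1' := Real.add_one_le_exp (1 : ℝ)
    have h2 := Real.log_le_sub_one_of_pos hy'
    have h3 : (0 : ℝ) ≤ k := by positivity
    have h4 : ((2 : ℝ) ^ y)⁻¹ * (((2 ^ y : ℕ) : ℝ) - ((1 : ℕ) : ℝ)) ≤ 1 := by
      rw [inv_mul_le_iff₀ (by positivity)]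
      push_cast
      linarith
    have h5 : ((2 : ℝ) ^ y)⁻¹ * (((2 ^ y : ℕ) : ℝ) - ((1 : ℕ) : ℝ)) * (Real.exp 1 - 1) ≤ 2 := by
      nlinarith
    have h6 : ((2 : ℝ) ^ y)⁻¹ * ((((1 : ℕ) : ℝ) - ((1 : ℕ) : ℝ)) * ((Real.exp 0 + Real.exp 0) / 2 - 1) +
        (((2 ^ y : ℕ) : ℝ) - ((1 : ℕ) : ℝ)) * ((Real.exp 1 + Real.exp 1) / 2 - 1)) =
        ((2 : ℝ) ^ y)⁻¹ * (((2 ^ y : ℕ) : ℝ) - ((1 : ℕ) : ℝ)) * (Real.exp 1 - 1) := by ring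
    rw [h6]
    nlinarith
  · intro ω hω sb hsb
    rw [← hsb] at hω
    have h0 : ∀ ν, cnt sb ν 1 1 = 0 := fun ν => cnt_eq_zero _ _ le_rfl
    simp only [h0, Nat.cast_zero]
    linarith

theorem UniformHashes.prob_not_quality_le (H : UniformHashes Pr T hash) {δ ε r : ℝ} (hδ : 0 < δ)
    (hδ' : δ < 1) (ha : 8 ≤ a * δ ^ 2) (hη : η ≤ δ ^ 2 / 4) (hε : ε ≤ 1 / 100)
    (hr : -2 * Real.log (1 - δ) * r ≤ δ ^ 2 / 80) :
    Pr {ω | ∃ n z c y, 1 ≤ y ∧ 2 ^ n ≤ 4 * y ∧ z ≤ c ∧ c ≤ y ∧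
      ((1 - ε) * scale k a y ≤ ((y : ℝ) - z) / 2 ^ n ∧
        (cnt (IsSuper T fun b => hash b ω) (n + 1) z c : ℝ) ≤ r * scale k a y ∧
        (cnt (IsSuper T fun b => hash b ω) n c y : ℝ) < (1 - δ) * (((y : ℝ) - z) / 2 ^ n))} ≤
      ENNReal.ofReal (unionConst * (2 * Real.exp (-η * k))) := by
  refine measure_exists_mid_le (Real.exp_pos _).le _ fun n z c y hy hn hz hc => ?_
  by_cases hlen : (1 - ε) * scale k a y ≤ ((y : ℝ) - z) / 2 ^ n
  swap
  · simp [hlen]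
  have hδ1 : 0 < 1 - δ := by linarith
  have hlog : Real.log (1 - δ) ≤ 0 := Real.log_nonpos hδ1.le (by linarith)
  set m := ((y : ℝ) - z) / 2 ^ n with hm
  -- On the missing part only level n+1 is penalised, by 2 log(1 - δ), so that (1 + (1 - δ)^2)/2 - 1
  -- = -δ + δ^2/2. This is also an upper bound for e^(-δ) - 1, the rate on [c, y). Both parts thus
  -- count equally towards the total length, wherever `c` lies.
  have key := H.chernoff n hz hc (2 * Real.log (1 - δ)) 0 (-δ) (-δ)
    (2 * Real.log (1 - δ) * (r * scale k a y) - δ * ((1 - δ) * m))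
    (Or.inr ⟨by linarith, le_rfl⟩) (Or.inr ⟨le_rfl, by linarith⟩)
    (fun ω => (1 - ε) * scale k a y ≤ m ∧
        (cnt (IsSuper T fun b => hash b ω) (n + 1) z c : ℝ) ≤ r * scale k a y ∧
        (cnt (IsSuper T fun b => hash b ω) n c y : ℝ) < (1 - δ) * m) ?_
  · refine key.trans (ENNReal.ofReal_le_ofReal (le_trans (Real.exp_le_exp.2 ?_)
      -- The exponent δ^2/2 * 19/20 times `a` must reach 27/8, which is where `a ≥ 8 / δ^2` enters.
      (exp_scale_le (k := k) (a := a) (s := δ ^ 2 / 2 * (19 / 20)) hy (by nlinarith) (by nlinarith))))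
    have h3 : 0 ≤ scale k a y := by
      unfold scale
      have := Real.log_natCast_nonneg y
      have : 0 ≤ a := by
        by_contra hneg
        push Not at hneg
        nlinarith [sq_nonneg δ]
      positivity
    have e1 : Real.exp (2 * Real.log (1 - δ)) = (1 - δ) ^ 2 := by
      rw [← Real.log_rpow hδ1, Real.exp_log (by positivity)]
      norm_num
    have e2 : Real.exp (-δ) ≤ 1 - δ + δ ^ 2 / 2 := by
      have h1 := Real.quadratic_le_exp_of_nonneg hδ.le
      rw [Real.exp_neg, inv_le_iff_one_le_mul₀ (Real.exp_pos _)]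
      nlinarith [sq_nonneg δ, sq_nonneg (δ ^ 2), mul_pos hδ hδ1]
    rw [e1, Real.exp_zero]
    have hp : (0 : ℝ) < (2 ^ n)⁻¹ := by positivity
    have hc' : (c : ℝ) ≤ y := by exact_mod_cast hc
    have hm' : m = (2 ^ n)⁻¹ * ((c : ℝ) - z) + (2 ^ n)⁻¹ * ((y : ℝ) - c) := by
      rw [hm, div_eq_inv_mul]; ring
    have h5 : (2 ^ n)⁻¹ * (((c : ℝ) - z) * ((1 + (1 - δ) ^ 2) / 2 - 1) +
        ((y : ℝ) - c) * ((Real.exp (-δ) + Real.exp (-δ)) / 2 - 1)) ≤ m * (-δ + δ ^ 2 / 2) := by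
      have h6 : (2 ^ n)⁻¹ * ((y : ℝ) - c) * (Real.exp (-δ) - 1) ≤
          (2 ^ n)⁻¹ * ((y : ℝ) - c) * (-δ + δ ^ 2 / 2) :=
        mul_le_mul_of_nonneg_left (by linarith) (mul_nonneg hp.le (by linarith))
      rw [hm']
      nlinarith
    have h7 : -2 * Real.log (1 - δ) * r * scale k a y ≤ δ ^ 2 / 80 * scale k a y :=
      mul_le_mul_of_nonneg_right hr h3
    have h8 : δ ^ 2 / 2 * ((99 / 100) * scale k a y) ≤ δ ^ 2 / 2 * m :=
      mul_le_mul_of_nonneg_left (by nlinarith) (by positivity)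
    have h9 : 0 ≤ δ ^ 2 * scale k a y := by positivity
    nlinarith
  · rintro ω ⟨-, h1, h2⟩ sb hsb
    rw [← hsb] at h1 h2
    have h3 : Real.log (1 - δ) * (r * scale k a y) ≤ Real.log (1 - δ) * cnt sb (n + 1) z c :=
      mul_le_mul_of_nonpos_left h1 hlog
    have h4 : δ * (cnt sb n c y : ℝ) ≤ δ * ((1 - δ) * m) := mul_le_mul_of_nonneg_left h2.le hδ.le
    linarith

theorem UniformHashes.prob_not_half_le (H : UniformHashes Pr T hash) {r : ℝ} (ha : 8 ≤ a)
    (hη : η ≤ 1 / 4) (hr : r ≤ 1 / 160) :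
    Pr {ω | ∃ n z y, 1 ≤ y ∧ 2 ^ n ≤ 4 * y ∧ z ≤ y ∧ (1 ≤ z ∧
      2 * scale k a y ≤ cnt (IsSuper T fun b => hash b ω) (n + 1) z y ∧
        (cnt (IsSuper T fun b => hash b ω) n z y : ℝ) <
          cnt (IsSuper T fun b => hash b ω) (n + 1) z y + r * scale k a y)} ≤
      ENNReal.ofReal (unionConst * Real.exp (-η * k)) := by
  refine measure_exists_le (Real.exp_pos _).le _ fun n z y hy hn hz => ?_
  by_cases hz1 : 1 ≤ z
  swap
  · simp [hz1]
  have hlog : 0 ≤ Real.log (7 / 4) := Real.log_nonneg (by norm_num)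
  have hlog4 : 0 ≤ Real.log 4 := Real.log_nonneg (by norm_num)
  -- Weights log(7/4) for level n+1 and -log 4 for exact level n satisfy (7/4 + 1/4)/2 = 1, so the
  -- bound does not depend on the length of the interval.
  have key := H.chernoff n (le_refl z) hz 0 0 (Real.log (7 / 4)) (-Real.log 4)
    (Real.log (7 / 4) * (2 * scale k a y) - Real.log 4 * (r * scale k a y)) (Or.inl hz1)
    (Or.inl hz1)
    (fun ω => 1 ≤ z ∧ 2 * scale k a y ≤ cnt (IsSuper T fun b => hash b ω) (n + 1) z y ∧
        (cnt (IsSuper T fun b => hash b ω) n z y : ℝ) <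
          cnt (IsSuper T fun b => hash b ω) (n + 1) z y + r * scale k a y) ?_
  · refine key.trans (ENNReal.ofReal_le_ofReal (le_trans (Real.exp_le_exp.2 ?_)
      (exp_scale_le (k := k) (a := a) (s := 4 / 5) hy (by linarith) (by linarith))))
    have h3 : 0 ≤ scale k a y := by
      unfold scale
      have := Real.log_natCast_nonneg y
      positivity
    have e1 : Real.exp (Real.log (7 / 4)) = 7 / 4 := Real.exp_log (by norm_num)
    have e2 : Real.exp (-Real.log 4) = 1 / 4 := by
      rw [Real.exp_neg, Real.exp_log (by norm_num)]; norm_num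
    rw [e1, e2]
    have h5 := Real.one_sub_inv_le_log_of_pos (show (0 : ℝ) < 7 / 4 by norm_num)
    have h6 := Real.log_le_sub_one_of_pos (show (0 : ℝ) < 4 by norm_num)
    have h7 : Real.log 4 * (r * scale k a y) ≤ 3 * (1 / 160 * scale k a y) := by
      have h8 : r * scale k a y ≤ 1 / 160 * scale k a y := mul_le_mul_of_nonneg_right hr h3
      have h9 : 0 ≤ 1 / 160 * scale k a y := by positivity
      nlinarith
    have h10 : 3 / 7 * (2 * scale k a y) ≤ Real.log (7 / 4) * (2 * scale k a y) := by
      refine mul_le_mul_of_nonneg_right ?_ (by positivity)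
      norm_num at h5 ⊢
      linarith
    norm_num
    linarith
  · rintro ω ⟨-, h1, h2⟩ sb hsb
    rw [← hsb] at h1 h2
    have h0 : ∀ ν, cnt sb ν z z = 0 := fun ν => cnt_eq_zero _ _ le_rfl
    simp only [h0, Nat.cast_zero]
    have h3 := mul_le_mul_of_nonneg_left h1 hlog
    have h4 := mul_le_mul_of_nonneg_left h2.le hlog4
    linarith

/-- 11 ≤ 2^(7/2) because 121 ≤ 128; the factor 128 is 4^(7/2). -/
theorem eleven_pow_le {μ y : ℕ} (hy : 1 ≤ y) (hμ : 2 ^ μ ≤ 4 * y) :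
    (11 : ℝ) ^ μ ≤ 128 * (y : ℝ) ^ (7 / 2 : ℝ) := by
  have h' : (2 : ℝ) ^ μ ≤ 4 * y := by exact_mod_cast hμ
  have h1 : (0 : ℝ) ≤ 4 * y := by positivity
  have h2 : (11 : ℝ) ^ μ ≤ ((2 : ℝ) ^ μ) ^ (7 / 2 : ℝ) := by
    rw [← Real.rpow_natCast 2 μ, ← Real.rpow_mul (by norm_num), mul_comm, Real.rpow_mul (by norm_num),
      Real.rpow_natCast]
    refine pow_le_pow_left₀ (by norm_num) ?_ _
    refine le_of_pow_le_pow_left₀ (n := 2) (by norm_num) (by positivity) ?_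
    rw [← Real.rpow_natCast (2 ^ (7 / 2 : ℝ)) 2, ← Real.rpow_mul (by norm_num)]
    norm_num
  refine h2.trans ?_
  calc ((2 : ℝ) ^ μ) ^ (7 / 2 : ℝ) ≤ (4 * (y : ℝ)) ^ (7 / 2 : ℝ) := by gcongr
    _ = 4 ^ (7 / 2 : ℝ) * (y : ℝ) ^ (7 / 2 : ℝ) := Real.mul_rpow (by norm_num) (by positivity)
    _ = _ := by
      congr 1
      rw [show (4 : ℝ) = 2 ^ (2 : ℝ) by norm_num, ← Real.rpow_mul (by norm_num)]
      norm_num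

theorem UniformHashes.prob_not_dominant_le (H : UniformHashes Pr T hash) {ε : ℝ} (ha : 8 ≤ a)
    (hη : η ≤ 1 / 4) (hε : ε ≤ 1 / 100) :
    Pr {ω | ∃ μ x y, 1 ≤ y ∧ 2 ^ μ ≤ 4 * y ∧ x ≤ y ∧ ∃ h, ∃ n : ℕ → ℕ, ∃ μ₁ < μ,
      (1 - ε) * scale k a y - μ - 1 ≤ ((∑ ν ∈ Finset.range (μ + 1), n ν : ℕ) : ℝ) ∧
        Survives (IsSuper T fun b => hash b ω) μ h (fullWord μ μ₁ n) x} ≤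
      ENNReal.ofReal (unionConst * (40000 * Real.exp (-η * k))) := by
  refine measure_exists_le (by positivity) _ fun μ x y hy hμ hx => ?_
  refine (H.prob_heavy_le μ x _).trans (ENNReal.ofReal_le_ofReal ?_)
  have hy' : (1 : ℝ) ≤ y := by exact_mod_cast hy
  have h3 : 0 ≤ scale k a y := by
    unfold scale
    have := Real.log_natCast_nonneg y
    positivity
  have h1 := level_le_rpow hy hμ
  have h2 := eleven_pow_le hy hμ
  have h4 : 5 * Real.exp (775 / 1000) ≤ 11 := by
    have h5 := Real.exp_one_lt_d9
    have h6 := Real.quadratic_le_exp_of_nonneg (show (0 : ℝ) ≤ 225 / 1000 by norm_num)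
    have h7 : Real.exp (775 / 1000) * Real.exp (225 / 1000) = Real.exp 1 := by
      rw [← Real.exp_add]; norm_num
    have h8 := Real.exp_pos (775 / 1000 : ℝ)
    norm_num at h6 ⊢
    nlinarith
  have h5 : (5 : ℝ) ^ (μ + 1) * Real.exp (-(775 / 1000) * ((1 - ε) * scale k a y - μ - 1)) ≤
      11 ^ (μ + 1) * Real.exp (-(767 / 1000) * scale k a y) := by
    calc (5 : ℝ) ^ (μ + 1) * Real.exp (-(775 / 1000) * ((1 - ε) * scale k a y - μ - 1))
        = (5 * Real.exp (775 / 1000)) ^ (μ + 1) *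
            Real.exp (-(775 / 1000) * ((1 - ε) * scale k a y)) := by
          rw [mul_pow, ← Real.exp_nat_mul, mul_assoc, ← Real.exp_add]
          congr 2
          push_cast
          ring
      _ ≤ 11 ^ (μ + 1) * Real.exp (-(767 / 1000) * scale k a y) := by
          refine mul_le_mul (pow_le_pow_left₀ (by positivity) h4 _) (Real.exp_le_exp.2 ?_)
            (Real.exp_pos _).le (by positivity)
          nlinarith
  -- With a ≥ 8, 767/1000 * a reaches 49/8 = 1/4 + 7/2 + 19/8: the powers spent on the factor μ, on
  -- 11^μ and on the union bound.
  have h6 := exp_scale_le (k := k) (a := a) (s := 767 / 1000) (η := η) (p := 49 / 8) hy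
    (by linarith) (by linarith)
  have h7 : (y : ℝ) ^ (1 / 4 : ℝ) * ((y : ℝ) ^ (7 / 2 : ℝ) * (y : ℝ) ^ (-(49 / 8) : ℝ)) =
      (y : ℝ) ^ (-(19 / 8) : ℝ) := by
    rw [← Real.rpow_add (by linarith), ← Real.rpow_add (by linarith)]
    norm_num
  calc 2 * (μ : ℝ) * 5 ^ (μ + 1) * Real.exp (-(775 / 1000) * ((1 - ε) * scale k a y - μ - 1))
      = 2 * (μ : ℝ) *
          (5 ^ (μ + 1) * Real.exp (-(775 / 1000) * ((1 - ε) * scale k a y - μ - 1))) := by ring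
    _ ≤ 2 * (13 * (y : ℝ) ^ (1 / 4 : ℝ)) *
          ((11 * (128 * (y : ℝ) ^ (7 / 2 : ℝ))) * (Real.exp (-η * k) * (y : ℝ) ^ (-(49 / 8) : ℝ))) := by
        refine mul_le_mul (by linarith) (h5.trans ?_) (by positivity) (by positivity)
        rw [pow_succ, mul_comm ((11 : ℝ) ^ μ)]
        gcongr
    _ = 36608 * Real.exp (-η * k) *
          ((y : ℝ) ^ (1 / 4 : ℝ) * ((y : ℝ) ^ (7 / 2 : ℝ) * (y : ℝ) ^ (-(49 / 8) : ℝ))) := by ring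
    _ ≤ _ := by
        rw [h7]
        gcongr
        norm_num

end

/-! ### The chain is typical with overwhelming probability -/

section

variable {sb : ℕ → ℕ → Prop} {k : ℕ} {a δ ε r : ℝ}

theorem one_le_scale_of (hk : 1 ≤ k) (ha : 8 ≤ a) (y : ℕ) : 1 ≤ scale k a y := by
  unfold scale
  have h1 := Real.log_natCast_nonneg y
  have h2 : (1 : ℝ) ≤ k := by exact_mod_cast hk
  nlinarith

/-- Upper bounds on the numbers of superblocks carry over to levels that are too high for the
chain, and to intervals that begin with genesis. -/
theorem upper_of_low_levels (hk : 1 ≤ k) (ha : 8 ≤ a)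
    (hanti : ∀ μ ν b, μ ≤ ν → sb ν b → sb μ b)
    (h : ∀ n z y : ℕ, 1 ≤ y → 2 ^ n ≤ 4 * y → z ≤ y → 1 ≤ z →
      (cnt sb n z y : ℝ) ≤ 5 / 4 * ((y : ℝ) - z) / 2 ^ n + 10 * scale k a y)
    (ν i j : ℕ) (hij : i ≤ j) (hj : 1 ≤ j) :
    (cnt sb ν i j : ℝ) ≤ 5 / 4 * ((j : ℝ) - i) / 2 ^ ν + 12 * scale k a j := by
  have hs := one_le_scale_of hk ha j
  set i' := max i 1 with hi'
  have h1 : (cnt sb ν i j : ℝ) ≤ cnt sb ν i' j + 1 := by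
    have h2 : cnt sb ν i j = cnt sb ν i i' + cnt sb ν i' j :=
      (cnt_add sb ν (le_max_left _ _) (max_le hij hj)).symm
    have h3 := cnt_le sb ν i i'
    have h4 : cnt sb ν i j ≤ cnt sb ν i' j + 1 := by omega
    exact_mod_cast h4
  have hii : (i : ℝ) ≤ i' := by exact_mod_cast le_max_left i 1
  have hij' : (i : ℝ) ≤ j := by exact_mod_cast hij
  have h0 : 0 ≤ 5 / 4 * ((j : ℝ) - i) / 2 ^ ν := div_nonneg (by linarith) (by positivity)
  by_cases hν : 2 ^ ν ≤ 4 * j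
  · have h2 := h ν i' j hj hν (max_le hij hj) (le_max_right _ _)
    have h3 : 5 / 4 * ((j : ℝ) - i') / 2 ^ ν ≤ 5 / 4 * ((j : ℝ) - i) / 2 ^ ν := by gcongr
    linarith
  -- A level too high for the chain is compared with the highest admissible one, where the expected
  -- count is below 1. This and genesis account for the step from 10 to 12.
  · set m := Nat.log 2 (4 * j) with hm
    have hm1 : 2 ^ m ≤ 4 * j := Nat.pow_log_le_self 2 (by omega)
    have hm2 : 4 * j < 2 ^ (m + 1) := Nat.lt_pow_succ_log_self (by norm_num) _
    have hmν : m ≤ ν := by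
      by_contra hlt
      exact hν ((Nat.pow_le_pow_right (by norm_num) (by omega)).trans hm1)
    have h2 := h m i' j hj hm1 (max_le hij hj) (le_max_right _ _)
    have h3 : (cnt sb ν i' j : ℝ) ≤ cnt sb m i' j := by exact_mod_cast cnt_anti hanti hmν i' j
    have h4 : 5 / 4 * ((j : ℝ) - i') / 2 ^ m ≤ 1 := by
      rw [div_le_one (by positivity)]
      have h5 : (4 * j : ℝ) < 2 ^ m * 2 := by rw [← pow_succ]; exact_mod_cast hm2
      have h6 : (0 : ℝ) ≤ i' := by positivity
      linarith
    linarith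

theorem lower_of_low_levels (hk : 1 ≤ k) (ha : 8 ≤ a)
    (h : ∀ n z y : ℕ, 1 ≤ y → 2 ^ n ≤ 4 * y → z ≤ y →
      (y : ℝ) - z ≤ 5 / 4 * 2 ^ n * (cnt sb n z y : ℝ) + 10 * 2 ^ n * scale k a y)
    (ν i j : ℕ) (hij : i ≤ j) (hj : 1 ≤ j) :
    (j : ℝ) - i ≤ 5 / 4 * 2 ^ ν * cnt sb ν i j + 10 * 2 ^ ν * scale k a j := by
  by_cases hν : 2 ^ ν ≤ 4 * j
  · exact h ν i j hj hν hij
  · have hs := one_le_scale_of hk ha j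
    have h1 : (4 * j : ℝ) < 2 ^ ν := by exact_mod_cast not_le.1 hν
    have h2 : (0 : ℝ) ≤ i := by positivity
    have h3 : (0 : ℝ) ≤ 5 / 4 * 2 ^ ν * cnt sb ν i j := by positivity
    have h4 : (0 : ℝ) < 2 ^ ν := by positivity
    nlinarith

end

theorem unionConst_nonneg : 0 ≤ unionConst :=
  mul_nonneg (by norm_num) (tsum_nonneg fun _ => by positivity)

section

variable {Ω : Type*} [MeasurableSpace Ω] {Pr : Measure Ω} {T : ℕ}
  {hash : ℕ → Ω → ℝ} {k : ℕ} {a δ ε r η : ℝ}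

theorem UniformHashes.prob_not_valid [IsProbabilityMeasure Pr] (H : UniformHashes Pr T hash) :
    Pr {ω | ∃ b, ¬ IsSuper T (fun b => hash b ω) 0 b} = 0 := by
  have h : ∀ᵐ ω ∂Pr, ∀ b, IsSuper T (fun b => hash b ω) 0 b := by
    rw [ae_all_iff]
    intro b
    rcases Nat.eq_zero_or_pos b with rfl | hb
    · exact Filter.Eventually.of_forall fun ω => Or.inl rfl
    · refine (prob_compl_eq_zero_iff (H.measurableSet_super 0 b)).2 ?_
      rw [H.prob_super 0 hb]
      simp
  rw [ae_iff] at h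
  convert h using 3
  simp

/-- The constant 40020 adds 1 + 1 + 1 + 14 + 2 + 1 + 40000, with e^2 ≤ 14 for the event about new
levels; validity of the hashes fails with probability 0. -/
theorem UniformHashes.prob_not_typical_le [IsProbabilityMeasure Pr]
    (H : UniformHashes Pr T hash) (hk : 1 ≤ k) (ha : 8 ≤ a)
    (hδ : 0 < δ) (hδ' : δ < 1) (haδ : 8 ≤ a * δ ^ 2) (hη : η ≤ δ ^ 2 / 4) (hε : ε ≤ 1 / 100)
    (hr : -2 * Real.log (1 - δ) * r ≤ δ ^ 2 / 80) (hr' : r ≤ 1 / 160) :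
    Pr {ω | ¬ Typical (IsSuper T fun b => hash b ω) k a δ ε r} ≤
      ENNReal.ofReal (unionConst * (40020 * Real.exp (-η * k))) := by
  have hη' : η ≤ 1 / 4 := by nlinarith
  have b0 := H.prob_not_valid
  have b1 := H.prob_not_lower_le (k := k) ha hη'
  have b2 := H.prob_not_upper_le (k := k) ha hη'
  have b3 := H.prob_not_level_le (k := k) ha hη'
  have b4 := H.prob_not_top_le (k := k) hη'
  have b5 := H.prob_not_quality_le (k := k) (a := a) hδ hδ' haδ hη hε hr
  have b6 := H.prob_not_half_le (k := k) ha hη' hr'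
  have b7 := H.prob_not_dominant_le (k := k) ha hη' hε
  set E0 := {ω | ∃ b, ¬ IsSuper T (fun b => hash b ω) 0 b} with hE0
  set E1 := {ω | ∃ n z y, 1 ≤ y ∧ 2 ^ n ≤ 4 * y ∧ z ≤ y ∧
      5 / 4 * 2 ^ n * (cnt (IsSuper T fun b => hash b ω) n z y : ℝ) + 10 * 2 ^ n * scale k a y <
        (y : ℝ) - z} with hE1
  set E2 := {ω | ∃ n z y : ℕ, 1 ≤ y ∧ 2 ^ n ≤ 4 * y ∧ z ≤ y ∧ (1 ≤ z ∧
      5 / 4 * ((y : ℝ) - z) / 2 ^ n + 10 * scale k a y <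
        (cnt (IsSuper T fun b => hash b ω) n z y : ℝ))} with hE2
  set E3 := {ω | ∃ n z y : ℕ, 1 ≤ y ∧ 2 ^ n ≤ 4 * y ∧ z ≤ y ∧
      IsSuper T (fun b => hash b ω) (⌊4 * scale k a y⌋₊ + 1) y} with hE3
  set E4 := {ω | ∃ n z y : ℕ, 1 ≤ y ∧ 2 ^ n ≤ 4 * y ∧ z ≤ y ∧
      3 * (k : ℝ) + 15 * y ≤ cnt (IsSuper T fun b => hash b ω) y 1 (2 ^ y)} with hE4
  set E5 := {ω | ∃ n z c y, 1 ≤ y ∧ 2 ^ n ≤ 4 * y ∧ z ≤ c ∧ c ≤ y ∧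
      ((1 - ε) * scale k a y ≤ ((y : ℝ) - z) / 2 ^ n ∧
        (cnt (IsSuper T fun b => hash b ω) (n + 1) z c : ℝ) ≤ r * scale k a y ∧
        (cnt (IsSuper T fun b => hash b ω) n c y : ℝ) < (1 - δ) * (((y : ℝ) - z) / 2 ^ n))} with hE5
  set E6 := {ω | ∃ n z y, 1 ≤ y ∧ 2 ^ n ≤ 4 * y ∧ z ≤ y ∧ (1 ≤ z ∧
      2 * scale k a y ≤ cnt (IsSuper T fun b => hash b ω) (n + 1) z y ∧
        (cnt (IsSuper T fun b => hash b ω) n z y : ℝ) <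
          cnt (IsSuper T fun b => hash b ω) (n + 1) z y + r * scale k a y)} with hE6
  set E7 := {ω | ∃ μ x y, 1 ≤ y ∧ 2 ^ μ ≤ 4 * y ∧ x ≤ y ∧ ∃ h, ∃ n : ℕ → ℕ, ∃ μ₁ < μ,
      (1 - ε) * scale k a y - μ - 1 ≤ ((∑ ν ∈ Finset.range (μ + 1), n ν : ℕ) : ℝ) ∧
        Survives (IsSuper T fun b => hash b ω) μ h (fullWord μ μ₁ n) x} with hE7
  have hsub : {ω | ¬ Typical (IsSuper T fun b => hash b ω) k a δ ε r} ⊆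
      E0 ∪ (E1 ∪ (E2 ∪ (E3 ∪ (E4 ∪ (E5 ∪ (E6 ∪ E7)))))) := by
    intro ω hω
    by_contra hout
    simp only [Set.mem_union, not_or] at hout
    obtain ⟨n0, n1, n2, n3, n4, n5, n6, n7⟩ := hout
    refine hω ?_
    have hanti := isSuper_anti T (fun b => hash b ω)
    refine ⟨hanti, fun μ => Or.inl rfl, fun b => ?_, fun ν j hj hν => ?_,
      lower_of_low_levels hk ha fun n z y hy hn hz => ?_,
      upper_of_low_levels hk ha hanti fun n z y hy hn hz hz1 => ?_, fun ν hν => ?_,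
      fun n z c y hz hc hy hn h1 h2 => ?_, fun n c y hc hcy hn h1 => ?_,
      fun μ i j y g hj hy hμ hg => ?_⟩
    · by_contra hb
      exact n0 ⟨b, hb⟩
    · by_contra hlt
      push Not at hlt
      have hs := one_le_scale_of hk ha j
      refine n3 ⟨0, 0, j, hj, by omega, Nat.zero_le _, hanti _ ν j ?_ hν⟩
      exact (Nat.floor_lt (by linarith)).2 hlt
    · by_contra hlt
      exact n1 ⟨n, z, y, hy, hn, hz, not_le.1 hlt⟩
    · by_contra hlt
      exact n2 ⟨n, z, y, hy, hn, hz, hz1, not_le.1 hlt⟩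
    · by_contra hlt
      exact n4 ⟨0, 0, ν, hν, by omega, Nat.zero_le _, not_lt.1 hlt⟩
    · by_contra hlt
      exact n5 ⟨n, z, c, y, hy, hn, hz, hc, h1, h2, not_le.1 hlt⟩
    · by_contra hlt
      exact n6 ⟨n, c, y, hc.trans hcy, hn, hcy, hc, h1, not_le.1 hlt⟩
    · have hs := one_le_scale_of hk ha y
      refine dominant_of_not_survives hanti hj (by nlinarith) fun x hx h n μ₁ hμ₁ hG hS => ?_
      exact n7 ⟨μ, x, y, hy, hμ, hx, h, n, μ₁, hμ₁, by linarith, hS⟩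
  have hU := unionConst_nonneg
  have hadd : ∀ {A B : Set Ω} {u v : ℝ}, 0 ≤ v → Pr A ≤ ENNReal.ofReal (unionConst * u) → 0 ≤ u →
      Pr B ≤ ENNReal.ofReal (unionConst * v) →
      Pr (A ∪ B) ≤ ENNReal.ofReal (unionConst * (u + v)) := by
    intro A B u v hv hA hu hB
    refine (measure_union_le _ _).trans ((add_le_add hA hB).trans (le_of_eq ?_))
    rw [← ENNReal.ofReal_add (by positivity) (by positivity), mul_add]
  have hE : Pr (E0 ∪ (E1 ∪ (E2 ∪ (E3 ∪ (E4 ∪ (E5 ∪ (E6 ∪ E7))))))) ≤ _ :=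
    hadd (by positivity) (b0.le.trans zero_le : _ ≤ ENNReal.ofReal (unionConst * 0)) le_rfl
      (hadd (by positivity) b1 (by positivity)
        (hadd (by positivity) b2 (by positivity)
          (hadd (by positivity) b3 (by positivity)
            (hadd (by positivity) b4 (by positivity)
              (hadd (by positivity) b5 (by positivity)
                (hadd (by positivity) b6 (by positivity) b7))))))
  refine (measure_mono hsub).trans (hE.trans (ENNReal.ofReal_le_ofReal ?_))
  refine mul_le_mul_of_nonneg_left ?_ hU
  have h2 : Real.exp 2 ≤ 14 := by
    have h3 : Real.exp 2 = Real.exp 1 ^ 2 := by rw [← Real.exp_nat_mul]; norm_num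
    rw [h3]
    have h4 := Real.exp_one_lt_d9
    have h5 := Real.exp_pos 1
    nlinarith
  have h6 := mul_le_mul_of_nonneg_right h2 (Real.exp_pos (-η * k)).le
  linarith

/-- The hashes of honestly mined blocks agree almost surely with measurable ones. -/
theorem HonestMining.exists_uniformHashes {rate : ℝ≥0} {N : ℝ≥0 → Ω → ℕ}
    (H : HonestMining Pr rate T N hash) :
    ∃ hash', UniformHashes Pr T hash' ∧ ∀ᵐ ω ∂Pr, ∀ b, hash b ω = hash' b ω := by
  have hvol : (volume : Measure ℝ) (Set.Icc 0 (((2 : ℝ) ^ T)⁻¹)) =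
      ENNReal.ofReal (((2 : ℝ) ^ T)⁻¹) := by
    rw [Real.volume_Icc, sub_zero]
  have hpos : (0 : ℝ) < ((2 : ℝ) ^ T)⁻¹ := by positivity
  have hne : (volume : Measure ℝ) (Set.Icc 0 (((2 : ℝ) ^ T)⁻¹)) ≠ 0 := by
    rw [hvol]; simp
  have hnt : (volume : Measure ℝ) (Set.Icc 0 (((2 : ℝ) ^ T)⁻¹)) ≠ ⊤ := by
    rw [hvol]; exact ENNReal.ofReal_ne_top
  have hm : ∀ b, AEMeasurable (hash b) Pr := fun b => (H.uniform b).aemeasurable hne hnt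
  refine ⟨fun b => (hm b).mk (hash b), ⟨fun b => (hm b).measurable_mk,
    H.indep_hash.congr fun b => (hm b).ae_eq_mk, fun b ν => ?_⟩,
    ae_all_iff.2 fun b => (hm b).ae_eq_mk⟩
  have h1 : Pr {ω | (hm b).mk (hash b) ω ≤ ((2 : ℝ) ^ (T + ν))⁻¹} =
      Pr (hash b ⁻¹' Set.Iic (((2 : ℝ) ^ (T + ν))⁻¹)) := by
    refine measure_congr ?_
    filter_upwards [(hm b).ae_eq_mk] with ω hω
    refine propext ?_
    change (hm b).mk (hash b) ω ≤ _ ↔ hash b ω ≤ _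
    rw [hω]
  have hle : ((2 : ℝ) ^ (T + ν))⁻¹ ≤ (2 ^ T)⁻¹ :=
    inv_anti₀ (by positivity) (pow_le_pow_right₀ (by norm_num) (by omega))
  have h2 : Set.Icc 0 (((2 : ℝ) ^ T)⁻¹) ∩ Set.Iic (((2 : ℝ) ^ (T + ν))⁻¹) =
      Set.Icc 0 (((2 : ℝ) ^ (T + ν))⁻¹) := by
    ext x
    simp only [Set.mem_inter_iff, Set.mem_Icc, Set.mem_Iic]
    constructor
    · rintro ⟨h, h'⟩; exact ⟨h.1, h'⟩
    · rintro ⟨h, h'⟩; exact ⟨⟨h, h'.trans hle⟩, h'⟩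
  rw [h1, (H.uniform b).measure_preimage hne hnt measurableSet_Iic, h2, Real.volume_Icc,
    Real.volume_Icc, sub_zero, sub_zero, ← ENNReal.ofReal_div_of_pos hpos]
  congr 1
  rw [pow_add]
  field_simp

end

/-! ### Choice of the constants -/

theorem exists_log_le {a ε M : ℝ} (ha : 0 < a) (hε : 0 < ε) (hM : 0 < M) :
    ∃ k₀ : ℕ, ∀ x : ℝ, (k₀ : ℝ) ≤ x → a * Real.log (M * x) ≤ ε * x := by
  have h1 := Real.isLittleO_log_id_atTop.bound (show 0 < ε / (2 * a) by positivity)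
  have h2 := Filter.eventually_ge_atTop (2 * (a * Real.log M) / ε)
  obtain ⟨x₀, hx₀⟩ := Filter.eventually_atTop.1 ((h1.and h2).and (Filter.eventually_gt_atTop 0))
  refine ⟨⌈x₀⌉₊, fun x hx => ?_⟩
  obtain ⟨⟨h3, h4⟩, h5⟩ := hx₀ x ((Nat.le_ceil x₀).trans hx)
  rw [Real.log_mul hM.ne' h5.ne']
  simp only [id, Real.norm_eq_abs, abs_of_pos h5] at h3
  have h6 := mul_le_mul_of_nonneg_left ((le_abs_self _).trans h3) ha.le
  have h7 : a * (ε / (2 * a) * x) = ε * x / 2 := by field_simp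
  rw [div_le_iff₀ hε] at h4
  linarith

theorem exists_regime {a c δ : ℝ} (hδ : 0 < δ) (hδ' : δ < 1) (ha : 8 / δ ^ 2 ≤ a) (hc : 3 < c)
    {Q : ℕ} (hQ : 1 ≤ Q) : ∃ (ε r : ℝ) (k₀ : ℕ), ε ≤ 1 / 100 ∧
      -2 * Real.log (1 - δ) * r ≤ δ ^ 2 / 80 ∧ r ≤ 1 / 160 ∧
      ∀ k k' : ℕ, k₀ ≤ k → Regime ⟨k, k', a, c, δ, Q⟩ ε r := by
  have ha8 : 8 ≤ a := by
    refine le_trans ?_ ha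
    rw [le_div_iff₀ (by positivity)]
    nlinarith
  have hlog : Real.log (1 - δ) < 0 := Real.log_neg (by linarith) (by linarith)
  set φ := -2 * Real.log (1 - δ) with hφ
  have hφ0 : 0 < φ := by linarith
  -- The second entry makes r = 4cε small enough for superquality to tolerate the missing part, the
  -- third gives r ≤ 1/160 for the comparison of adjacent levels.
  set ε := min (1 / 100) (min (δ ^ 2 / (320 * c * φ)) (1 / (640 * c))) with hε
  have hε0 : 0 < ε := by positivity
  have h1 : ε ≤ 1 / 100 := min_le_left _ _
  have h2 : ε ≤ δ ^ 2 / (320 * c * φ) := (min_le_right _ _).trans (min_le_left _ _)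
  have h3 : ε ≤ 1 / (640 * c) := (min_le_right _ _).trans (min_le_right _ _)
  obtain ⟨k₁, hk₁⟩ := exists_log_le (M := 300 + 10 * (Q : ℝ) + 4 * c) (by linarith : 0 < a) hε0
    (by positivity)
  refine ⟨ε, 4 * c * ε, max (max k₁ 1) ⌈1 / ε⌉₊, h1, ?_, ?_, fun k k' hk => ?_⟩
  · rw [le_div_iff₀ (by positivity)] at h2
    linarith
  · rw [le_div_iff₀ (by positivity)] at h3
    linarith
  · have hk1 : k₁ ≤ k := by omega
    have hk2 : (1 : ℝ) / ε ≤ k := (Nat.le_ceil _).trans (by exact_mod_cast (by omega : ⌈1 / ε⌉₊ ≤ k))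
    rw [div_le_iff₀ hε0] at hk2
    exact ⟨hδ, hδ', ha8, hc, hQ, hε0, h1, rfl, by show 1 ≤ k; omega,
      by show 1 ≤ ε * (k : ℝ); linarith,
      fun x hx => hk₁ x (le_trans (by exact_mod_cast hk1) hx)⟩

end HybridNode

theorem theorem3 (a c δ : ℝ) (hδ : 0 < δ) (hδ' : δ < 1) (ha : 8 / δ ^ 2 ≤ a) (hc : 3 < c)
    (Q : ℕ) (hQ : 1 ≤ Q) (hdr link txMax : ℕ) :
    ∃ K C η : ℝ, 0 < η ∧
      ∀ (k k' T : ℕ) (rate : ℝ≥0) (Ω : Type*) [MeasurableSpace Ω] (Pr : Measure Ω)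
        [IsProbabilityMeasure Pr] (N : ℝ≥0 → Ω → ℕ) (hash : ℕ → Ω → ℝ) (tx : ℕ → Ω → ℕ),
        0 < rate → HybridNode.HonestMining Pr rate T N hash → (∀ b ω, tx b ω ≤ txMax) →
        Pr {ω | ¬ ∀ t : ℝ≥0,
            let sb := HybridNode.IsSuper T (fun b => hash b ω)
            let st := HybridNode.node sb ⟨k, k', a, c, δ, Q⟩ (N t ω)
            let B : ℕ := N t ω + 1
            let L : ℝ := k + k' + Real.log B
            (HybridNode.storage sb hdr link (fun b => tx b ω) st : ℝ) ≤ K * L ^ 4 ∧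
            (st.top : ℝ) ≤ K * L ∧
            (∀ μ, ((st.levelRange μ).card : ℝ) ≤ K * L ^ 2) ∧
            (st.tail.card : ℝ) ≤ K * L ∧
            (∀ b < B, (HybridNode.interlinkSize sb b : ℝ) ≤ K * L)}
          ≤ ENNReal.ofReal (C * Real.exp (-η * k)) := by
  obtain ⟨ε, r, k₀, hε, hr, hr', hreg⟩ := HybridNode.exists_regime hδ hδ' ha hc hQ
  obtain ⟨K, hK⟩ := HybridNode.exists_storage_bound a c Q hdr link txMax
  have hδ2 : 0 < δ ^ 2 / 4 := by positivity
  have hU := HybridNode.unionConst_nonneg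
  -- The second summand of `C` makes the bound at least 1 for `k` below the threshold `k₀`, where
  -- nothing needs proof. The rate δ^2/4 is dictated by superquality.
  refine ⟨K, HybridNode.unionConst * 40020 + Real.exp (δ ^ 2 / 4 * k₀), δ ^ 2 / 4, hδ2, ?_⟩
  intro k k' T rate Ω _ Pr _ N hash tx _ H htx
  by_cases hk : k₀ ≤ k
  · have R := hreg k k' hk
    obtain ⟨hash', H', hae⟩ := H.exists_uniformHashes
    have haδ : 8 ≤ a * δ ^ 2 := by rwa [div_le_iff₀ (by positivity)] at ha
    have key := H'.prob_not_typical_le (k := k) (ε := ε) (r := r) R.k_pos R.a_ge hδ hδ' haδ le_rfl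
      hε hr hr'
    refine le_trans (le_trans (measure_mono_ae ?_) key) (ENNReal.ofReal_le_ofReal ?_)
    -- Typicality concerns the whole hash sequence and `hK` covers every chain length, so one
    -- outcome serves all times.
    · filter_upwards [hae] with ω hω hbad htyp
      refine hbad fun t => ?_
      have hhash : (fun b => hash b ω) = fun b => hash' b ω := funext hω
      rw [← hhash] at htyp
      exact hK ⟨k, k', a, c, δ, Q⟩ ε r _ (fun b => tx b ω) (N t ω) rfl rfl rfl R htyp
        fun b => htx b ω
    · have := Real.exp_pos (δ ^ 2 / 4 * k₀)
      have := Real.exp_pos (-(δ ^ 2 / 4) * k)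
      nlinarith
  · refine prob_le_one.trans ?_
    rw [← ENNReal.ofReal_one]
    refine ENNReal.ofReal_le_ofReal ?_
    have hk' : (k : ℝ) ≤ k₀ := by exact_mod_cast (not_le.1 hk).le
    have h1 : 1 ≤ Real.exp (δ ^ 2 / 4 * k₀) * Real.exp (-(δ ^ 2 / 4) * k) := by
      rw [← Real.exp_add]
      refine Real.one_le_exp ?_
      nlinarith
    have h2 : 0 ≤ HybridNode.unionConst * 40020 * Real.exp (-(δ ^ 2 / 4) * k) := by positivity
    linarith
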